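/- Let $\Delta>0$ and let $P_0$ be a probability measure on $\mathbb R$ with support in $[-M,M]$. For integers $n,K\ge 1$, let $\Theta$ consist of independent random variables: $S_1,\dots,S_n\sim P_0$ and standard Gaussians $Z^{(l)}_{ij}$ ($1\le i\le j\le n$), $\widetilde Z^{(l)}_i$, $\widehat Z_i$ ($1\le i\le n$, $1\le l\le K$). For $x,s\in\mathbb R^n$ and a signal-to-noise ratio $\gamma\ge 0$ put $$h(x,s,z;\gamma)=\sum_{1\le i\le j\le n}\Big(\gamma\frac{x_i^2x_j^2}{2n}-\gamma\frac{x_ix_js_is_j}{n}-\sqrt{\gamma}\,\frac{x_ix_jz_{ij}}{\sqrt n}\Big),\qquad h_{\rm mf}(x,s,\widetilde z;\gamma)=\sum_{i=1}^n\Big(\gamma\frac{x_i^2}{2}-\gamma x_is_i-\sqrt\gamma\,x_i\widetilde z_i\Big).$$ For trial parameters $m_1,\dots,m_K\ge 0$, $k\in\{1,\dots,K\}$, $t\in[0,1]$ and $\epsilon\in(0,1)$ let $$\mathcal H_{k,t;\epsilon}(x)=\sum_{l=k+1}^{K}h\big(x,S,Z^{(l)};\tfrac{1}{K\Delta}\big)+\sum_{l=1}^{k-1}h_{\rm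 mf}\big(x,S,\widetilde Z^{(l)};\tfrac{m_l}{K\Delta}\big)+h\big(x,S,Z^{(k)};\tfrac{1-t}{K\Delta}\big)+h_{\rm mf}\big(x,S,\widetilde Z^{(k)};\tfrac{t\,m_k}{K\Delta}\big)+h_{\rm mf}\big(x,S,\widehat Z;\epsilon\big),$$ let $\langle\cdot\rangle_{k,t;\epsilon}$ be the expectation over $X$ under the (random) probability measure on $\mathbb R^n$ proportional to $e^{-\mathcal H_{k,t;\epsilon}(x)}\prod_i P_0(dx_i)$, let $\mathbb E$ be the expectation over $\Theta$, and let $q=\frac1n\sum_{i=1}^n X_iS_i$ be the overlap. Then for every $0<\alpha<1/4$ there is a constant $C>0$, depending only on $\Delta$, $\alpha$, $M$ and the second moment of $P_0$, such that for all sequences $K_n\to\infty$ and $0<a_n<b_n<1$, all families of trial parameters $m_k=m_k^{(n)}(\epsilon)$, $1\le k\le K_n$, each of which is a nonnegative, differentiable, bounded and non-decreasing function of $\epsilon\in(0,1)$, and all $n\ge 1$, $$\int_{a_n}^{b_n}d\epsilon\,\frac1{K_n}\sum_{k=1}^{K_n}\int_0^1dt\,\mathbb E\Big[\Big\langle\big(q-\mathbb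 E[\langle q\rangle_{k,t;\epsilon}]\big)^2\Big\rangle_{k,t;\epsilon}\Big]\le\frac{C}{a_n^2\,n^{\alpha}}.$$ In particular $C$ does not depend on $n$, $K_n$, $a_n$, $b_n$ or the trial parameters. -/

import Mathlib

open MeasureTheory ProbabilityTheory Filter Set

noncomputable section

namespace RankOne

/-- Index set of the independent entries `i ≤ j` of a symmetric `n × n` matrix. -/
abbrev UpperPairs (n : ℕ) : Type := {p : Fin n × Fin n // p.1 ≤ p.2}

/-- Quenched variables `θ = (s, (z⁽ᵏ⁾)ₖ, (z̃⁽ᵏ⁾)ₖ, ẑ)`. -/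
abbrev Quenched (n K : ℕ) : Type :=
  (Fin n → ℝ) × (Fin K → UpperPairs n → ℝ) × (Fin K → Fin n → ℝ) × (Fin n → ℝ)

/-- Law of the quenched variables: the coordinates of `s` are i.i.d. with law `P₀`, all the noise
variables are i.i.d. standard Gaussians, independent of `s`. -/
def quenchedLaw (P₀ : Measure ℝ) (n K : ℕ) : Measure (Quenched n K) :=
  (Measure.pi fun _ => P₀).prod
    ((Measure.pi fun _ => Measure.pi fun _ => gaussianReal 0 1).prod
      ((Measure.pi fun _ => Measure.pi fun _ => gaussianReal 0 1).prod
        (Measure.pi fun _ => gaussianReal 0 1)))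

/-- Hamiltonian `h(x, s, z, σ²)` of the rank-one matrix channel `s sᵀ / √n + σ z`,
written with the signal-to-noise ratio `γ = 1 / σ²` (so `γ = 0` is `σ² = ∞`):
`γ ∑_{i ≤ j} (x_i² x_j² / (2n) - x_i x_j s_i s_j / n - x_i x_j z_ij / √(γ n))`. -/
def hMat {n : ℕ} (x s : Fin n → ℝ) (z : UpperPairs n → ℝ) (γ : ℝ) : ℝ :=
  ∑ p : UpperPairs n,
    (γ * (x p.1.1 ^ 2 * x p.1.2 ^ 2 / (2 * n) - x p.1.1 * x p.1.2 * (s p.1.1 * s p.1.2) / n)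
      - √γ * (x p.1.1 * x p.1.2 * z p) / √(n : ℝ))

/-- Mean-field Hamiltonian `h_mf(x, s, z̃, σ²)` of the scalar channels `s_i + σ z̃_i`,
written with the signal-to-noise ratio `γ = 1 / σ²`:
`γ ∑_i (x_i² / 2 - x_i s_i - x_i z̃_i / √γ)`. -/
def hMf {n : ℕ} (x s zt : Fin n → ℝ) (γ : ℝ) : ℝ :=
  ∑ i, (γ * (x i ^ 2 / 2 - x i * s i) - √γ * (x i * zt i))

/-- The perturbed `(k, t)`-interpolating Hamiltonian `H_{k,t;ε}(x; θ)` with noise variance `Δ` and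
values `m` of the trial parameters; the `K` steps are indexed by `Fin K`. -/
def hamiltonian {n K : ℕ} (Δ : ℝ) (m : Fin K → ℝ) (k : Fin K) (t ε : ℝ)
    (θ : Quenched n K) (x : Fin n → ℝ) : ℝ :=
  (∑ l ∈ Finset.Ioi k, hMat x θ.1 (θ.2.1 l) (1 / (K * Δ)))
    + (∑ l ∈ Finset.Iio k, hMf x θ.1 (θ.2.2.1 l) (m l / (K * Δ)))
    + hMat x θ.1 (θ.2.1 k) ((1 - t) / (K * Δ))
    + hMf x θ.1 (θ.2.2.1 k) (t * m k / (K * Δ))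
    + hMf x θ.1 θ.2.2.2 ε

/-- The posterior `P_{k,t;ε}(dx | θ)`, proportional to `e^{-H_{k,t;ε}(x; θ)} ∏ᵢ P₀(dxᵢ)`. -/
def gibbsPosterior (P₀ : Measure ℝ) {n K : ℕ} (Δ : ℝ) (m : Fin K → ℝ) (k : Fin K) (t ε : ℝ)
    (θ : Quenched n K) : Measure (Fin n → ℝ) :=
  (Measure.pi fun _ : Fin n => P₀).tilted fun x => -hamiltonian Δ m k t ε θ x

/-- The average `𝔼⟨g(X, S)⟩_{k,t;ε}` over the posterior and then the quenched variables. -/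
def quenchedGibbs (P₀ : Measure ℝ) {n K : ℕ} (Δ : ℝ) (m : Fin K → ℝ) (k : Fin K) (t ε : ℝ)
    (g : (Fin n → ℝ) → (Fin n → ℝ) → ℝ) : ℝ :=
  ∫ θ, (∫ x, g x θ.1 ∂(gibbsPosterior P₀ Δ m k t ε θ)) ∂(quenchedLaw P₀ n K)

/-- The overlap `q_{x,s} = n⁻¹ ∑ᵢ xᵢ sᵢ`. -/
def overlap {n : ℕ} (x s : Fin n → ℝ) : ℝ := (∑ i, x i * s i) / n

/-- `𝔼⟨(q - 𝔼⟨q⟩_{k,t;ε})²⟩_{k,t;ε}`. -/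
def overlapVariance (P₀ : Measure ℝ) (n : ℕ) {K : ℕ} (Δ : ℝ) (m : Fin K → ℝ) (k : Fin K)
    (t ε : ℝ) : ℝ :=
  quenchedGibbs P₀ (n := n) Δ m k t ε fun x s =>
    (overlap x s - quenchedGibbs P₀ (n := n) Δ m k t ε overlap) ^ 2

/-- Admissible trial parameter `ε ↦ m_k(ε)` on `(0, 1)`: a signal-to-noise ratio (nonnegative),
differentiable, bounded and non-decreasing in `ε`. -/
structure IsTrialParameter (f : ℝ → ℝ) : Prop where
  nonneg : ∀ ε ∈ Ioo (0 : ℝ) 1, 0 ≤ f ε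
  differentiableOn : DifferentiableOn ℝ f (Ioo 0 1)
  bounded : ∃ B : ℝ, ∀ ε ∈ Ioo (0 : ℝ) 1, |f ε| ≤ B
  monotoneOn : MonotoneOn f (Ioo 0 1)

end RankOne

end

/-!
# Averaged concentration of the overlap in the interpolated spiked matrix model

Only the laws of the noises matter, and independent Gaussian channels observing the same features
combine into one channel whose signal-to-noise ratio is the sum. Hence the interpolating posterior
is that of one matrix channel of ratio `γ ≤ 1 / Δ` and one mean-field channel of ratio
`R ε = ε + ∑ l < k, m_l(ε) / (K Δ) + t m_k(ε) / (K Δ)` (`exists_combined_channel`,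
`overlapVariance_eq`). The matrix channel only enters through bounds that are uniform in `γ`, which
are recorded in `Model`. Since the trial parameters are non-decreasing, `R' ≥ 1`.

Write `u = √R` and let `A` be the `u`-derivative of the Hamiltonian. Gaussian integration by parts
and the Nishimori identity (signal and posterior sample are exchangeable given the observation)
express the covariance of the overlap `q` with `A` through `q` and `‖S‖² / n` only
(`Model.integral_overlap_mul_A`). Completing a square bounds the variance of `q` by
`2 Var(A) / (u n)² + O(1 / n)` (`Model.variance_overlap_le`). By the law of total variance,
`Var(A)` has two parts.

* The thermal part `𝔼 Var_Gibbs(A)` is, up to `O(n)`, minus the `u`-derivative of `𝔼⟨A⟩`, so its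
  integral over `u` telescopes (`Model.lintegral_varA_le`); `𝔼|⟨A⟩| = O(n / u)` follows from the
  Nishimori identity again.
* The disorder part `Var(⟨A⟩)` concerns `-⟨A⟩`, the derivative of the log-partition function `F`,
  which is convex up to an explicit quadratic. Convexity bounds it by difference quotients of `F` at
  distance `δ`, whose variance is `O(n / δ²)` by the Efron–Stein inequality
  (`Model.variance_F_le`), plus the square of the increment over `[u - δ, u + δ]` of the monotone
  function `Model.slope`. The increment is `O(n)` pointwise and `O(n δ)` after integration over `u`
  (`Model.variance_meanA_le`, `Model.lintegral_slope_diff_le`).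

The integral over `ε` becomes one over `u` with Jacobian `2 u / R' ≤ 2 u`
(`lintegral_comp_sqrt_le`). The trial parameters have no bound that is uniform in `n`, so `u` is not
confined to a fixed interval; but for `u` beyond a cut-off `L` the sample is so close to the signal
that `Var(q) = O(u⁻⁴ + 1 / n)` (`Model.overlapVar_le_tail`). With `n = L ^ 16` and `δ = L⁻⁵` every
contribution is `O(L⁻⁴) = O(n^(-1/4))`, with the stated dependence on `a`
(`Model.lintegral_overlapVar_le`).
-/

open MeasureTheory ProbabilityTheory Filter Set

noncomputable section

namespace RankOne

/-! ### Gaussian shifts and integration by parts -/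

/-- The law of `J` independent standard Gaussians. -/
abbrev stdNoise (J : Type*) [Fintype J] : Measure (J → ℝ) :=
  Measure.pi fun _ : J => gaussianReal 0 1

lemma gaussianReal_one_eq_withDensity (a : ℝ) :
    gaussianReal a 1 = (gaussianReal 0 1).withDensity
      fun t => ENNReal.ofReal (Real.exp (a * t - a ^ 2 / 2)) := by
  rw [gaussianReal_of_var_ne_zero _ one_ne_zero, gaussianReal_of_var_ne_zero _ one_ne_zero,
    ← withDensity_mul _ (measurable_gaussianPDF _ _) (by fun_prop)]
  congr 1
  ext t
  simp only [gaussianPDF, Pi.mul_apply, gaussianPDFReal]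
  rw [← ENNReal.ofReal_mul (by positivity), mul_assoc (√_)⁻¹, ← Real.exp_add]
  congr 3
  simp
  ring

/-- Cameron–Martin formula for finitely many standard Gaussians. -/
lemma stdNoise_map_add {J : Type*} [Fintype J] (a : J → ℝ) :
    (stdNoise J).map (fun w => w + a) = (stdNoise J).withDensity
      fun w => ENNReal.ofReal (Real.exp (∑ j, a j * w j - (∑ j, a j ^ 2) / 2)) := by
  have h1 : (stdNoise J).map (fun w => w + a) = Measure.pi fun j => gaussianReal (a j) 1 := by
    have := Measure.pi_map_pi (μ := fun _ : J => gaussianReal 0 1) (f := fun j t => t + a j)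
      (hμ := fun j => by rw [gaussianReal_map_add_const]; infer_instance)
      (fun j => by fun_prop)
    simp only [gaussianReal_map_add_const, zero_add] at this
    exact this
  rw [h1]
  refine Measure.pi_eq fun s hs => ?_
  rw [withDensity_apply _ (MeasurableSet.univ_pi hs), ← lintegral_indicator (.univ_pi hs)]
  have h2 : (fun w : J → ℝ => (univ.pi s).indicator (fun w => ENNReal.ofReal
      (Real.exp (∑ j, a j * w j - (∑ j, a j ^ 2) / 2))) w) =
      fun w => ∏ j, (s j).indicator
        (fun t => ENNReal.ofReal (Real.exp (a j * t - a j ^ 2 / 2))) (w j) := by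
    ext w
    by_cases hw : w ∈ univ.pi s
    · rw [indicator_of_mem hw]
      have : ∀ j, w j ∈ s j := fun j => hw j trivial
      simp only [indicator_of_mem (this _)]
      rw [← ENNReal.ofReal_prod_of_nonneg (fun _ _ => by positivity), ← Real.exp_sum,
        Finset.sum_sub_distrib, Finset.sum_div]
    · rw [indicator_of_notMem hw]
      obtain ⟨j, hj⟩ : ∃ j, w j ∉ s j := by simpa using hw
      exact (Finset.prod_eq_zero (Finset.mem_univ j) (indicator_of_notMem hj _)).symm
  have hind : iIndepFun (fun (j : J) (w : J → ℝ) => (s j).indicator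
        (fun t => ENNReal.ofReal (Real.exp (a j * t - a j ^ 2 / 2))) (w j)) (stdNoise J) :=
    iIndepFun_pi (X := fun j t => (s j).indicator
      (fun t => ENNReal.ofReal (Real.exp (a j * t - a j ^ 2 / 2))) t)
      fun j => (Measurable.indicator (by fun_prop) (hs j)).aemeasurable
  rw [h2, lintegral_prod_eq_prod_lintegral_of_indepFun _ _ hind
    (fun j => (Measurable.indicator (by fun_prop) (hs j)).comp (measurable_pi_apply j))]
  refine Finset.prod_congr rfl fun j _ => ?_
  have hm : Measurable fun t => (s j).indicator
      (fun t => ENNReal.ofReal (Real.exp (a j * t - a j ^ 2 / 2))) t :=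
    Measurable.indicator (by fun_prop) (hs j)
  have := (measurePreserving_eval (fun _ : J => gaussianReal 0 1) j).lintegral_comp hm
  simp only [Function.eval] at this
  rw [this, lintegral_indicator (hs j), gaussianReal_one_eq_withDensity (a j),
    withDensity_apply _ (hs j)]

lemma lintegral_stdNoise_add {J : Type*} [Fintype J] (a : J → ℝ) {f : (J → ℝ) → ENNReal}
    (hf : Measurable f) :
    ∫⁻ w, f (w + a) ∂(stdNoise J) = ∫⁻ w,
      ENNReal.ofReal (Real.exp (∑ j, a j * w j - (∑ j, a j ^ 2) / 2)) * f w ∂(stdNoise J) := by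
  rw [← lintegral_map hf (by fun_prop), stdNoise_map_add,
    lintegral_withDensity_eq_lintegral_mul _ (by fun_prop) hf]
  rfl

lemma hasDerivAt_gaussianPDFReal (t : ℝ) :
    HasDerivAt (gaussianPDFReal 0 1) (-t * gaussianPDFReal 0 1 t) t := by
  have h : HasDerivAt (fun t : ℝ => (√(2 * Real.pi * (1 : NNReal)))⁻¹ *
      Real.exp (-(t - 0) ^ 2 / (2 * (1 : NNReal))))
      ((√(2 * Real.pi * (1 : NNReal)))⁻¹ * (Real.exp (-(t - 0) ^ 2 / (2 * (1 : NNReal))) *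
        (-(2 * (t - 0) ^ (2 - 1) * 1) / (2 * (1 : NNReal))))) t :=
    (((((hasDerivAt_id t).sub_const 0).fun_pow 2).fun_neg.div_const _).exp).const_mul _
  have e : gaussianPDFReal 0 1 = fun t : ℝ => (√(2 * Real.pi * (1 : NNReal)))⁻¹ *
      Real.exp (-(t - 0) ^ 2 / (2 * (1 : NNReal))) := rfl
  rw [e]
  convert h using 1
  simp
  ring

/-- Gaussian integration by parts for a bounded function with bounded derivative. -/
lemma integral_mul_gaussianReal {G G' : ℝ → ℝ} (hG : ∀ t, HasDerivAt G (G' t) t)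
    (hG'm : Measurable G') {B B' : ℝ} (hB : ∀ t, |G t| ≤ B) (hB' : ∀ t, |G' t| ≤ B') :
    ∫ t, t * G t ∂(gaussianReal 0 1) = ∫ t, G' t ∂(gaussianReal 0 1) := by
  rw [integral_gaussianReal_eq_integral_smul one_ne_zero,
    integral_gaussianReal_eq_integral_smul one_ne_zero]
  have hGm : Measurable G := (continuous_iff_continuousAt.2
    fun t => (hG t).continuousAt).measurable
  have hint : Integrable (gaussianPDFReal 0 1) := integrable_gaussianPDFReal 0 1
  have hid : Integrable (fun t : ℝ => t * gaussianPDFReal 0 1 t) := by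
    have h := (memLp_id_gaussianReal (μ := 0) (v := 1) 1).integrable (by simp)
    rw [gaussianReal_of_var_ne_zero _ one_ne_zero,
      integrable_withDensity_iff (measurable_gaussianPDF _ _) (by simp [gaussianPDF])] at h
    simpa [toReal_gaussianPDF] using h
  have key := integral_mul_deriv_eq_deriv_mul_of_integrable (u := G) (u' := G')
    (v := gaussianPDFReal 0 1) (v' := fun t => -t * gaussianPDFReal 0 1 t)
    (fun t _ => hG t) (fun t _ => hasDerivAt_gaussianPDFReal t) ?_ ?_ ?_
  · simp only [smul_eq_mul]
    have e1 : ∀ t, gaussianPDFReal 0 1 t * (t * G t) =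
        -(G t * (-t * gaussianPDFReal 0 1 t)) := fun t => by ring
    simp_rw [e1, integral_neg, key, neg_neg]
    exact integral_congr_ae (.of_forall fun t => mul_comm _ _)
  · have : Integrable (fun t : ℝ => -t * gaussianPDFReal 0 1 t) := by
      simpa only [neg_mul] using hid.fun_neg
    exact this.bdd_mul hGm.aestronglyMeasurable (.of_forall hB)
  · exact hint.bdd_mul hG'm.aestronglyMeasurable (.of_forall hB')
  · exact hint.bdd_mul hGm.aestronglyMeasurable (.of_forall hB)

/-- Resampling one coordinate preserves the law of i.i.d. variables. -/
lemma measurePreserving_update {J X : Type*} [Fintype J] [DecidableEq J] [MeasurableSpace X]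
    (μ : Measure X) [IsProbabilityMeasure μ] (j : J) :
    MeasurePreserving (fun p : (J → X) × X => Function.update p.1 j p.2)
      ((Measure.pi fun _ : J => μ).prod μ) (Measure.pi fun _ : J => μ) := by
  have hm : Measurable fun p : (J → X) × X => Function.update p.1 j p.2 := by
    refine measurable_pi_iff.2 fun i => ?_
    by_cases h : i = j
    · subst h; simpa using measurable_snd
    · simpa [Function.update_of_ne h, Function.comp_def] using
        (measurable_pi_apply i).comp measurable_fst
  refine ⟨hm, (Measure.pi_eq fun s hs => ?_).symm⟩
  rw [Measure.map_apply hm (.univ_pi hs)]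
  have : (fun p : (J → X) × X => Function.update p.1 j p.2) ⁻¹' univ.pi s =
      (univ.pi (Function.update s j univ)) ×ˢ s j := by
    ext p
    simp only [mem_preimage, Set.mem_pi, mem_univ, true_implies, mem_prod]
    constructor
    · intro h
      refine ⟨fun i => ?_, by simpa using h j⟩
      by_cases hi : i = j
      · subst hi; simp
      · simpa [Function.update_of_ne hi] using h i
    · rintro ⟨h1, h2⟩ i
      by_cases hi : i = j
      · subst hi; simpa using h2
      · simpa [Function.update_of_ne hi] using h1 i
  rw [this, Measure.prod_prod, Measure.pi_pi,
    ← Finset.mul_prod_erase _ _ (Finset.mem_univ j),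
    ← Finset.mul_prod_erase _ (fun i => μ (s i)) (Finset.mem_univ j)]
  simp only [Function.update_self, measure_univ, one_mul]
  rw [mul_comm]
  congr 1
  exact Finset.prod_congr rfl fun i hi => by
    rw [Function.update_of_ne (Finset.ne_of_mem_erase hi)]

/-! ### Subadditivity of the variance over independent variables -/

lemma variance_eq_integral_sq_sub {X : Type*} [MeasurableSpace X] {μ : Measure X}
    [IsProbabilityMeasure μ] {f : X → ℝ} (hf : MemLp f 2 μ) :
    Var[f; μ] = ∫ x, f x ^ 2 ∂μ - (∫ x, f x ∂μ) ^ 2 := by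
  rw [variance_eq_sub hf]; rfl

/-- The slice averages of a square integrable function are square integrable. -/
lemma memLp_integral_prod {X Y : Type*} [MeasurableSpace X] [MeasurableSpace Y]
    {μ : Measure X} {ν : Measure Y} [IsProbabilityMeasure μ] [IsProbabilityMeasure ν]
    {f : X × Y → ℝ} (hf : MemLp f 2 (μ.prod ν)) :
    MemLp (fun x => ∫ y, f (x, y) ∂ν) 2 μ := by
  have hm : AEStronglyMeasurable (fun x => ∫ y, f (x, y) ∂ν) μ :=
    hf.1.integral_prod_right'
  rw [memLp_two_iff_integrable_sq hm]
  have h2 := (hf.integrable_sq).integral_prod_left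
  refine h2.mono' (hm.pow 2) ?_
  filter_upwards [hf.integrable_sq.prod_right_ae, hf.1.prodMk_left] with x hx hmx
  have hL : MemLp (fun y => f (x, y)) 2 ν := (memLp_two_iff_integrable_sq hmx).2 hx
  rw [Real.norm_of_nonneg (sq_nonneg _)]
  have := variance_nonneg (fun y => f (x, y)) ν
  rw [variance_eq_integral_sq_sub hL] at this
  linarith

/-- Efron–Stein inequality for two independent variables. -/
lemma variance_prod_le {X Y : Type*} [MeasurableSpace X] [MeasurableSpace Y]
    {μ : Measure X} {ν : Measure Y} [IsProbabilityMeasure μ] [IsProbabilityMeasure ν]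
    {f : X × Y → ℝ} (hf : MemLp f 2 (μ.prod ν)) :
    Var[f; μ.prod ν] ≤
      ∫ y, Var[fun x => f (x, y); μ] ∂ν + ∫ x, Var[fun y => f (x, y); ν] ∂μ := by
  set fX : X → ℝ := fun x => ∫ y, f (x, y) ∂ν with hfX
  set fY : Y → ℝ := fun y => ∫ x, f (x, y) ∂μ with hfY
  set m := ∫ p, f p ∂(μ.prod ν) with hm
  have hX : MemLp fX 2 μ := memLp_integral_prod hf
  have hsw : MemLp (fun q : Y × X => f (q.2, q.1)) 2 (ν.prod μ) :=
    hf.comp_measurePreserving Measure.measurePreserving_swap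
  have hY : MemLp fY 2 ν := memLp_integral_prod hsw
  have hX' : MemLp (fun p : X × Y => fX p.1) 2 (μ.prod ν) :=
    hX.comp_measurePreserving measurePreserving_fst
  have hY' : MemLp (fun p : X × Y => fY p.2) 2 (μ.prod ν) :=
    hY.comp_measurePreserving measurePreserving_snd
  have hfi := hf.integrable (by norm_num)
  have iX : ∫ x, fX x ∂μ = m := (integral_prod f hfi).symm
  have iY : ∫ y, fY y ∂ν = m := (integral_prod_symm f hfi).symm
  have e1 : ∫ y, Var[fun x => f (x, y); μ] ∂ν =
      ∫ p, f p ^ 2 ∂(μ.prod ν) - ∫ y, fY y ^ 2 ∂ν := by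
    rw [integral_prod_symm _ hf.integrable_sq,
      ← integral_sub hf.integrable_sq.integral_prod_right hY.integrable_sq]
    refine integral_congr_ae ?_
    filter_upwards [hsw.integrable_sq.prod_right_ae, hsw.1.prodMk_left] with y hy hmy
    exact variance_eq_integral_sq_sub ((memLp_two_iff_integrable_sq hmy).2 hy)
  have e2 : ∫ x, Var[fun y => f (x, y); ν] ∂μ =
      ∫ p, f p ^ 2 ∂(μ.prod ν) - ∫ x, fX x ^ 2 ∂μ := by
    rw [integral_prod _ hf.integrable_sq,
      ← integral_sub hf.integrable_sq.integral_prod_left hX.integrable_sq]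
    refine integral_congr_ae ?_
    filter_upwards [hf.integrable_sq.prod_right_ae, hf.1.prodMk_left] with y hy hmy
    exact variance_eq_integral_sq_sub ((memLp_two_iff_integrable_sq hmy).2 hy)
  rw [variance_eq_integral_sq_sub hf, e1, e2]
  -- it remains to expand `0 ≤ ∫ (f - fX - fY + m) ^ 2`
  have p1 : Integrable (fun p : X × Y => f p * fX p.1) (μ.prod ν) := hf.integrable_mul hX'
  have p2 : Integrable (fun p : X × Y => f p * fY p.2) (μ.prod ν) := hf.integrable_mul hY'
  have p3 : Integrable (fun p : X × Y => fX p.1 * fY p.2) (μ.prod ν) := hX'.integrable_mul hY'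
  have q1 : ∫ p, f p * fX p.1 ∂(μ.prod ν) = ∫ x, fX x ^ 2 ∂μ := by
    rw [integral_prod _ p1]
    refine integral_congr_ae (.of_forall fun x => ?_)
    simp only [integral_mul_const]
    rw [sq]
  have q2 : ∫ p, f p * fY p.2 ∂(μ.prod ν) = ∫ y, fY y ^ 2 ∂ν := by
    rw [integral_prod_symm _ p2]
    refine integral_congr_ae (.of_forall fun x => ?_)
    simp only [integral_mul_const]
    rw [sq]
  have q3 : ∫ p, fX p.1 * fY p.2 ∂(μ.prod ν) = m ^ 2 := by
    rw [integral_prod_mul, iX, iY, sq]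
  have q4 : ∫ p : X × Y, fX p.1 ^ 2 ∂(μ.prod ν) = ∫ x, fX x ^ 2 ∂μ := by
    have := integral_prod_mul (μ := μ) (ν := ν) (fun x => fX x ^ 2) (fun _ => (1 : ℝ))
    simpa using this
  have q5 : ∫ p : X × Y, fY p.2 ^ 2 ∂(μ.prod ν) = ∫ y, fY y ^ 2 ∂ν := by
    have := integral_prod_mul (μ := μ) (ν := ν) (fun _ => (1 : ℝ)) (fun y => fY y ^ 2)
    simpa using this
  have q6 : ∫ p : X × Y, fX p.1 ∂(μ.prod ν) = m := by
    have := integral_prod_mul (μ := μ) (ν := ν) fX (fun _ => (1 : ℝ))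
    simpa [iX] using this
  have q7 : ∫ p : X × Y, fY p.2 ∂(μ.prod ν) = m := by
    have := integral_prod_mul (μ := μ) (ν := ν) (fun _ => (1 : ℝ)) fY
    simpa [iY] using this
  have hpos : 0 ≤ ∫ p, (f p - fX p.1 - fY p.2 + m) ^ 2 ∂(μ.prod ν) :=
    integral_nonneg fun p => sq_nonneg _
  have hexp : ∀ p : X × Y, (f p - fX p.1 - fY p.2 + m) ^ 2 =
      f p ^ 2 + fX p.1 ^ 2 + fY p.2 ^ 2 + m ^ 2 + -2 * (f p * fX p.1) + -2 * (f p * fY p.2)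
        + 2 * (fX p.1 * fY p.2) + 2 * m * f p + -2 * m * fX p.1 + -2 * m * fY p.2 :=
    fun p => by ring
  have s1 := hf.integrable_sq
  have s2 := hX'.integrable_sq
  have s3 := hY'.integrable_sq
  have s4 := hX'.integrable (by norm_num)
  have s5 := hY'.integrable (by norm_num)
  have s6 : Integrable (fun _ : X × Y => m ^ 2) (μ.prod ν) := integrable_const _
  simp_rw [hexp] at hpos
  have t1 := s1.fun_add s2
  have t2 := t1.fun_add s3
  have t3 := t2.fun_add s6
  have t4 := t3.fun_add (p1.const_mul (-2))
  have t5 := t4.fun_add (p2.const_mul (-2))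
  have t6 := t5.fun_add (p3.const_mul 2)
  have t7 := t6.fun_add (hfi.const_mul (2 * m))
  have t8 := t7.fun_add (s4.const_mul (-2 * m))
  rw [integral_add t8 (s5.const_mul (-2 * m)), integral_add t7 (s4.const_mul (-2 * m)),
    integral_add t6 (hfi.const_mul (2 * m)), integral_add t5 (p3.const_mul 2),
    integral_add t4 (p2.const_mul (-2)), integral_add t3 (p1.const_mul (-2)), integral_add t2 s6,
    integral_add t1 s3, integral_add s1 s2] at hpos
  simp only [integral_const_mul, q1, q2, q3, q4, q5, q6, q7, ← hm, integral_const, smul_eq_mul,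
    probReal_univ, one_mul] at hpos
  linarith

lemma variance_comp_equiv {X : Type*} [MeasurableSpace X] (μ : Measure X) [IsProbabilityMeasure μ]
    {I J : Type*} [Fintype I] [Fintype J] (e : I ≃ J) (f : (J → X) → ℝ) :
    Var[fun x : I → X => f (x ∘ e.symm); Measure.pi fun _ => μ] =
      Var[f; Measure.pi fun _ => μ] := by
  have h := measurePreserving_arrowCongr' (fun _ : I => μ) (fun _ : J => μ) e
    (MeasurableEquiv.refl X) (fun _ => MeasurePreserving.id μ)
  rw [← h.map_eq, variance_map_equiv]
  rfl

lemma memLp_sum_comp_eval {X : Type*} [MeasurableSpace X] {μ : Measure X}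
    [IsProbabilityMeasure μ] {J : Type*} [Fintype J] {h : X → ℝ} (hh : MemLp h 2 μ) :
    MemLp (fun x : J → X => ∑ i, h (x i)) 2 (Measure.pi fun _ => μ) :=
  memLp_finsetSum _ fun i _ =>
    hh.comp_measurePreserving (measurePreserving_eval (fun _ : J => μ) i)

lemma memLp_of_growth {X : Type*} [MeasurableSpace X] {μ : Measure X}
    [IsProbabilityMeasure μ] {J : Type*} [Fintype J] {h : X → ℝ} (hh : MemLp h 2 μ)
    {f : (J → X) → ℝ} (hf : Measurable f) {C : ℝ} (hC : ∀ x, |f x| ≤ C + ∑ i, h (x i)) :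
    MemLp f 2 (Measure.pi fun _ => μ) := by
  refine ((memLp_const C).add (memLp_sum_comp_eval (J := J) hh)).mono hf.aestronglyMeasurable
    (.of_forall fun x => ?_)
  rw [Real.norm_eq_abs]
  exact (hC x).trans (le_abs_self _)

lemma variance_pi_fin_le {X : Type*} [MeasurableSpace X] {μ : Measure X}
    [IsProbabilityMeasure μ] {h : X → ℝ} (hh : MemLp h 2 μ) :
    ∀ {n : ℕ} {f : (Fin n → X) → ℝ} (_ : Measurable f) {C : ℝ}
    (_ : ∀ x, |f x| ≤ C + ∑ i, h (x i)) {c : Fin n → ℝ}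
    (_ : ∀ i x, Var[fun t => f (Function.update x i t); μ] ≤ c i),
    Var[f; Measure.pi fun _ => μ] ≤ ∑ i, c i := by
  intro n
  induction n with
  | zero =>
    intro f hf C hC c hc
    have : f = fun _ => f default := by ext x; congr 1; exact Subsingleton.elim _ _
    rw [this]
    simp [variance_eq_integral aemeasurable_const]
  | succ n ih =>
    intro f hf C hC c hc
    obtain ⟨t₀⟩ : Nonempty X := nonempty_of_isProbabilityMeasure μ
    have hmp := (measurePreserving_piFinSuccAbove (fun _ : Fin (n + 1) => μ) 0).symm
    have hcons : ∀ p : X × (Fin n → X),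
        (MeasurableEquiv.piFinSuccAbove (fun _ : Fin (n + 1) => X) 0).symm p =
          Fin.cons p.1 p.2 := by
      intro p
      simp [MeasurableEquiv.piFinSuccAbove_symm_apply, Fin.insertNthEquiv]
    set g : X × (Fin n → X) → ℝ := fun p => f (Fin.cons p.1 p.2) with hg
    have hL : MemLp g 2 (μ.prod (Measure.pi fun _ => μ)) := by
      have := (memLp_of_growth hh hf hC).comp_measurePreserving hmp
      refine this.congr_norm ?_ ?_
      · have := this.1
        simpa only [Function.comp_def, hcons] using this
      · exact .of_forall fun p => by simp only [Function.comp_def, hcons, hg]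
    have hv : Var[f; Measure.pi fun _ => μ] = Var[g; μ.prod (Measure.pi fun _ => μ)] := by
      rw [← hmp.map_eq, variance_map_equiv]
      congr 1
      ext p
      simp only [Function.comp_def, hcons, hg]
    have hgm : Measurable g := by
      have := hf.comp (MeasurableEquiv.piFinSuccAbove (fun _ : Fin (n + 1) => X) 0).symm.measurable
      simpa only [Function.comp_def, hcons] using this
    rw [hv, Fin.sum_univ_succ]
    refine (variance_prod_le hL).trans (add_le_add ?_ ?_)
    · have : ∀ y, Var[fun x => g (x, y); μ] ≤ c 0 := by
        intro y
        have := hc 0 (Fin.cons t₀ y)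
        simpa only [Fin.update_cons_zero] using this
      refine (integral_mono_of_nonneg (.of_forall fun _ => variance_nonneg _ _)
        (integrable_const (c 0)) (.of_forall this)).trans ?_
      simp
    · have : ∀ x, Var[fun y => g (x, y); Measure.pi fun _ => μ] ≤ ∑ i : Fin n, c i.succ := by
        intro x
        refine ih (f := fun y => g (x, y)) (C := C + h x) (hgm.comp measurable_prodMk_left)
          (fun y => ?_) (fun i y => ?_)
        · have := hC (Fin.cons x y)
          rw [Fin.sum_univ_succ] at this
          simpa [add_assoc] using this
        · have := hc i.succ (Fin.cons x y)
          simpa only [← Fin.cons_update] using this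
      refine (integral_mono_of_nonneg (.of_forall fun _ => variance_nonneg _ _)
        (integrable_const (∑ i : Fin n, c i.succ)) (.of_forall this)).trans ?_
      simp

/-- Efron–Stein inequality for i.i.d. variables, with uniform bounds on the variances in each
coordinate. The growth condition ensures square integrability, also of all the sections of `f`. -/
lemma variance_pi_le {X : Type*} [MeasurableSpace X] {μ : Measure X}
    [IsProbabilityMeasure μ] {h : X → ℝ} (hh : MemLp h 2 μ) {J : Type*} [Fintype J]
    [DecidableEq J] {f : (J → X) → ℝ} (hf : Measurable f) {C : ℝ}
    (hC : ∀ x, |f x| ≤ C + ∑ i, h (x i)) {c : J → ℝ}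
    (hc : ∀ i x, Var[fun t => f (Function.update x i t); μ] ≤ c i) :
    Var[f; Measure.pi fun _ => μ] ≤ ∑ i, c i := by
  let e := (Fintype.equivFin J).symm
  rw [← variance_comp_equiv μ e, ← e.sum_comp]
  refine variance_pi_fin_le hh (C := C) ?_ (fun x => ?_) (fun i x => ?_)
  · exact hf.comp (by fun_prop)
  · refine (hC _).trans_eq ?_
    rw [← e.sum_comp]
    simp
  · have := hc (e i) (x ∘ e.symm)
    convert this using 3 with t
    rw [Function.update_comp_equiv]
    simp

/-! ### Gibbs measures with bounded Hamiltonians -/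

/-- Bounded measurable real functions. Hamiltonians of this kind have Gibbs measures, whose averages
can be differentiated under the integral sign. -/
def BddMeas {X : Type*} [MeasurableSpace X] (g : X → ℝ) : Prop :=
  Measurable g ∧ ∃ B, ∀ x, |g x| ≤ B

namespace BddMeas

variable {X : Type*} [MeasurableSpace X] {g h : X → ℝ}

lemma mk' (hm : Measurable g) {B : ℝ} (hB : ∀ x, |g x| ≤ B) : BddMeas g := ⟨hm, B, hB⟩

lemma const (c : ℝ) : BddMeas fun _ : X => c := ⟨measurable_const, |c|, fun _ => le_rfl⟩

lemma add (hg : BddMeas g) (hh : BddMeas h) : BddMeas fun x => g x + h x := by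
  obtain ⟨hg, B, hB⟩ := hg
  obtain ⟨hh, C, hC⟩ := hh
  exact ⟨hg.add hh, B + C, fun x => (abs_add_le _ _).trans (add_le_add (hB x) (hC x))⟩

lemma mul (hg : BddMeas g) (hh : BddMeas h) : BddMeas fun x => g x * h x := by
  obtain ⟨hg, B, hB⟩ := hg
  obtain ⟨hh, C, hC⟩ := hh
  refine ⟨hg.mul hh, B * C, fun x => ?_⟩
  rw [abs_mul]
  exact mul_le_mul (hB x) (hC x) (abs_nonneg _) ((abs_nonneg _).trans (hB x))

lemma const_mul (c : ℝ) (hg : BddMeas g) : BddMeas fun x => c * g x := (const c).mul hg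

lemma neg (hg : BddMeas g) : BddMeas fun x => -g x := by simpa using hg.const_mul (-1)

lemma sub (hg : BddMeas g) (hh : BddMeas h) : BddMeas fun x => g x - h x := by
  simpa [sub_eq_add_neg] using hg.add hh.neg

lemma pow (hg : BddMeas g) : ∀ n : ℕ, BddMeas fun x => g x ^ n
  | 0 => by simpa using const 1
  | n + 1 => by simpa only [pow_succ] using (pow hg n).mul hg

lemma sum {ι : Type*} {s : Finset ι} {f : ι → X → ℝ} (hf : ∀ i ∈ s, BddMeas (f i)) :
    BddMeas fun x => ∑ i ∈ s, f i x := by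
  classical
  induction s using Finset.induction_on with
  | empty => simpa using const 0
  | insert i s hi ih =>
    simp only [Finset.sum_insert hi]
    exact (hf i (by simp)).add (ih fun j hj => hf j (by simp [hj]))

lemma exp (hg : BddMeas g) : BddMeas fun x => Real.exp (g x) := by
  obtain ⟨hg, B, hB⟩ := hg
  refine ⟨hg.exp, Real.exp B, fun x => ?_⟩
  rw [abs_of_pos (Real.exp_pos _)]
  exact Real.exp_le_exp.2 ((le_abs_self _).trans (hB x))

lemma integrable (hg : BddMeas g) (μ : Measure X) [IsFiniteMeasure μ] : Integrable g μ := by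
  obtain ⟨hg, B, hB⟩ := hg
  exact Integrable.of_bound hg.aestronglyMeasurable B (.of_forall hB)

lemma memLp (hg : BddMeas g) (p : ENNReal) (μ : Measure X) [IsFiniteMeasure μ] : MemLp g p μ := by
  obtain ⟨hg, B, hB⟩ := hg
  exact MemLp.of_bound hg.aestronglyMeasurable B (.of_forall hB)

end BddMeas

section Gibbs

variable {X : Type*} [MeasurableSpace X] {P : Measure X}

/-- The Gibbs measure with reference measure `P` and Hamiltonian `H`. -/
abbrev gibbs (P : Measure X) (H : X → ℝ) : Measure X := P.tilted fun x => -H x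

lemma integral_gibbs (H g : X → ℝ) :
    ∫ x, g x ∂(gibbs P H) =
      (∫ x, g x * Real.exp (-H x) ∂P) / ∫ x, Real.exp (-H x) ∂P := by
  rw [integral_tilted, div_eq_mul_inv, mul_comm, ← integral_const_mul]
  refine integral_congr_ae (.of_forall fun x => ?_)
  simp only [smul_eq_mul]
  ring

/-- Adding a constant to the Hamiltonian does not change the Gibbs measure. -/
lemma gibbs_add_const {H : X → ℝ} (c : ℝ) : gibbs P (fun x => H x + c) = gibbs P H := by
  unfold gibbs Measure.tilted
  congr 1
  ext x
  have : ∀ x, Real.exp (-(H x + c)) = Real.exp (-c) * Real.exp (-H x) := fun x => by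
    rw [← Real.exp_add]; ring_nf
  simp only [this, integral_const_mul]
  rw [mul_div_mul_left _ _ (Real.exp_pos _).ne']

variable [IsProbabilityMeasure P]

lemma gibbs_isProb {H : X → ℝ} (hH : BddMeas H) : IsProbabilityMeasure (gibbs P H) :=
  isProbabilityMeasure_tilted (hH.neg.exp.integrable P)

lemma partition_pos {H : X → ℝ} (hH : BddMeas H) : 0 < ∫ x, Real.exp (-H x) ∂P :=
  integral_exp_pos (hH.neg.exp.integrable P)

lemma abs_integral_gibbs_le {H g : X → ℝ} (hH : BddMeas H) {B : ℝ} (hB : ∀ x, |g x| ≤ B) :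
    |∫ x, g x ∂(gibbs P H)| ≤ B := by
  have := gibbs_isProb (P := P) hH
  have h := norm_integral_le_of_norm_le_const (μ := gibbs P H) (f := g) (C := B)
    (.of_forall hB)
  simpa using h

/-- The log-partition function. -/
def logZ (P : Measure X) (H : X → ℝ) : ℝ := Real.log (∫ x, Real.exp (-H x) ∂P)

/-- The log-partition function is 1-Lipschitz in the Hamiltonian. -/
lemma abs_logZ_sub_le {H H' : X → ℝ} (hH : BddMeas H) (hH' : BddMeas H') {B : ℝ}
    (hB : ∀ x, |H x - H' x| ≤ B) : |logZ P H - logZ P H'| ≤ B := by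
  have key : ∀ {H H' : X → ℝ}, BddMeas H → BddMeas H' → (∀ x, |H x - H' x| ≤ B) →
      logZ P H - logZ P H' ≤ B := by
    intro H H' hH hH' hB
    have : ∫ x, Real.exp (-H x) ∂P ≤ Real.exp B * ∫ x, Real.exp (-H' x) ∂P := by
      rw [← integral_const_mul]
      refine integral_mono (hH.neg.exp.integrable P) ((hH'.neg.exp.integrable P).const_mul _)
        fun x => ?_
      simp only [← Real.exp_add]
      exact Real.exp_le_exp.2 (by linarith [(abs_le.1 (hB x)).1])
    have h2 := Real.log_le_log (partition_pos hH) this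
    rw [Real.log_mul (Real.exp_pos _).ne' (partition_pos hH').ne', Real.log_exp] at h2
    unfold logZ
    linarith
  rw [abs_le]
  constructor
  · linarith [key hH' hH fun x => by rw [abs_sub_comm]; exact hB x]
  · exact key hH hH' hB

lemma abs_logZ_le {H : X → ℝ} (hH : BddMeas H) {B : ℝ} (hB : ∀ x, |H x| ≤ B) :
    |logZ P H| ≤ B := by
  have := abs_logZ_sub_le (P := P) hH (BddMeas.const 0) (B := B) (by simpa using hB)
  have h0 : logZ P (fun _ : X => (0 : ℝ)) = 0 := by simp [logZ]
  rwa [h0, sub_zero] at this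

variable {k a b g : X → ℝ}

lemma hasDerivAt_integral_mul_exp (hk : BddMeas k) (hb : BddMeas b) (ha : BddMeas a)
    (hg : BddMeas g) (τ : ℝ) :
    HasDerivAt (fun τ => ∫ x, g x * Real.exp (-(k x + τ * b x + τ ^ 2 * a x)) ∂P)
      (∫ x, -(g x * (b x + 2 * τ * a x)) *
        Real.exp (-(k x + τ * b x + τ ^ 2 * a x)) ∂P) τ := by
  have hE : ∀ τ : ℝ, BddMeas fun x => k x + τ * b x + τ ^ 2 * a x := fun τ =>
    (hk.add (hb.const_mul τ)).add (ha.const_mul _)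
  have hF : ∀ τ : ℝ, BddMeas fun x => g x * Real.exp (-(k x + τ * b x + τ ^ 2 * a x)) :=
    fun τ => hg.mul (hE τ).neg.exp
  have hF' : BddMeas fun x => -(g x * (b x + 2 * τ * a x)) *
        Real.exp (-(k x + τ * b x + τ ^ 2 * a x)) :=
    (hg.mul (hb.add (ha.const_mul (2 * τ)))).neg.mul (hE τ).neg.exp
  obtain ⟨-, Bk, hBk⟩ := hk
  obtain ⟨-, Bb, hBb⟩ := hb
  obtain ⟨-, Ba, hBa⟩ := ha
  obtain ⟨-, Bg, hBg⟩ := hg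
  set T := |τ| + 1 with hT
  have hT0 : 0 ≤ T := by positivity
  refine (hasDerivAt_integral_of_dominated_loc_of_deriv_le (s := Metric.ball τ 1)
    (F' := fun τ x => -(g x * (b x + 2 * τ * a x)) *
        Real.exp (-(k x + τ * b x + τ ^ 2 * a x)))
    (bound := fun _ => (Bg * (Bb + 2 * T * Ba)) * Real.exp (Bk + T * Bb + T ^ 2 * Ba))
    (Metric.ball_mem_nhds τ one_pos) (.of_forall fun τ => (hF τ).1.aestronglyMeasurable)
    ((hF τ).integrable P) hF'.1.aestronglyMeasurable ?_ (integrable_const _) ?_).2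
  · refine .of_forall fun x σ hσ => ?_
    have hσT : |σ| ≤ T := by
      have h1 : |σ - τ| < 1 := by simpa [Real.dist_eq] using hσ
      have h2 := abs_add_le (σ - τ) τ
      rw [sub_add_cancel] at h2
      linarith
    have gb := hBg x
    have bb := hBb x
    have ab := hBa x
    have kb := hBk x
    have Bg0 : 0 ≤ Bg := (abs_nonneg _).trans gb
    have Bb0 : 0 ≤ Bb := (abs_nonneg _).trans bb
    have Ba0 : 0 ≤ Ba := (abs_nonneg _).trans ab
    have h1 : |σ * b x| ≤ T * Bb := by rw [abs_mul]; gcongr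
    have h2 : |σ * a x| ≤ T * Ba := by rw [abs_mul]; gcongr
    have h3 : |σ ^ 2 * a x| ≤ T ^ 2 * Ba := by rw [abs_mul, abs_pow]; gcongr
    have h4 : |b x + 2 * σ * a x| ≤ Bb + 2 * T * Ba := by
      have : 2 * σ * a x = 2 * (σ * a x) := by ring
      rw [this]
      refine (abs_add_le _ _).trans ?_
      rw [abs_mul 2, abs_two]
      linarith
    rw [Real.norm_eq_abs, abs_mul, abs_neg, abs_mul, abs_of_pos (Real.exp_pos _)]
    gcongr
    have := (abs_le.1 kb).1
    have := (abs_le.1 h1).1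
    have := (abs_le.1 h3).1
    linarith
  · refine .of_forall fun x σ _ => ?_
    have h : HasDerivAt (fun σ : ℝ => -(k x + σ * b x + σ ^ 2 * a x))
        (-(1 * b x + ((2 : ℕ) * σ ^ (2 - 1) * 1) * a x)) σ :=
      ((((hasDerivAt_id σ).mul_const (b x)).const_add (k x)).add
        (((hasDerivAt_id σ).fun_pow 2).mul_const (a x))).neg
    have h2 := h.exp.const_mul (g x)
    refine h2.congr_deriv ?_
    simp
    ring

lemma hasDerivAt_logZ (hk : BddMeas k) (hb : BddMeas b) (ha : BddMeas a) (τ : ℝ) :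
    HasDerivAt (fun τ => logZ P fun x => k x + τ * b x + τ ^ 2 * a x)
      (-∫ x, (b x + 2 * τ * a x) ∂(gibbs P fun x => k x + τ * b x + τ ^ 2 * a x)) τ := by
  have hE : BddMeas fun x => k x + τ * b x + τ ^ 2 * a x :=
    (hk.add (hb.const_mul τ)).add (ha.const_mul _)
  have h := hasDerivAt_integral_mul_exp (P := P) hk hb ha (BddMeas.const 1) τ
  simp only [one_mul] at h
  refine (h.log (partition_pos hE).ne').congr_deriv ?_
  rw [integral_gibbs, ← neg_div, ← integral_neg]
  simp only [neg_mul]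

/-- The derivative of a Gibbs average is minus a covariance with the derivative of the
Hamiltonian. -/
lemma hasDerivAt_integral_gibbs (hk : BddMeas k) (hb : BddMeas b) (ha : BddMeas a)
    (hg : BddMeas g) (τ : ℝ) :
    HasDerivAt (fun τ => ∫ x, g x ∂(gibbs P fun x => k x + τ * b x + τ ^ 2 * a x))
      ((∫ x, g x ∂(gibbs P fun x => k x + τ * b x + τ ^ 2 * a x)) *
        (∫ x, (b x + 2 * τ * a x) ∂(gibbs P fun x => k x + τ * b x + τ ^ 2 * a x)) -
        ∫ x, g x * (b x + 2 * τ * a x) ∂(gibbs P fun x => k x + τ * b x + τ ^ 2 * a x)) τ := by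
  have hE : BddMeas fun x => k x + τ * b x + τ ^ 2 * a x :=
    (hk.add (hb.const_mul τ)).add (ha.const_mul _)
  have h1 := hasDerivAt_integral_mul_exp (P := P) hk hb ha hg τ
  have h0 := hasDerivAt_integral_mul_exp (P := P) hk hb ha (BddMeas.const 1) τ
  simp only [one_mul] at h0
  have hZ := (partition_pos (P := P) hE).ne'
  have h := h1.div h0 hZ
  simp only [neg_mul, integral_neg] at h
  simp only [integral_gibbs]
  refine h.congr_deriv ?_
  generalize (∫ x, g x * (b x + 2 * τ * a x) *
    Real.exp (-(k x + τ * b x + τ ^ 2 * a x)) ∂P) = I₁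
  generalize (∫ x, (b x + 2 * τ * a x) * Real.exp (-(k x + τ * b x + τ ^ 2 * a x)) ∂P) = I₂
  generalize (∫ x, g x * Real.exp (-(k x + τ * b x + τ ^ 2 * a x)) ∂P) = I₃
  generalize (∫ x, Real.exp (-(k x + τ * b x + τ ^ 2 * a x)) ∂P) = I₄ at hZ ⊢
  field_simp
  ring

end Gibbs

/-! ### Measurable dependence on parameters -/

section Param

variable {X T : Type*} [MeasurableSpace X] [MeasurableSpace T] {P : Measure X}
  [IsProbabilityMeasure P]

lemma measurable_integral_param {f : T → X → ℝ} (hf : Measurable (Function.uncurry f)) :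
    Measurable fun t => ∫ x, f t x ∂P :=
  hf.stronglyMeasurable.integral_prod_right.measurable

lemma measurable_integral_gibbs {H g : T → X → ℝ} (hH : Measurable (Function.uncurry H))
    (hg : Measurable (Function.uncurry g)) :
    Measurable fun t => ∫ x, g t x ∂(gibbs P (H t)) := by
  simp only [integral_gibbs]
  exact (measurable_integral_param (hg.mul hH.neg.exp)).div
    (measurable_integral_param hH.neg.exp)

lemma measurable_logZ {H : T → X → ℝ} (hH : Measurable (Function.uncurry H)) :
    Measurable fun t => logZ P (H t) :=
  (measurable_integral_param hH.neg.exp).log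

/-- The Gibbs measures of a measurable family of Hamiltonians, as a kernel. -/
def gibbsKernel (P : Measure X) [IsProbabilityMeasure P] (H : T → X → ℝ)
    (_hH : Measurable (Function.uncurry H)) : Kernel T X :=
  (Kernel.const T P).withDensity fun t x =>
    ENNReal.ofReal (Real.exp (-H t x) / ∫ x, Real.exp (-H t x) ∂P)

lemma gibbsKernel_apply {H : T → X → ℝ} (hH : Measurable (Function.uncurry H)) (t : T) :
    gibbsKernel P H hH t = gibbs P (H t) := by
  unfold gibbsKernel
  rw [Kernel.withDensity_apply]
  · simp [Measure.tilted]
  · have h1 : Measurable fun t => ∫ x, Real.exp (-H t x) ∂P :=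
      measurable_integral_param hH.neg.exp
    exact (hH.neg.exp.div (h1.comp measurable_fst)).ennreal_ofReal

end Param

/-! ### The joint law of disorder and Gibbs sample -/

section Joint

variable {X Ω : Type*} [MeasurableSpace X] [MeasurableSpace Ω] {P : Measure X}
  [IsProbabilityMeasure P] {μ : Measure Ω} [IsProbabilityMeasure μ]

/-- The joint law of the disorder `ω ∼ μ` and of a sample of the Gibbs measure with
Hamiltonian `H ω`. -/
def joint (μ : Measure Ω) (P : Measure X) [IsProbabilityMeasure P] (H : Ω → X → ℝ)
    (hH : Measurable (Function.uncurry H)) : Measure (Ω × X) :=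
  μ ⊗ₘ gibbsKernel P H hH

variable {H : Ω → X → ℝ} (hH : Measurable (Function.uncurry H)) (hb : ∀ ω, BddMeas (H ω))

include hb in
lemma isMarkovKernel_gibbsKernel : IsMarkovKernel (gibbsKernel P H hH) :=
  ⟨fun t => by rw [gibbsKernel_apply]; exact gibbs_isProb (hb t)⟩

include hb in
lemma isProbabilityMeasure_joint : IsProbabilityMeasure (joint μ P H hH) := by
  have := isMarkovKernel_gibbsKernel (P := P) hH hb
  unfold joint; infer_instance

include hb in
lemma lintegral_joint {f : Ω × X → ENNReal} (hf : Measurable f) :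
    ∫⁻ p, f p ∂(joint μ P H hH) = ∫⁻ ω, ∫⁻ x, f (ω, x) ∂(gibbs P (H ω)) ∂μ := by
  have := isMarkovKernel_gibbsKernel (P := P) hH hb
  unfold joint
  rw [Measure.lintegral_compProd hf]
  simp only [gibbsKernel_apply]

include hb in
lemma integral_joint {f : Ω × X → ℝ} (hf : Integrable f (joint μ P H hH)) :
    ∫ p, f p ∂(joint μ P H hH) = ∫ ω, ∫ x, f (ω, x) ∂(gibbs P (H ω)) ∂μ := by
  have := isMarkovKernel_gibbsKernel (P := P) hH hb
  unfold joint at hf ⊢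
  rw [Measure.integral_compProd hf]
  simp only [gibbsKernel_apply]

include hb in
/-- The disorder marginal of the joint law. -/
lemma measurePreserving_fst_joint : MeasurePreserving Prod.fst (joint μ P H hH) μ := by
  have := isMarkovKernel_gibbsKernel (P := P) hH hb
  exact ⟨measurable_fst, by unfold joint; exact Measure.fst_compProd μ _⟩

end Joint

/-! ### The Nishimori identity -/

section Nishimori

variable {X : Type*} [MeasurableSpace X] {P : Measure X}
  [IsProbabilityMeasure P] {J : Type*} [Fintype J]

/-- The Hamiltonian of the Bayesian posterior of a signal `x` observed as `y = Ψ x + noise`. -/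
def potential (Ψ : X → J → ℝ) (y : J → ℝ) (x : X) : ℝ :=
  (∑ j, Ψ x j ^ 2) / 2 - ∑ j, Ψ x j * y j

variable {Ψ : X → J → ℝ} (hΨ : ∀ j, BddMeas fun x => Ψ x j)

include hΨ

omit [Fintype J] in
lemma measurable_feature : Measurable Ψ := measurable_pi_iff.2 fun j => (hΨ j).1

lemma bddMeas_potential (y : J → ℝ) : BddMeas (potential Ψ y) := by
  have h1 : BddMeas fun x => (1 / 2) * ∑ j, Ψ x j ^ 2 :=
    (BddMeas.sum fun j _ => (hΨ j).pow 2).const_mul _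
  have h2 : BddMeas fun x => ∑ j, Ψ x j * y j :=
    BddMeas.sum fun j _ => (hΨ j).mul (BddMeas.const (y j))
  have := h1.sub h2
  unfold potential
  convert this using 2
  ring

lemma measurable_potential : Measurable (Function.uncurry (potential Ψ)) := by
  have := measurable_feature hΨ
  unfold potential Function.uncurry
  fun_prop

omit hΨ in
/-- The swap of the signal and the posterior sample, at fixed observation. -/
def nishimoriSwap (Ψ : X → J → ℝ) (p : (X × (J → ℝ)) × X) : (X × (J → ℝ)) × X :=
  ((p.2, p.1.2 + Ψ p.1.1 - Ψ p.2), p.1.1)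

omit [Fintype J] in
lemma measurable_nishimoriSwap : Measurable (nishimoriSwap Ψ) := by
  have := measurable_feature hΨ
  unfold nishimoriSwap
  fun_prop

lemma measurable_potential_obs :
    Measurable (Function.uncurry fun (ω : X × (J → ℝ)) => potential Ψ (Ψ ω.1 + ω.2)) := by
  have := measurable_feature hΨ
  exact (measurable_potential hΨ).comp
    (f := fun q : (X × (J → ℝ)) × X => (Ψ q.1.1 + q.1.2, q.2)) (by fun_prop)

omit hΨ in
/-- The law of signal, noise and posterior sample. -/
def channelLaw (P : Measure X) [IsProbabilityMeasure P] (Ψ : X → J → ℝ)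
    (hΨ : ∀ j, BddMeas fun x => Ψ x j) : Measure ((X × (J → ℝ)) × X) :=
  joint (P.prod (stdNoise J)) P (fun ω => potential Ψ (Ψ ω.1 + ω.2)) (measurable_potential_obs hΨ)

/-- In terms of signal `s`, sample `x` and observation `y`, the density of the joint law is
symmetric in `s` and `x`. -/
lemma lintegral_channelLaw {G : X → X → (J → ℝ) → ENNReal}
    (hG : Measurable fun q : X × X × (J → ℝ) => G q.1 q.2.1 q.2.2) :
    ∫⁻ p, G p.2 p.1.1 (Ψ p.1.1 + p.1.2) ∂(channelLaw P Ψ hΨ) =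
      ∫⁻ s, ∫⁻ x, ∫⁻ y, ENNReal.ofReal (Real.exp (-potential Ψ y s) *
        (Real.exp (-potential Ψ y x) / ∫ x, Real.exp (-potential Ψ y x) ∂P)) * G x s y
        ∂(stdNoise J) ∂P ∂P := by
  have hm := measurable_feature hΨ
  have hpm := measurable_potential hΨ
  unfold channelLaw
  rw [lintegral_joint _ (fun ω => bddMeas_potential hΨ _) (by fun_prop)]
  have hZ : Measurable fun y : J → ℝ => ∫ x, Real.exp (-potential Ψ y x) ∂P :=
    measurable_integral_param hpm.neg.exp
  have hk : Measurable fun q : X × X × (J → ℝ) => ENNReal.ofReal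
      (Real.exp (-potential Ψ q.2.2 q.1) / ∫ x, Real.exp (-potential Ψ q.2.2 x) ∂P) * 
      G q.1 q.2.1 q.2.2 := by
    refine Measurable.mul (Measurable.ennreal_ofReal (Measurable.div ?_ ?_)) hG
    · exact (hpm.comp (f := fun q : X × X × (J → ℝ) => (q.2.2, q.1)) (by fun_prop)).neg.exp
    · exact hZ.comp (by fun_prop)
  have h1 : ∀ ω : X × (J → ℝ), ∫⁻ x, G x ω.1 (Ψ ω.1 + ω.2) ∂(gibbs P (potential Ψ (Ψ ω.1 + ω.2))) =
      ∫⁻ x, ENNReal.ofReal (Real.exp (-potential Ψ (Ψ ω.1 + ω.2) x) /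
        ∫ x, Real.exp (-potential Ψ (Ψ ω.1 + ω.2) x) ∂P) * G x ω.1 (Ψ ω.1 + ω.2) ∂P :=
    fun ω => lintegral_tilted _ _
  simp only [h1]
  have hk2 : Measurable fun q : (X × (J → ℝ)) × X =>
      ENNReal.ofReal (Real.exp (-potential Ψ (Ψ q.1.1 + q.1.2) q.2) /
        ∫ x, Real.exp (-potential Ψ (Ψ q.1.1 + q.1.2) x) ∂P) * G q.2 q.1.1 (Ψ q.1.1 + q.1.2) :=
    hk.comp (f := fun q : (X × (J → ℝ)) × X => (q.2, q.1.1, Ψ q.1.1 + q.1.2)) (by fun_prop)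
  rw [lintegral_prod _ hk2.lintegral_prod_right'.aemeasurable]
  refine lintegral_congr fun s => ?_
  rw [lintegral_lintegral_swap]
  swap
  · exact (hk2.comp (f := fun q : (J → ℝ) × X => ((s, q.1), q.2)) (by fun_prop)).aemeasurable
  refine lintegral_congr fun x => ?_
  have h2 := lintegral_stdNoise_add (Ψ s) (f := fun y => ENNReal.ofReal
      (Real.exp (-potential Ψ y x) / ∫ x, Real.exp (-potential Ψ y x) ∂P) * G x s y)
      (hk.comp (f := fun y => (x, s, y)) (by fun_prop))
  simp only [add_comm _ (Ψ s)] at h2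
  rw [h2]
  refine lintegral_congr fun y => ?_
  rw [← mul_assoc, ← ENNReal.ofReal_mul (by positivity)]
  congr 4
  unfold potential
  ring

/-- **Nishimori identity**: swapping the signal and the posterior sample at fixed observation
preserves their joint law. -/
lemma measurePreserving_nishimoriSwap :
    MeasurePreserving (nishimoriSwap Ψ) (channelLaw P Ψ hΨ) (channelLaw P Ψ hΨ) := by
  have hm := measurable_feature hΨ
  have hpm := measurable_potential hΨ
  have hτ := measurable_nishimoriSwap hΨ
  refine ⟨hτ, Measure.ext_of_lintegral _ fun f hf => ?_⟩
  rw [lintegral_map hf hτ]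
  have hZ : Measurable fun y : J → ℝ => ∫ x, Real.exp (-potential Ψ y x) ∂P :=
    measurable_integral_param hpm.neg.exp
  set G : X → X → (J → ℝ) → ENNReal := fun x s y => f ((s, y - Ψ s), x) with hGdef
  have hG : Measurable fun q : X × X × (J → ℝ) => G q.1 q.2.1 q.2.2 :=
    hf.comp (f := fun q : X × X × (J → ℝ) => ((q.2.1, q.2.2 - Ψ q.2.1), q.1)) (by fun_prop)
  have hG' : Measurable fun q : X × X × (J → ℝ) => G q.2.1 q.1 q.2.2 :=
    hf.comp (f := fun q : X × X × (J → ℝ) => ((q.1, q.2.2 - Ψ q.1), q.2.1)) (by fun_prop)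
  have e1 : ∀ p : (X × (J → ℝ)) × X, f (nishimoriSwap Ψ p) =
      G p.1.1 p.2 (Ψ p.1.1 + p.1.2) := by
    intro p
    simp only [hGdef, nishimoriSwap]
    congr 3
    abel
  have e2 : ∀ p : (X × (J → ℝ)) × X, f p = G p.2 p.1.1 (Ψ p.1.1 + p.1.2) := by
    intro p
    simp only [hGdef, add_sub_cancel_left]
  simp only [e1]
  rw [lintegral_congr e2, lintegral_channelLaw hΨ (G := fun x s y => G s x y) hG',
    lintegral_channelLaw hΨ hG, lintegral_lintegral_swap]
  · refine lintegral_congr fun s => lintegral_congr fun x => lintegral_congr fun y => ?_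
    congr 2
    ring
  · refine Measurable.aemeasurable (Measurable.lintegral_prod_right'
      (f := fun q : (X × X) × (J → ℝ) =>
      ENNReal.ofReal (Real.exp (-potential Ψ q.2 q.1.1) *
        (Real.exp (-potential Ψ q.2 q.1.2) / ∫ x, Real.exp (-potential Ψ q.2 x) ∂P)) *
        G q.1.1 q.1.2 q.2) ?_)
    refine Measurable.mul (Measurable.ennreal_ofReal (Measurable.mul ?_ (Measurable.div ?_ ?_)))
      (hG.comp (f := fun q : (X × X) × (J → ℝ) => (q.1.1, q.1.2, q.2)) (by fun_prop))
    · exact (hpm.comp (f := fun q : (X × X) × (J → ℝ) => (q.2, q.1.1)) (by fun_prop)).neg.exp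
    · exact (hpm.comp (f := fun q : (X × X) × (J → ℝ) => (q.2, q.1.2)) (by fun_prop)).neg.exp
    · exact hZ.comp (by fun_prop)

end Nishimori

/-! ### The inference model at a fixed mean-field signal-to-noise ratio -/

/-- An inference model: a signal `x` with i.i.d. coordinates of law `P₀`, read through the bounded
function `c`, is observed through bounded features `Φ x` in standard Gaussian noise. To these base
observations, mean-field observations of the `c (x i)` are added below. The constant `D` controls
the size of the features and their dependence on a single coordinate of the signal. -/
structure Model (n : ℕ) (ι : Type) [Fintype ι] where
  /-- prior of one coordinate -/
  P₀ : Measure ℝ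
  prob : IsProbabilityMeasure P₀
  /-- readout of one coordinate -/
  c : ℝ → ℝ
  /-- bound on the readout -/
  M : ℝ
  one_le_M : 1 ≤ M
  measurable_c : Measurable c
  abs_c_le : ∀ t, |c t| ≤ M
  /-- base features -/
  Φ : (Fin n → ℝ) → ι → ℝ
  measurable_Φ : Measurable Φ
  /-- bounds on the base features -/
  β : ι → ℝ
  abs_Φ_le : ∀ x a, |Φ x a| ≤ β a
  /-- constant controlling the base features -/
  D : ℝ
  sum_β_le : ∑ a, β a ^ 2 ≤ n * D
  abs_sum_Φ_update_le : ∀ x s i t, |∑ a, Φ x a * (Φ (Function.update s i t) a - Φ s a)| ≤ D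

namespace Model

variable {n : ℕ} {ι : Type} [Fintype ι] (S : Model n ι)

instance : IsProbabilityMeasure S.P₀ := S.prob

attribute [fun_prop] Model.measurable_c Model.measurable_Φ

/-- Law of the signal. -/
abbrev P : Measure (Fin n → ℝ) := Measure.pi fun _ => S.P₀

/-- Law of the disorder: signal, and noise of the base and mean-field observations. -/
abbrev μ : Measure ((Fin n → ℝ) × (ι ⊕ Fin n → ℝ)) := S.P.prod (stdNoise (ι ⊕ Fin n))

lemma M_pos : 0 < S.M := one_pos.trans_le S.one_le_M

/-- Difference between sample and signal in one coordinate. -/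
def d (i : Fin n) (s x : Fin n → ℝ) : ℝ := S.c (x i) - S.c (s i)

lemma abs_d_le (i : Fin n) (s x : Fin n → ℝ) : |S.d i s x| ≤ 2 * S.M := by
  have h1 := S.abs_c_le (x i)
  have h2 := S.abs_c_le (s i)
  unfold d
  exact (abs_sub _ _).trans (by linarith)

lemma measurable_d (i : Fin n) : Measurable (Function.uncurry (S.d i)) := by
  unfold d Function.uncurry; fun_prop

lemma bddMeas_d (i : Fin n) (s : Fin n → ℝ) : BddMeas (S.d i s) :=
  .mk' ((S.measurable_d i).comp measurable_prodMk_left) (S.abs_d_le i s)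

/-- Squared distance between sample and signal. -/
def W (s x : Fin n → ℝ) : ℝ := ∑ i, S.d i s x ^ 2

/-- Correlation of the mean-field noise with the difference between sample and signal. -/
def V (ω : (Fin n → ℝ) × (ι ⊕ Fin n → ℝ)) (x : Fin n → ℝ) : ℝ :=
  ∑ i, S.d i ω.1 x * ω.2 (.inr i)

/-- Hamiltonian of the base observations. -/
def base (ω : (Fin n → ℝ) × (ι ⊕ Fin n → ℝ)) (x : Fin n → ℝ) : ℝ :=
  (∑ a, S.Φ x a ^ 2) / 2 - ∑ a, S.Φ x a * (S.Φ ω.1 a + ω.2 (.inl a))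

/-- The Hamiltonian at mean-field signal-to-noise ratio `u ^ 2`, normalised such that its
mean-field part vanishes when sample and signal agree. -/
def H (u : ℝ) (ω : (Fin n → ℝ) × (ι ⊕ Fin n → ℝ)) (x : Fin n → ℝ) : ℝ :=
  S.base ω x + u * -S.V ω x + u ^ 2 * (S.W ω.1 x / 2)

/-- The derivative of the Hamiltonian in `u`. -/
def A (u : ℝ) (ω : (Fin n → ℝ) × (ι ⊕ Fin n → ℝ)) (x : Fin n → ℝ) : ℝ :=
  -S.V ω x + 2 * u * (S.W ω.1 x / 2)

/-- All the features observed at mean-field signal-to-noise ratio `u ^ 2`. -/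
def Ψ (u : ℝ) (x : Fin n → ℝ) : ι ⊕ Fin n → ℝ := Sum.elim (S.Φ x) fun i => u * S.c (x i)

lemma measurable_W : Measurable (Function.uncurry S.W) := by
  unfold W
  exact Finset.measurable_sum _ fun i _ => (S.measurable_d i).pow_const 2

lemma measurable_V : Measurable (Function.uncurry S.V) := by
  unfold V
  refine Finset.measurable_sum _ fun i _ => Measurable.mul ?_ (by fun_prop)
  exact (S.measurable_d i).comp
    (f := fun q : ((Fin n → ℝ) × (ι ⊕ Fin n → ℝ)) × (Fin n → ℝ) => (q.1.1, q.2)) (by fun_prop)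

lemma measurable_base : Measurable (Function.uncurry S.base) := by
  unfold base Function.uncurry
  fun_prop

lemma measurable_H : Measurable fun q : (ℝ × (Fin n → ℝ) × (ι ⊕ Fin n → ℝ)) × (Fin n → ℝ) =>
    S.H q.1.1 q.1.2 q.2 := by
  unfold H
  have h1 := S.measurable_base.comp (f := fun q : (ℝ × (Fin n → ℝ) × (ι ⊕ Fin n → ℝ)) ×
    (Fin n → ℝ) => (q.1.2, q.2)) (by fun_prop)
  have h2 := S.measurable_V.comp (f := fun q : (ℝ × (Fin n → ℝ) × (ι ⊕ Fin n → ℝ)) ×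
    (Fin n → ℝ) => (q.1.2, q.2)) (by fun_prop)
  have h3 := S.measurable_W.comp (f := fun q : (ℝ × (Fin n → ℝ) × (ι ⊕ Fin n → ℝ)) ×
    (Fin n → ℝ) => (q.1.2.1, q.2)) (by fun_prop)
  have h4 : Measurable fun q : (ℝ × (Fin n → ℝ) × (ι ⊕ Fin n → ℝ)) × (Fin n → ℝ) => q.1.1 := by
    fun_prop
  exact (h1.add (h4.mul h2.neg)).add ((h4.pow_const 2).mul (h3.div_const 2))

lemma measurable_A : Measurable fun q : (ℝ × (Fin n → ℝ) × (ι ⊕ Fin n → ℝ)) × (Fin n → ℝ) =>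
    S.A q.1.1 q.1.2 q.2 := by
  unfold A
  have h2 := S.measurable_V.comp (f := fun q : (ℝ × (Fin n → ℝ) × (ι ⊕ Fin n → ℝ)) ×
    (Fin n → ℝ) => (q.1.2, q.2)) (by fun_prop)
  have h3 := S.measurable_W.comp (f := fun q : (ℝ × (Fin n → ℝ) × (ι ⊕ Fin n → ℝ)) ×
    (Fin n → ℝ) => (q.1.2.1, q.2)) (by fun_prop)
  have h4 : Measurable fun q : (ℝ × (Fin n → ℝ) × (ι ⊕ Fin n → ℝ)) × (Fin n → ℝ) => q.1.1 := by
    fun_prop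
  exact h2.neg.add ((h4.const_mul 2).mul (h3.div_const 2))

lemma measurable_H_right (u : ℝ) : Measurable (Function.uncurry (S.H u)) :=
  S.measurable_H.comp (f := fun q : ((Fin n → ℝ) × (ι ⊕ Fin n → ℝ)) × (Fin n → ℝ) =>
    ((u, q.1), q.2)) (by fun_prop)

lemma bddMeas_Φ (a : ι) : BddMeas fun x => S.Φ x a :=
  .mk' (by fun_prop) fun x => S.abs_Φ_le x a

lemma bddMeas_base (ω : (Fin n → ℝ) × (ι ⊕ Fin n → ℝ)) : BddMeas (S.base ω) := by
  have h1 : BddMeas fun x => ∑ a, S.Φ x a ^ 2 := .sum fun a _ => (S.bddMeas_Φ a).pow 2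
  have h2 : BddMeas fun x => ∑ a, S.Φ x a * (S.Φ ω.1 a + ω.2 (.inl a)) :=
    .sum fun a _ => (S.bddMeas_Φ a).mul (.const _)
  have := (h1.const_mul (1 / 2)).sub h2
  unfold base
  convert this using 2
  ring

lemma bddMeas_V (ω : (Fin n → ℝ) × (ι ⊕ Fin n → ℝ)) : BddMeas (S.V ω) :=
  .sum fun i _ => (S.bddMeas_d i _).mul (.const _)

lemma bddMeas_W (s : Fin n → ℝ) : BddMeas (S.W s) :=
  .sum fun i _ => (S.bddMeas_d i _).pow 2

lemma bddMeas_half_W (s : Fin n → ℝ) : BddMeas fun x => S.W s x / 2 := by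
  simpa [div_eq_inv_mul] using (S.bddMeas_W s).const_mul (1 / 2)

lemma bddMeas_H (u : ℝ) (ω : (Fin n → ℝ) × (ι ⊕ Fin n → ℝ)) : BddMeas (S.H u ω) :=
  ((S.bddMeas_base ω).add ((S.bddMeas_V ω).neg.const_mul u)).add
    ((S.bddMeas_half_W ω.1).const_mul _)

lemma bddMeas_A (u : ℝ) (ω : (Fin n → ℝ) × (ι ⊕ Fin n → ℝ)) : BddMeas (S.A u ω) :=
  (S.bddMeas_V ω).neg.add ((S.bddMeas_half_W ω.1).const_mul _)

lemma bddMeas_c (i : Fin n) : BddMeas fun x : Fin n → ℝ => S.c (x i) :=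
  .mk' (by fun_prop) fun x => S.abs_c_le (x i)

lemma bddMeas_Ψ (u : ℝ) : ∀ j, BddMeas fun x => S.Ψ u x j
  | .inl a => S.bddMeas_Φ a
  | .inr i => (S.bddMeas_c i).const_mul u

/-- The Gibbs measure at mean-field signal-to-noise ratio `u ^ 2`. -/
abbrev G (u : ℝ) (ω : (Fin n → ℝ) × (ι ⊕ Fin n → ℝ)) : Measure (Fin n → ℝ) :=
  gibbs S.P (S.H u ω)

instance (u : ℝ) (ω : (Fin n → ℝ) × (ι ⊕ Fin n → ℝ)) : IsProbabilityMeasure (S.G u ω) :=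
  gibbs_isProb (S.bddMeas_H u ω)

lemma H_eq_potential (u : ℝ) (ω : (Fin n → ℝ) × (ι ⊕ Fin n → ℝ)) (x : Fin n → ℝ) :
    S.H u ω x = potential (S.Ψ u) (S.Ψ u ω.1 + ω.2) x +
      ∑ i, (u ^ 2 * S.c (ω.1 i) ^ 2 / 2 + u * S.c (ω.1 i) * ω.2 (.inr i)) := by
  unfold H potential base V W d Ψ
  simp only [Fintype.sum_sum_type, Sum.elim_inl, Sum.elim_inr, Pi.add_apply]
  have key : u * -∑ i, (S.c (x i) - S.c (ω.1 i)) * ω.2 (.inr i) +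
      u ^ 2 * ((∑ i, (S.c (x i) - S.c (ω.1 i)) ^ 2) / 2) =
      (∑ i, (u * S.c (x i)) ^ 2) / 2 -
        ∑ i, u * S.c (x i) * (u * S.c (ω.1 i) + ω.2 (.inr i)) +
      ∑ i, (u ^ 2 * S.c (ω.1 i) ^ 2 / 2 + u * S.c (ω.1 i) * ω.2 (.inr i)) := by
    simp only [Finset.sum_div, ← Finset.sum_neg_distrib, Finset.mul_sum]
    rw [← Finset.sum_add_distrib, ← Finset.sum_sub_distrib, ← Finset.sum_add_distrib]
    exact Finset.sum_congr rfl fun i _ => by ring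
  linarith

lemma G_eq_potential (u : ℝ) (ω : (Fin n → ℝ) × (ι ⊕ Fin n → ℝ)) :
    S.G u ω = gibbs S.P (potential (S.Ψ u) (S.Ψ u ω.1 + ω.2)) := by
  have : S.H u ω = fun x => potential (S.Ψ u) (S.Ψ u ω.1 + ω.2) x +
      ∑ i, (u ^ 2 * S.c (ω.1 i) ^ 2 / 2 + u * S.c (ω.1 i) * ω.2 (.inr i)) :=
    funext fun x => S.H_eq_potential u ω x
  unfold G
  rw [this, gibbs_add_const]

/-- The joint law of the disorder and of a posterior sample. -/
abbrev law (u : ℝ) : Measure (((Fin n → ℝ) × (ι ⊕ Fin n → ℝ)) × (Fin n → ℝ)) :=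
  channelLaw S.P (S.Ψ u) (S.bddMeas_Ψ u)

instance (u : ℝ) : IsProbabilityMeasure (S.law u) :=
  isProbabilityMeasure_joint _ fun _ => bddMeas_potential (S.bddMeas_Ψ u) _

lemma integral_law {u : ℝ} {f : ((Fin n → ℝ) × (ι ⊕ Fin n → ℝ)) × (Fin n → ℝ) → ℝ}
    (hf : Integrable f (S.law u)) :
    ∫ p, f p ∂(S.law u) = ∫ ω, ∫ x, f (ω, x) ∂(S.G u ω) ∂S.μ := by
  simp only [G_eq_potential]
  exact integral_joint _ (fun _ => bddMeas_potential (S.bddMeas_Ψ u) _) hf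

lemma measurePreserving_fst_law (u : ℝ) : MeasurePreserving Prod.fst (S.law u) S.μ :=
  measurePreserving_fst_joint _ fun _ => bddMeas_potential (S.bddMeas_Ψ u) _

lemma measurePreserving_swap_law (u : ℝ) :
    MeasurePreserving (nishimoriSwap (S.Ψ u)) (S.law u) (S.law u) :=
  measurePreserving_nishimoriSwap _

/-- The Gibbs measure depends on the disorder through the observation only. -/
lemma G_swap (u : ℝ) (p : ((Fin n → ℝ) × (ι ⊕ Fin n → ℝ)) × (Fin n → ℝ)) :
    S.G u (nishimoriSwap (S.Ψ u) p).1 = S.G u p.1 := by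
  rw [G_eq_potential, G_eq_potential]
  congr 2
  simp only [nishimoriSwap]
  abel

/-- The noises are standard Gaussian. -/
lemma measurePreserving_noise (u : ℝ) (j : ι ⊕ Fin n) :
    MeasurePreserving (fun p : ((Fin n → ℝ) × (ι ⊕ Fin n → ℝ)) × (Fin n → ℝ) => p.1.2 j)
      (S.law u) (gaussianReal 0 1) :=
  (measurePreserving_eval (fun _ : ι ⊕ Fin n => gaussianReal 0 1) j).comp
    (measurePreserving_snd.comp (S.measurePreserving_fst_law u))

end Model

/-- The fourth moment of a standard Gaussian. -/
def gaussFourth : ℝ := ∫ t, t ^ 4 ∂(gaussianReal 0 1)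

lemma gaussFourth_nonneg : 0 ≤ gaussFourth := integral_nonneg fun t => by positivity

lemma integrable_pow_four_gaussianReal : Integrable (fun t : ℝ => t ^ 4) (gaussianReal 0 1) := by
  have := (memLp_id_gaussianReal (μ := 0) (v := 1) 4).integrable_norm_pow (by norm_num)
  refine this.congr (.of_forall fun t => ?_)
  simp [Even.pow_abs (show Even 4 by decide)]

namespace Model

variable {n : ℕ} {ι : Type} [Fintype ι] (S : Model n ι)

lemma memLp_noise (u : ℝ) (j : ι ⊕ Fin n) :
    MemLp (fun p : ((Fin n → ℝ) × (ι ⊕ Fin n → ℝ)) × (Fin n → ℝ) => p.1.2 j) 2 (S.law u) :=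
  (memLp_id_gaussianReal (μ := 0) (v := 1) 2).comp_measurePreserving
    (S.measurePreserving_noise u j)

lemma integral_noise_pow_four (u : ℝ) (j : ι ⊕ Fin n) :
    ∫ p, p.1.2 j ^ 4 ∂(S.law u) = gaussFourth := by
  have h := S.measurePreserving_noise u j
  unfold gaussFourth
  rw [← h.map_eq, integral_map h.measurable.aemeasurable (by fun_prop)]

lemma integrable_noise_pow_four (u : ℝ) (j : ι ⊕ Fin n) :
    Integrable (fun p : ((Fin n → ℝ) × (ι ⊕ Fin n → ℝ)) × (Fin n → ℝ) => p.1.2 j ^ 4)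
      (S.law u) :=
  ((S.measurePreserving_noise u j).integrable_comp
    integrable_pow_four_gaussianReal.aestronglyMeasurable).2 integrable_pow_four_gaussianReal

lemma measurable_d_law (i : Fin n) : Measurable
    fun p : ((Fin n → ℝ) × (ι ⊕ Fin n → ℝ)) × (Fin n → ℝ) => S.d i p.1.1 p.2 :=
  (S.measurable_d i).comp (f := fun p : ((Fin n → ℝ) × (ι ⊕ Fin n → ℝ)) × (Fin n → ℝ) =>
    (p.1.1, p.2)) (by fun_prop)

lemma bddMeas_d_law (i : Fin n) : BddMeas
    fun p : ((Fin n → ℝ) × (ι ⊕ Fin n → ℝ)) × (Fin n → ℝ) => S.d i p.1.1 p.2 :=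
  .mk' (S.measurable_d_law i) fun _ => S.abs_d_le i _ _

/-- The Nishimori swap turns the noise `z` into `z - u d`, where `d` is the difference of sample and
signal. As both are standard Gaussian, `u d` has a bounded fourth moment. -/
lemma integral_d_pow_four_le (u : ℝ) (i : Fin n) :
    u ^ 4 * ∫ p, S.d i p.1.1 p.2 ^ 4 ∂(S.law u) ≤ 16 * gaussFourth := by
  have hsw := S.measurePreserving_swap_law u
  have e : ∀ p, (nishimoriSwap (S.Ψ u) p).1.2 (.inr i) = p.1.2 (.inr i) - u * S.d i p.1.1 p.2 := by
    intro p
    simp only [nishimoriSwap, Pi.sub_apply, Pi.add_apply, Ψ, Sum.elim_inr, d]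
    ring
  have h4 := S.integral_noise_pow_four u (.inr i)
  have i4 := S.integrable_noise_pow_four u (.inr i)
  have i4' : Integrable (fun p => (p.1.2 (.inr i) - u * S.d i p.1.1 p.2) ^ 4) (S.law u) := by
    simpa only [Function.comp_def, e] using (hsw.integrable_comp i4.aestronglyMeasurable).2 i4
  have h4' : ∫ p, (p.1.2 (.inr i) - u * S.d i p.1.1 p.2) ^ 4 ∂(S.law u) = gaussFourth := by
    simp only [← e]
    rw [← h4]
    conv_rhs => rw [← hsw.map_eq]
    rw [integral_map hsw.measurable.aemeasurable (by fun_prop)]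
  have id4 : Integrable (fun p => S.d i p.1.1 p.2 ^ 4) (S.law u) :=
    ((S.bddMeas_d_law i).pow 4).integrable _
  rw [← integral_const_mul]
  calc ∫ p, u ^ 4 * S.d i p.1.1 p.2 ^ 4 ∂(S.law u)
      ≤ ∫ p, (8 * p.1.2 (.inr i) ^ 4 + 8 * (p.1.2 (.inr i) - u * S.d i p.1.1 p.2) ^ 4)
          ∂(S.law u) := by
        refine integral_mono (id4.const_mul _) ((i4.const_mul 8).fun_add (i4'.const_mul 8))
          fun p => ?_
        set z := p.1.2 (.inr i)
        set v := z - u * S.d i p.1.1 p.2 with hv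
        have : u ^ 4 * S.d i p.1.1 p.2 ^ 4 = (z - v) ^ 4 := by rw [hv]; ring
        simp only [this]
        nlinarith [sq_nonneg (z + v), sq_nonneg (z ^ 2 - v ^ 2), sq_nonneg (z - v),
          sq_nonneg (z * v + (z ^ 2 + v ^ 2) / 2), sq_nonneg ((z + v) ^ 2),
          sq_nonneg (z * (z + v)), sq_nonneg (v * (z + v))]
    _ = 16 * gaussFourth := by
        rw [integral_add (i4.const_mul 8) (i4'.const_mul 8), integral_const_mul,
          integral_const_mul, h4, h4']
        ring

lemma A_eq_sum (u : ℝ) (ω : (Fin n → ℝ) × (ι ⊕ Fin n → ℝ)) (x : Fin n → ℝ) :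
    S.A u ω x = ∑ i, (u * S.d i ω.1 x ^ 2 - S.d i ω.1 x * ω.2 (.inr i)) := by
  unfold A V W
  rw [Finset.sum_sub_distrib, ← Finset.mul_sum]
  ring

lemma memLp_A (u : ℝ) : MemLp (fun p => S.A u p.1 p.2) 2 (S.law u) := by
  simp only [A_eq_sum]
  refine memLp_finsetSum _ fun i _ => ?_
  refine ((((S.bddMeas_d_law i).pow 2).const_mul u).memLp 2 _).sub ?_
  exact (S.memLp_noise u (.inr i)).mul (p := ⊤) (q := 2) (r := 2) ((S.bddMeas_d_law i).memLp ⊤ _)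

/-- The constant in the bound on the second moment of the derivative of the Hamiltonian. Adding `1`
makes `1 ≤ κ`, so that `κ` also bounds the first moment. -/
def κ : ℝ := 49 * gaussFourth + 1

lemma κ_pos : 0 < κ := by have := gaussFourth_nonneg; unfold κ; positivity

lemma integral_A_sq_le {u : ℝ} (hu : 0 < u) :
    ∫ p, S.A u p.1 p.2 ^ 2 ∂(S.law u) ≤ n ^ 2 * κ / u ^ 2 := by
  rw [le_div_iff₀ (by positivity), mul_comm, ← integral_const_mul]
  have id4 : ∀ i, Integrable (fun p => S.d i p.1.1 p.2 ^ 4) (S.law u) := fun i =>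
    ((S.bddMeas_d_law i).pow 4).integrable _
  have i4 := fun i : Fin n => S.integrable_noise_pow_four u (.inr i)
  have hint : ∀ i, Integrable
      (fun p => 3 * u ^ 4 * S.d i p.1.1 p.2 ^ 4 + p.1.2 (.inr i) ^ 4) (S.law u) :=
    fun i => ((id4 i).const_mul _).fun_add (i4 i)
  calc ∫ p, u ^ 2 * S.A u p.1 p.2 ^ 2 ∂(S.law u)
      ≤ ∫ p, (n : ℝ) * ∑ i, (3 * u ^ 4 * S.d i p.1.1 p.2 ^ 4 + p.1.2 (.inr i) ^ 4) ∂(S.law u) := by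
        refine integral_mono ((S.memLp_A u).integrable_sq.const_mul _)
          ((integrable_finsetSum _ fun i _ => hint i).const_mul _) fun p => ?_
        simp only [A_eq_sum]
        have h1 := sq_sum_le_card_mul_sum_sq (s := (Finset.univ : Finset (Fin n)))
          (f := fun i => u * S.d i p.1.1 p.2 ^ 2 - S.d i p.1.1 p.2 * p.1.2 (.inr i))
        simp only [Finset.card_univ, Fintype.card_fin] at h1
        refine (mul_le_mul_of_nonneg_left h1 (sq_nonneg u)).trans ?_
        rw [mul_left_comm, Finset.mul_sum]
        gcongr with i _
        set δ := S.d i p.1.1 p.2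
        set z := p.1.2 (.inr i)
        nlinarith [sq_nonneg (u ^ 2 * δ ^ 2 - z ^ 2), sq_nonneg (u ^ 2 * δ ^ 2 + u * δ * z)]
    _ = n * ∑ i : Fin n, (3 * (u ^ 4 * ∫ p, S.d i p.1.1 p.2 ^ 4 ∂(S.law u)) + gaussFourth) := by
        rw [integral_const_mul, integral_finsetSum _ fun i _ => hint i]
        congr 1
        refine Finset.sum_congr rfl fun i _ => ?_
        rw [integral_add ((id4 i).const_mul _) (i4 i), integral_const_mul,
          S.integral_noise_pow_four]
        ring
    _ ≤ n * ∑ i : Fin n, κ := by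
        gcongr with i _
        have := S.integral_d_pow_four_le u i
        unfold κ
        linarith
    _ = n ^ 2 * κ := by
        simp
        ring

end Model

/-! ### Integration by parts and control of the overlap -/

/-- Gaussian integration by parts in one coordinate. -/
lemma integral_coord_mul_stdNoise {J : Type*} [Fintype J] [DecidableEq J] {f f' : (J → ℝ) → ℝ}
    (j : J) (hf : BddMeas f) (hf' : BddMeas f')
    (hd : ∀ w t, HasDerivAt (fun t => f (Function.update w j t)) (f' (Function.update w j t)) t) :
    ∫ w, w j * f w ∂(stdNoise J) = ∫ w, f' w ∂(stdNoise J) := by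
  have hmp := measurePreserving_update (gaussianReal 0 1) j
  obtain ⟨hfm, B, hB⟩ := id hf
  obtain ⟨hfm', B', hB'⟩ := id hf'
  have hi : Integrable (fun w : J → ℝ => w j * f w) (stdNoise J) := by
    have h1 : MemLp (fun w : J → ℝ => w j) 1 (stdNoise J) :=
      (memLp_id_gaussianReal (μ := 0) (v := 1) 1).comp_measurePreserving
        (measurePreserving_eval (fun _ : J => gaussianReal 0 1) j)
    exact (h1.integrable le_rfl).mul_bdd hfm.aestronglyMeasurable (.of_forall hB)
  have hi' : Integrable f' (stdNoise J) := hf'.integrable _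
  have e1 := integral_map hmp.measurable.aemeasurable (f := fun w : J → ℝ => w j * f w)
    (by rw [hmp.map_eq]; exact hi.aestronglyMeasurable)
  have e2 := integral_map hmp.measurable.aemeasurable (f := f')
    (by rw [hmp.map_eq]; exact hi'.aestronglyMeasurable)
  rw [hmp.map_eq] at e1 e2
  have I1 : Integrable (fun p : (J → ℝ) × ℝ => Function.update p.1 j p.2 j *
      f (Function.update p.1 j p.2)) ((stdNoise J).prod (gaussianReal 0 1)) :=
    (hmp.integrable_comp hi.aestronglyMeasurable).2 hi
  have I2 : Integrable (fun p : (J → ℝ) × ℝ => f' (Function.update p.1 j p.2))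
      ((stdNoise J).prod (gaussianReal 0 1)) :=
    (hmp.integrable_comp hi'.aestronglyMeasurable).2 hi'
  rw [e1, e2, integral_prod _ I1, integral_prod _ I2]
  refine integral_congr_ae (.of_forall fun w => ?_)
  simp only [Function.update_self]
  exact integral_mul_gaussianReal (hd w) (hfm'.comp (hmp.measurable.comp measurable_prodMk_left))
    (fun t => hB _) fun t => hB' _

namespace Model

variable {n : ℕ} {ι : Type} [Fintype ι] (S : Model n ι)

lemma measurable_avg (u : ℝ) {g : (Fin n → ℝ) → (Fin n → ℝ) → ℝ}
    (hg : Measurable (Function.uncurry g)) :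
    Measurable fun ω => ∫ x, g ω.1 x ∂(S.G u ω) := by
  have hg' : Measurable (Function.uncurry
      fun (ω : (Fin n → ℝ) × (ι ⊕ Fin n → ℝ)) x => g ω.1 x) :=
    hg.comp (f := fun q : ((Fin n → ℝ) × (ι ⊕ Fin n → ℝ)) × (Fin n → ℝ) => (q.1.1, q.2))
      (by fun_prop)
  exact measurable_integral_gibbs (S.measurable_H_right u) hg'

lemma abs_avg_le (u : ℝ) {g : (Fin n → ℝ) → (Fin n → ℝ) → ℝ} {B : ℝ}
    (hB : ∀ s x, |g s x| ≤ B) (ω) : |∫ x, g ω.1 x ∂(S.G u ω)| ≤ B :=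
  abs_integral_gibbs_le (S.bddMeas_H u ω) (hB ω.1)

lemma bddMeas_avg (u : ℝ) {g : (Fin n → ℝ) → (Fin n → ℝ) → ℝ}
    (hg : Measurable (Function.uncurry g)) {B : ℝ} (hB : ∀ s x, |g s x| ≤ B) :
    BddMeas fun ω => ∫ x, g ω.1 x ∂(S.G u ω) :=
  .mk' (S.measurable_avg u hg) (S.abs_avg_le u hB)

open Classical in
/-- Along one mean-field noise variable, the Hamiltonian is affine. -/
lemma H_update (u : ℝ) (i : Fin n) (s : Fin n → ℝ) (w : ι ⊕ Fin n → ℝ) (t : ℝ) :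
    S.H u (s, Function.update w (.inr i) t) = fun x =>
      S.H u (s, Function.update w (.inr i) 0) x + t * (-u * S.d i s x) + t ^ 2 * 0 := by
  ext x
  have hb : S.base (s, Function.update w (.inr i) t) x =
      S.base (s, Function.update w (.inr i) 0) x := by
    unfold base
    simp
  have hV : S.V (s, Function.update w (.inr i) t) x =
      S.V (s, Function.update w (.inr i) 0) x + S.d i s x * t := by
    unfold V
    simp only
    rw [← Finset.add_sum_erase _ _ (Finset.mem_univ i),
      ← Finset.add_sum_erase _ (fun k => S.d k s x * Function.update w (.inr i) 0 (.inr k))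
        (Finset.mem_univ i), Function.update_self, Function.update_self]
    have : ∑ k ∈ Finset.univ.erase i, S.d k s x * Function.update w (.inr i) t (.inr k) =
        ∑ k ∈ Finset.univ.erase i, S.d k s x * Function.update w (.inr i) 0 (.inr k) := by
      refine Finset.sum_congr rfl fun k hk => ?_
      have : (Sum.inr k : ι ⊕ Fin n) ≠ Sum.inr i := by
        simpa using Finset.ne_of_mem_erase hk
      rw [Function.update_of_ne this, Function.update_of_ne this]
    rw [this]
    ring
  unfold H
  rw [hb, hV]
  ring

/-- Integration by parts in a mean-field noise variable, under the joint law. -/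
lemma integral_mul_noise (u : ℝ) (i : Fin n) {g : (Fin n → ℝ) → (Fin n → ℝ) → ℝ}
    (hg : Measurable (Function.uncurry g)) {B : ℝ} (hB : ∀ s x, |g s x| ≤ B) :
    ∫ p, g p.1.1 p.2 * p.1.2 (.inr i) ∂(S.law u) =
      u * (∫ p, g p.1.1 p.2 * S.d i p.1.1 p.2 ∂(S.law u) -
        ∫ p, g p.1.1 p.2 * ∫ x, S.d i p.1.1 x ∂(S.G u p.1) ∂(S.law u)) := by
  classical
  have hgl : BddMeas fun p : ((Fin n → ℝ) × (ι ⊕ Fin n → ℝ)) × (Fin n → ℝ) => g p.1.1 p.2 :=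
    .mk' (hg.comp (f := fun p : ((Fin n → ℝ) × (ι ⊕ Fin n → ℝ)) × (Fin n → ℝ) => (p.1.1, p.2))
      (by fun_prop)) fun p => hB _ _
  have hgs : ∀ s, BddMeas (g s) := fun s => .mk' (hg.comp measurable_prodMk_left) (hB s)
  have hdavg := S.bddMeas_avg u (S.measurable_d i) (S.abs_d_le i)
  have hgavg := S.bddMeas_avg u hg hB
  have hgd : Measurable (Function.uncurry fun s x => g s x * S.d i s x) :=
    hg.mul (S.measurable_d i)
  have hgdB : ∀ s x, |g s x * S.d i s x| ≤ B * (2 * S.M) := fun s x => by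
    rw [abs_mul]
    exact mul_le_mul (hB s x) (S.abs_d_le i s x) (abs_nonneg _) ((abs_nonneg _).trans (hB s x))
  have hgdavg := S.bddMeas_avg u hgd hgdB
  have h1 : Integrable (fun p => g p.1.1 p.2 * p.1.2 (.inr i)) (S.law u) := by
    obtain ⟨hm, B, hB⟩ := hgl
    exact ((S.memLp_noise u (.inr i)).integrable (by norm_num)).bdd_mul
      hm.aestronglyMeasurable (.of_forall hB)
  have hdl : BddMeas fun p : ((Fin n → ℝ) × (ι ⊕ Fin n → ℝ)) × (Fin n → ℝ) =>
      ∫ x, S.d i p.1.1 x ∂(S.G u p.1) := by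
    obtain ⟨hm, B, hB⟩ := hdavg
    exact ⟨hm.comp measurable_fst, B, fun p => hB p.1⟩
  rw [S.integral_law h1, S.integral_law ((hgl.mul (S.bddMeas_d_law i)).integrable _),
    S.integral_law ((hgl.mul hdl).integrable _)]
  simp only [integral_mul_const]
  have h2 : Integrable (fun ω => (∫ x, g ω.1 x ∂(S.G u ω)) * ω.2 (.inr i)) S.μ := by
    have hz : MemLp (fun ω : (Fin n → ℝ) × (ι ⊕ Fin n → ℝ) => ω.2 (.inr i)) 2 S.μ :=
      (memLp_id_gaussianReal (μ := 0) (v := 1) 2).comp_measurePreserving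
        ((measurePreserving_eval (fun _ : ι ⊕ Fin n => gaussianReal 0 1) (.inr i)).comp
          measurePreserving_snd)
    obtain ⟨hm, B, hB⟩ := hgavg
    exact (hz.integrable (by norm_num)).bdd_mul hm.aestronglyMeasurable (.of_forall hB)
  rw [← integral_sub (hgdavg.integrable _) ((hgavg.mul hdavg).integrable _),
    ← integral_const_mul, integral_prod _ h2, integral_prod _
      (((hgdavg.sub (hgavg.mul hdavg)).const_mul u).integrable _)]
  refine integral_congr_ae (.of_forall fun s => ?_)
  simp only
  have hsec : ∀ {f : (Fin n → ℝ) × (ι ⊕ Fin n → ℝ) → ℝ}, BddMeas f →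
      BddMeas fun w => f (s, w) := fun hf => by
    obtain ⟨hm, B, hB⟩ := hf
    exact ⟨hm.comp measurable_prodMk_left, B, fun w => hB _⟩
  rw [← integral_coord_mul_stdNoise (.inr i) (hsec hgavg)
    (hsec ((hgdavg.sub (hgavg.mul hdavg)).const_mul u)) fun w t => ?_]
  · exact integral_congr_ae (.of_forall fun w => mul_comm _ _)
  · have hk := S.bddMeas_H u (s, Function.update w (.inr i) 0)
    have h := hasDerivAt_integral_gibbs (P := S.P) hk ((S.bddMeas_d i s).const_mul (-u))
      (BddMeas.const 0) (hgs s) t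
    simp only [← S.H_update] at h
    simp only [mul_zero, add_zero] at h
    refine h.congr_deriv ?_
    have e1 : ∫ x, -u * S.d i s x ∂(S.G u (s, Function.update w (.inr i) t)) =
        -u * ∫ x, S.d i s x ∂(S.G u (s, Function.update w (.inr i) t)) := integral_const_mul _ _
    have e2 : ∫ x, g s x * (-u * S.d i s x) ∂(S.G u (s, Function.update w (.inr i) t)) =
        -u * ∫ x, g s x * S.d i s x ∂(S.G u (s, Function.update w (.inr i) t)) := by
      rw [← integral_const_mul]
      exact integral_congr_ae (.of_forall fun x => by ring)
    unfold G at e1 e2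
    rw [e1, e2]
    simp only [G]
    ring

/-- The overlap of sample and signal. -/
def q (s x : Fin n → ℝ) : ℝ := (∑ i, S.c (x i) * S.c (s i)) / n

lemma measurable_q : Measurable (Function.uncurry S.q) := by
  unfold q Function.uncurry
  fun_prop

lemma abs_sum_c_mul_le (s x : Fin n → ℝ) : |∑ i, S.c (x i) * S.c (s i)| ≤ n * S.M ^ 2 := by
  refine (Finset.abs_sum_le_sum_abs _ _).trans ?_
  have : ∀ i ∈ Finset.univ, |S.c (x i) * S.c (s i)| ≤ S.M ^ 2 := fun i _ => by
    rw [abs_mul, sq]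
    exact mul_le_mul (S.abs_c_le _) (S.abs_c_le _) (abs_nonneg _) S.M_pos.le
  refine (Finset.sum_le_sum this).trans ?_
  simp

lemma abs_q_le (s x : Fin n → ℝ) : |S.q s x| ≤ S.M ^ 2 := by
  unfold q
  rw [abs_div, Nat.abs_cast]
  refine div_le_of_le_mul₀ (by positivity) (by positivity) ?_
  rw [mul_comm]
  exact S.abs_sum_c_mul_le s x

lemma bddMeas_q_law : BddMeas
    fun p : ((Fin n → ℝ) × (ι ⊕ Fin n → ℝ)) × (Fin n → ℝ) => S.q p.1.1 p.2 :=
  .mk' (S.measurable_q.comp (f := fun p : ((Fin n → ℝ) × (ι ⊕ Fin n → ℝ)) × (Fin n → ℝ) =>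
    (p.1.1, p.2)) (by fun_prop)) fun _ => S.abs_q_le _ _

lemma bddMeas_q_self_law : BddMeas
    fun p : ((Fin n → ℝ) × (ι ⊕ Fin n → ℝ)) × (Fin n → ℝ) => S.q p.1.1 p.1.1 :=
  .mk' (S.measurable_q.comp (f := fun p : ((Fin n → ℝ) × (ι ⊕ Fin n → ℝ)) × (Fin n → ℝ) =>
    (p.1.1, p.1.1)) (by fun_prop)) fun _ => S.abs_q_le _ _

lemma integral_comp_swap (u : ℝ) {f : ((Fin n → ℝ) × (ι ⊕ Fin n → ℝ)) × (Fin n → ℝ) → ℝ}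
    (hf : Measurable f) :
    ∫ p, f (nishimoriSwap (S.Ψ u) p) ∂(S.law u) = ∫ p, f p ∂(S.law u) := by
  have h := S.measurePreserving_swap_law u
  conv_rhs => rw [← h.map_eq]
  rw [integral_map h.measurable.aemeasurable hf.aestronglyMeasurable]

/-- The covariance of the overlap with the derivative of the Hamiltonian. Integrating by parts in
the noise brings in the posterior mean of the signal; its contribution is antisymmetric in signal
and sample, so it vanishes by the Nishimori identity. -/
lemma integral_overlap_mul_A (hn : 1 ≤ n) (u e : ℝ) :
    ∫ p, (S.q p.1.1 p.2 - e) * S.A u p.1 p.2 ∂(S.law u) =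
      u * n * ∫ p, (S.q p.1.1 p.2 - e) * (S.q p.1.1 p.1.1 - S.q p.1.1 p.2) ∂(S.law u) := by
  set f : (Fin n → ℝ) → (Fin n → ℝ) → ℝ := fun s x => S.q s x - e with hf
  have hfm : Measurable (Function.uncurry f) := S.measurable_q.sub_const e
  have hfb : ∀ s x, |f s x| ≤ S.M ^ 2 + |e| := fun s x =>
    (abs_sub _ _).trans (add_le_add (S.abs_q_le s x) le_rfl)
  have hfl : BddMeas fun p : ((Fin n → ℝ) × (ι ⊕ Fin n → ℝ)) × (Fin n → ℝ) => f p.1.1 p.2 :=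
    S.bddMeas_q_law.sub (.const e)
  have hdl := S.bddMeas_d_law
  -- the posterior mean of `c (x i)`, a function of the observation only
  set xb : Fin n → (Fin n → ℝ) × (ι ⊕ Fin n → ℝ) → ℝ :=
    fun i ω => ∫ x, S.c (x i) ∂(S.G u ω) with hxb
  have hxbl : ∀ i, BddMeas fun p : ((Fin n → ℝ) × (ι ⊕ Fin n → ℝ)) × (Fin n → ℝ) => xb i p.1 := by
    intro i
    obtain ⟨hm, B, hB⟩ := S.bddMeas_avg u (g := fun _ x => S.c (x i))
      (by unfold Function.uncurry; fun_prop) (fun _ x => S.abs_c_le (x i))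
    exact ⟨hm.comp measurable_fst, B, fun p => hB p.1⟩
  have hcl : ∀ i, BddMeas fun p : ((Fin n → ℝ) × (ι ⊕ Fin n → ℝ)) × (Fin n → ℝ) =>
      S.c (p.1.1 i) := fun i => .mk' (by fun_prop) fun p => S.abs_c_le _
  have hcx : ∀ i, BddMeas fun p : ((Fin n → ℝ) × (ι ⊕ Fin n → ℝ)) × (Fin n → ℝ) =>
      S.c (p.2 i) := fun i => .mk' (by fun_prop) fun p => S.abs_c_le _
  have hdb : ∀ i ω, ∫ x, S.d i ω.1 x ∂(S.G u ω) = xb i ω - S.c (ω.1 i) := by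
    intro i ω
    unfold d
    rw [integral_sub ((S.bddMeas_c i).integrable _) (integrable_const _)]
    simp [hxb]
  have hterm : ∀ i, ∫ p, f p.1.1 p.2 * (u * S.d i p.1.1 p.2 ^ 2 -
        S.d i p.1.1 p.2 * p.1.2 (.inr i)) ∂(S.law u) =
      u * ∫ p, f p.1.1 p.2 * (S.d i p.1.1 p.2 * (xb i p.1 - S.c (p.1.1 i))) ∂(S.law u) := by
    intro i
    have hst := S.integral_mul_noise u i (g := fun s x => f s x * S.d i s x)
      (hfm.mul (S.measurable_d i)) (B := (S.M ^ 2 + |e|) * (2 * S.M)) (fun s x => by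
        rw [abs_mul]
        exact mul_le_mul (hfb s x) (S.abs_d_le i s x) (abs_nonneg _)
          ((abs_nonneg _).trans (hfb s x)))
    simp only [hdb] at hst
    have i1 : Integrable (fun p => u * (f p.1.1 p.2 * S.d i p.1.1 p.2 * S.d i p.1.1 p.2))
      (S.law u) := (((hfl.mul (hdl i)).mul (hdl i)).const_mul u).integrable _
    have i2 : Integrable (fun p => f p.1.1 p.2 * S.d i p.1.1 p.2 * p.1.2 (.inr i)) (S.law u) := by
      obtain ⟨hm, B, hB⟩ := hfl.mul (hdl i)
      exact ((S.memLp_noise u (.inr i)).integrable (by norm_num)).bdd_mul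
        hm.aestronglyMeasurable (.of_forall hB)
    have e1 : ∀ p : ((Fin n → ℝ) × (ι ⊕ Fin n → ℝ)) × (Fin n → ℝ),
        f p.1.1 p.2 * (u * S.d i p.1.1 p.2 ^ 2 - S.d i p.1.1 p.2 * p.1.2 (.inr i)) =
        u * (f p.1.1 p.2 * S.d i p.1.1 p.2 * S.d i p.1.1 p.2) -
          f p.1.1 p.2 * S.d i p.1.1 p.2 * p.1.2 (.inr i) := fun p => by ring
    simp only [e1]
    rw [integral_sub i1 i2, integral_const_mul, hst]
    simp only [mul_assoc]
    ring
  have hint : ∀ i, Integrable (fun p => f p.1.1 p.2 * (u * S.d i p.1.1 p.2 ^ 2 -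
        S.d i p.1.1 p.2 * p.1.2 (.inr i))) (S.law u) := by
    intro i
    obtain ⟨hm, B, hB⟩ := hfl
    refine Integrable.bdd_mul ?_ hm.aestronglyMeasurable (.of_forall hB)
    refine ((((hdl i).pow 2).const_mul u).integrable _).sub ?_
    obtain ⟨hm, B, hB⟩ := hdl i
    exact ((S.memLp_noise u (.inr i)).integrable (by norm_num)).bdd_mul
        hm.aestronglyMeasurable (.of_forall hB)
  have hB : ∀ i, BddMeas fun p : ((Fin n → ℝ) × (ι ⊕ Fin n → ℝ)) × (Fin n → ℝ) =>
      f p.1.1 p.2 * (S.d i p.1.1 p.2 * (xb i p.1 - S.c (p.1.1 i))) := fun i =>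
    hfl.mul ((hdl i).mul ((hxbl i).sub (hcl i)))
  simp only [A_eq_sum, Finset.mul_sum]
  rw [integral_finsetSum _ fun i _ => hint i]
  simp only [hterm]
  rw [← Finset.mul_sum, ← integral_finsetSum _ fun i _ => (hB i).integrable _, mul_assoc u,
    ← integral_const_mul (n : ℝ)]
  congr 1
  -- the part with the posterior mean is antisymmetric under the swap of signal and sample
  set a : ((Fin n → ℝ) × (ι ⊕ Fin n → ℝ)) × (Fin n → ℝ) → ℝ :=
    fun p => f p.1.1 p.2 * ∑ i, S.d i p.1.1 p.2 * xb i p.1 with ha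
  have hab : BddMeas a := hfl.mul (.sum fun i _ => (hdl i).mul (hxbl i))
  have hanti : ∀ p, a (nishimoriSwap (S.Ψ u) p) = -a p := by
    intro p
    have h1 : ∀ i, xb i (nishimoriSwap (S.Ψ u) p).1 = xb i p.1 := fun i => by
      simp only [hxb, G_swap]
    have h2 : f p.2 p.1.1 = f p.1.1 p.2 := by
      simp only [hf, q]
      congr 2
      exact Finset.sum_congr rfl fun i _ => mul_comm _ _
    simp only [ha, h1]
    simp only [nishimoriSwap, h2, d]
    rw [← mul_neg, ← Finset.sum_neg_distrib]
    congr 1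
    exact Finset.sum_congr rfl fun i _ => by ring
  have hzero : ∫ p, a p ∂(S.law u) = 0 := by
    have := S.integral_comp_swap u hab.1
    simp only [hanti, integral_neg] at this
    linarith
  have hn0 : (n : ℝ) ≠ 0 := by positivity
  have hsplit : ∀ p : ((Fin n → ℝ) × (ι ⊕ Fin n → ℝ)) × (Fin n → ℝ),
      ∑ i, f p.1.1 p.2 * (S.d i p.1.1 p.2 * (xb i p.1 - S.c (p.1.1 i))) =
      a p + n * (f p.1.1 p.2 * (S.q p.1.1 p.1.1 - S.q p.1.1 p.2)) := by
    intro p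
    have h1 : (n : ℝ) * (S.q p.1.1 p.1.1 - S.q p.1.1 p.2) =
        -∑ i, S.d i p.1.1 p.2 * S.c (p.1.1 i) := by
      unfold q d
      rw [mul_sub, mul_div_cancel₀ _ hn0, mul_div_cancel₀ _ hn0, ← Finset.sum_sub_distrib,
        ← Finset.sum_neg_distrib]
      exact Finset.sum_congr rfl fun i _ => by ring
    rw [mul_left_comm, h1, ← Finset.mul_sum, ha]
    simp only [mul_sub, Finset.sum_sub_distrib]
    ring
  simp only [hsplit]
  rw [integral_add (hab.integrable _)
    (((hfl.mul (S.bddMeas_q_self_law.sub S.bddMeas_q_law)).const_mul _).integrable _), hzero,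
    zero_add]

/-- The squared norm of the signal concentrates. -/
lemma variance_q_self_le (u : ℝ) (hn : 1 ≤ n) :
    Var[fun p => S.q p.1.1 p.1.1; S.law u] ≤ S.M ^ 4 / n := by
  have hn0 : (0 : ℝ) < n := by positivity
  have h1 : MeasurePreserving
      (fun p : ((Fin n → ℝ) × (ι ⊕ Fin n → ℝ)) × (Fin n → ℝ) => p.1.1) (S.law u) S.P :=
    measurePreserving_fst.comp (S.measurePreserving_fst_law u)
  have hqm : Measurable fun s => S.q s s :=
    S.measurable_q.comp (f := fun s : Fin n → ℝ => (s, s)) (by fun_prop)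
  have h2 := h1.variance_fun_comp (f := fun s => S.q s s) hqm.aemeasurable
  rw [h2]
  refine (variance_pi_le (h := fun _ => 0) (memLp_const 0) hqm (C := S.M ^ 2)
    (c := fun _ => S.M ^ 4 / n ^ 2) (fun s => by simpa using S.abs_q_le s s) ?_).trans ?_
  · intro i s
    have hb : ∀ t, S.q (Function.update s i t) (Function.update s i t) ∈
        Icc ((∑ k ∈ Finset.univ.erase i, S.c (s k) * S.c (s k)) / n)
          ((∑ k ∈ Finset.univ.erase i, S.c (s k) * S.c (s k)) / n + S.M ^ 2 / n) := by
      intro t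
      have e : S.q (Function.update s i t) (Function.update s i t) =
          (∑ k ∈ Finset.univ.erase i, S.c (s k) * S.c (s k)) / n + S.c t ^ 2 / n := by
        unfold q
        rw [← Finset.add_sum_erase _ _ (Finset.mem_univ i), Function.update_self, add_comm,
          add_div]
        congr 2
        · refine Finset.sum_congr rfl fun k hk => ?_
          rw [Function.update_of_ne (Finset.ne_of_mem_erase hk)]
        · ring
      have hc : S.c t ^ 2 ≤ S.M ^ 2 := sq_le_sq' (abs_le.1 (S.abs_c_le t)).1
        (abs_le.1 (S.abs_c_le t)).2
      rw [e]
      constructor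
      · have : 0 ≤ S.c t ^ 2 / n := by positivity
        linarith
      · gcongr
    refine (variance_le_sq_of_bounded (.of_forall hb)
      (hqm.comp (measurable_update s)).aemeasurable).trans ?_
    rw [add_sub_cancel_left]
    have : (S.M ^ 2 / n / 2) ^ 2 = S.M ^ 4 / n ^ 2 / 4 := by ring
    rw [this]
    have : 0 ≤ S.M ^ 4 / (n : ℝ) ^ 2 := by positivity
    linarith
  · simp only [Finset.sum_const, Finset.card_univ, Fintype.card_fin, nsmul_eq_mul]
    apply le_of_eq
    field_simp

/-- Fluctuations of the overlap are controlled by those of the derivative of the Hamiltonian. -/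
lemma variance_overlap_le (hn : 1 ≤ n) {u : ℝ} (hu : 0 < u) :
    Var[fun p => S.q p.1.1 p.2; S.law u] ≤
      2 * Var[fun p => S.A u p.1 p.2; S.law u] / (u ^ 2 * n ^ 2) + 2 * S.M ^ 4 / n := by
  have hn0 : (0 : ℝ) < n := by positivity
  set Q : ((Fin n → ℝ) × (ι ⊕ Fin n → ℝ)) × (Fin n → ℝ) → ℝ := fun p => S.q p.1.1 p.2 with hQ
  set R : ((Fin n → ℝ) × (ι ⊕ Fin n → ℝ)) × (Fin n → ℝ) → ℝ := fun p => S.q p.1.1 p.1.1 with hR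
  set A : ((Fin n → ℝ) × (ι ⊕ Fin n → ℝ)) × (Fin n → ℝ) → ℝ := fun p => S.A u p.1 p.2 with hA
  set e := ∫ p, Q p ∂(S.law u) with he
  set r := ∫ p, R p ∂(S.law u) with hr
  set b := ∫ p, A p ∂(S.law u) with hb
  have hQb : BddMeas Q := S.bddMeas_q_law
  have hRb : BddMeas R := S.bddMeas_q_self_law
  have hAL : MemLp A 2 (S.law u) := S.memLp_A u
  have hkey := S.integral_overlap_mul_A hn u e
  have hf2 : MemLp (fun p => Q p - e) 2 (S.law u) := (hQb.sub (.const e)).memLp 2 _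
  have hR2 : MemLp (fun p => R p - r) 2 (S.law u) := (hRb.sub (.const r)).memLp 2 _
  have hA2 : MemLp (fun p => A p - b) 2 (S.law u) := hAL.sub (memLp_const b)
  have hf0 : ∫ p, (Q p - e) ∂(S.law u) = 0 := by
    rw [integral_sub (hQb.integrable _) (integrable_const _)]
    simp [he]
  have vQ : Var[Q; S.law u] = ∫ p, (Q p - e) ^ 2 ∂(S.law u) :=
    variance_eq_integral hQb.1.aemeasurable
  have vR : Var[R; S.law u] = ∫ p, (R p - r) ^ 2 ∂(S.law u) :=
    variance_eq_integral hRb.1.aemeasurable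
  have vA : Var[A; S.law u] = ∫ p, (A p - b) ^ 2 ∂(S.law u) :=
    variance_eq_integral hAL.1.aemeasurable
  have i0 : Integrable (fun p => Q p - e) (S.law u) := hf2.integrable (by norm_num)
  have i1 : Integrable (fun p => (Q p - e) * (A p - b)) (S.law u) := hf2.integrable_mul hA2
  have i2 : Integrable (fun p => (Q p - e) * (R p - r)) (S.law u) := hf2.integrable_mul hR2
  have k1 : ∫ p, (Q p - e) * A p ∂(S.law u) = ∫ p, (Q p - e) * (A p - b) ∂(S.law u) := by
    have : ∀ p, (Q p - e) * A p = (Q p - e) * (A p - b) + b * (Q p - e) := fun p => by ring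
    simp only [this]
    rw [integral_add i1 (i0.const_mul b), integral_const_mul, hf0]
    ring
  have k2 : ∫ p, (Q p - e) * (R p - Q p) ∂(S.law u) =
      ∫ p, (Q p - e) * (R p - r) ∂(S.law u) - ∫ p, (Q p - e) ^ 2 ∂(S.law u) := by
    have : ∀ p, (Q p - e) * (R p - Q p) =
        (Q p - e) * (R p - r) + (r - e) * (Q p - e) - (Q p - e) ^ 2 := fun p => by ring
    simp only [this]
    rw [integral_sub (i2.fun_add (i0.const_mul _)) hf2.integrable_sq,
      integral_add i2 (i0.const_mul _), integral_const_mul, hf0]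
    ring
  have hkey' : ∫ p, (Q p - e) * (A p - b) ∂(S.law u) =
      u * n * (∫ p, (Q p - e) * (R p - r) ∂(S.law u) - ∫ p, (Q p - e) ^ 2 ∂(S.law u)) := by
    rw [← k1, ← k2]
    exact hkey
  have hun : 0 < u * n := by positivity
  -- expand `0 ≤ ((Q - e) - (R - r) + (A - b) / (u n)) ^ 2`
  have hpos : 0 ≤ ∫ p, ((Q p - e) ^ 2 + 2 * (R p - r) ^ 2 + 2 / (u * n) ^ 2 * (A p - b) ^ 2
      - 2 * ((Q p - e) * (R p - r)) + 2 / (u * n) * ((Q p - e) * (A p - b))) ∂(S.law u) := by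
    refine integral_nonneg fun p => ?_
    simp only [Pi.zero_apply]
    have : 0 ≤ ((Q p - e) - (R p - r) + (A p - b) / (u * n)) ^ 2 +
      ((R p - r) + (A p - b) / (u * n)) ^ 2 := by positivity
    refine this.trans_eq ?_
    field_simp
    ring
  have j1 := hf2.integrable_sq
  have j2 := hR2.integrable_sq.const_mul 2
  have j3 := hA2.integrable_sq.const_mul (2 / (u * n) ^ 2)
  have hsub : ∀ p, (Q p - e) ^ 2 + 2 * (R p - r) ^ 2 + 2 / (u * n) ^ 2 * (A p - b) ^ 2
      - 2 * ((Q p - e) * (R p - r)) + 2 / (u * n) * ((Q p - e) * (A p - b)) =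
      (Q p - e) ^ 2 + 2 * (R p - r) ^ 2 + 2 / (u * n) ^ 2 * (A p - b) ^ 2
      + -2 * ((Q p - e) * (R p - r)) + 2 / (u * n) * ((Q p - e) * (A p - b)) := fun p => by ring
  simp only [hsub] at hpos
  rw [integral_add (((j1.fun_add j2).fun_add j3).fun_add (i2.const_mul _)) (i1.const_mul _),
    integral_add ((j1.fun_add j2).fun_add j3) (i2.const_mul _), integral_add (j1.fun_add j2) j3,
    integral_add j1 j2, integral_const_mul, integral_const_mul, integral_const_mul,
    integral_const_mul, hkey', ← vQ, ← vR, ← vA] at hpos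
  have e3 : 2 / (u * n) * (u * n * (∫ p, (Q p - e) * (R p - r) ∂(S.law u) - Var[Q; S.law u])) =
      2 * (∫ p, (Q p - e) * (R p - r) ∂(S.law u) - Var[Q; S.law u]) := by
    field_simp
  rw [e3] at hpos
  have hvr : Var[R; S.law u] ≤ S.M ^ 4 / n := S.variance_q_self_le u hn
  have e4 : 2 * Var[A; S.law u] / (u ^ 2 * n ^ 2) = 2 / (u * n) ^ 2 * Var[A; S.law u] := by
    ring
  have e5 : 2 * S.M ^ 4 / n = 2 * (S.M ^ 4 / n) := by ring
  rw [e4, e5]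
  linarith

end Model

/-! ### The free energy and its derivatives -/

lemma variance_le_integral_sub_sq {X : Type*} [MeasurableSpace X] {μ : Measure X}
    [IsProbabilityMeasure μ] {f : X → ℝ} (hf : Measurable f) {h : X → ℝ} (hh : MemLp h 2 μ) (a : ℝ)
    (hfh : ∀ x, |f x - a| ≤ h x) : Var[f; μ] ≤ ∫ x, h x ^ 2 ∂μ := by
  have e : Var[f; μ] = Var[fun x => f x - a; μ] := by
    rw [variance_sub_const hf.aestronglyMeasurable]
  rw [e]
  refine (variance_le_expectation_sq (hf.sub_const a).aestronglyMeasurable).trans ?_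
  refine integral_mono_of_nonneg (.of_forall fun x => sq_nonneg _) hh.integrable_sq
    (.of_forall fun x => ?_)
  have := hfh x
  simp only [Pi.pow_apply]
  rw [← sq_abs]
  gcongr

lemma integral_sq_gaussianReal : ∫ t, t ^ 2 ∂(gaussianReal 0 1) = 1 := by
  have h := variance_fun_id_gaussianReal (μ := 0) (v := 1)
  rw [variance_eq_integral (by fun_prop), integral_id_gaussianReal] at h
  simpa using h

namespace Model

variable {n : ℕ} {ι : Type} [Fintype ι] (S : Model n ι)

lemma continuous_integral_G (ω : (Fin n → ℝ) × (ι ⊕ Fin n → ℝ)) {g : (Fin n → ℝ) → ℝ}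
    (hg : BddMeas g) : Continuous fun u => ∫ x, g x ∂(S.G u ω) :=
  continuous_iff_continuousAt.2 fun u =>
    (hasDerivAt_integral_gibbs (S.bddMeas_base ω) (S.bddMeas_V ω).neg (S.bddMeas_half_W ω.1) hg
      u).continuousAt

/-- The log-partition function. -/
def F (u : ℝ) (ω : (Fin n → ℝ) × (ι ⊕ Fin n → ℝ)) : ℝ := logZ S.P (S.H u ω)

/-- Gibbs average of the derivative of the Hamiltonian. -/
def meanA (u : ℝ) (ω : (Fin n → ℝ) × (ι ⊕ Fin n → ℝ)) : ℝ := ∫ x, S.A u ω x ∂(S.G u ω)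

/-- Gibbs variance of the derivative of the Hamiltonian. -/
def varA (u : ℝ) (ω : (Fin n → ℝ) × (ι ⊕ Fin n → ℝ)) : ℝ :=
  ∫ x, S.A u ω x ^ 2 ∂(S.G u ω) - S.meanA u ω ^ 2

lemma varA_nonneg (u : ℝ) (ω) : 0 ≤ S.varA u ω := by
  have := variance_nonneg (S.A u ω) (S.G u ω)
  rwa [variance_eq_integral_sq_sub ((S.bddMeas_A u ω).memLp 2 _)] at this

lemma measurable_F : Measurable fun q : ℝ × (Fin n → ℝ) × (ι ⊕ Fin n → ℝ) => S.F q.1 q.2 :=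
  measurable_logZ (H := fun q : ℝ × (Fin n → ℝ) × (ι ⊕ Fin n → ℝ) => S.H q.1 q.2) S.measurable_H

lemma measurable_meanA :
    Measurable fun q : ℝ × (Fin n → ℝ) × (ι ⊕ Fin n → ℝ) => S.meanA q.1 q.2 :=
  measurable_integral_gibbs (H := fun q : ℝ × (Fin n → ℝ) × (ι ⊕ Fin n → ℝ) => S.H q.1 q.2)
    (g := fun q => S.A q.1 q.2) S.measurable_H S.measurable_A

lemma measurable_integral_A_sq : Measurable
    fun q : ℝ × (Fin n → ℝ) × (ι ⊕ Fin n → ℝ) => ∫ x, S.A q.1 q.2 x ^ 2 ∂(S.G q.1 q.2) :=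
  measurable_integral_gibbs (H := fun q : ℝ × (Fin n → ℝ) × (ι ⊕ Fin n → ℝ) => S.H q.1 q.2)
    (g := fun q x => S.A q.1 q.2 x ^ 2) S.measurable_H (S.measurable_A.pow_const 2)

lemma measurable_varA :
    Measurable fun q : ℝ × (Fin n → ℝ) × (ι ⊕ Fin n → ℝ) => S.varA q.1 q.2 :=
  S.measurable_integral_A_sq.sub (S.measurable_meanA.pow_const 2)

lemma hasDerivAt_F (u : ℝ) (ω) : HasDerivAt (fun u => S.F u ω) (-S.meanA u ω) u :=
  hasDerivAt_logZ (S.bddMeas_base ω) (S.bddMeas_V ω).neg (S.bddMeas_half_W ω.1) u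

lemma meanA_eq (u : ℝ) (ω) :
    S.meanA u ω = -∫ x, S.V ω x ∂(S.G u ω) + u * ∫ x, S.W ω.1 x ∂(S.G u ω) := by
  unfold meanA A
  rw [← integral_neg, ← integral_const_mul, ← integral_add ((S.bddMeas_V ω).neg.integrable _)
    (((S.bddMeas_W ω.1).const_mul u).integrable _)]
  exact integral_congr_ae (.of_forall fun x => by ring)

lemma integral_A_sq_eq (u : ℝ) (ω) :
    ∫ x, S.A u ω x ^ 2 ∂(S.G u ω) = ∫ x, S.V ω x ^ 2 ∂(S.G u ω) +
      (-2 * u * ∫ x, S.V ω x * S.W ω.1 x ∂(S.G u ω) + u ^ 2 * ∫ x, S.W ω.1 x ^ 2 ∂(S.G u ω)) := by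
  have h1 := (S.bddMeas_V ω).pow 2
  have h2 := ((S.bddMeas_V ω).mul (S.bddMeas_W ω.1)).const_mul (-2 * u)
  have h3 := ((S.bddMeas_W ω.1).pow 2).const_mul (u ^ 2)
  rw [← integral_const_mul, ← integral_const_mul, ← integral_add (h2.integrable _)
    (h3.integrable _), ← integral_add (h1.integrable _) ((h2.add h3).integrable _)]
  refine integral_congr_ae (.of_forall fun x => ?_)
  simp only [A]
  ring

lemma hasDerivAt_meanA (u : ℝ) (ω) :
    HasDerivAt (fun u => S.meanA u ω) (∫ x, S.W ω.1 x ∂(S.G u ω) - S.varA u ω) u := by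
  have hV := S.bddMeas_V ω
  have hW := S.bddMeas_W ω.1
  have dV := hasDerivAt_integral_gibbs (P := S.P) (S.bddMeas_base ω) hV.neg
    (S.bddMeas_half_W ω.1) hV u
  have dW := hasDerivAt_integral_gibbs (P := S.P) (S.bddMeas_base ω) hV.neg
    (S.bddMeas_half_W ω.1) hW u
  have h := dV.fun_neg.fun_add ((hasDerivAt_id u).fun_mul dW)
  simp only [meanA_eq]
  refine h.congr_deriv ?_
  have e1 : ∫ x, S.V ω x * S.A u ω x ∂(S.G u ω) =
      -∫ x, S.V ω x ^ 2 ∂(S.G u ω) + u * ∫ x, S.V ω x * S.W ω.1 x ∂(S.G u ω) := by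
    rw [← integral_neg, ← integral_const_mul, ← integral_add ((hV.pow 2).neg.integrable _)
      (((hV.mul hW).const_mul u).integrable _)]
    refine integral_congr_ae (.of_forall fun x => ?_)
    simp only [A]
    ring
  have e2 : ∫ x, S.W ω.1 x * S.A u ω x ∂(S.G u ω) =
      -∫ x, S.V ω x * S.W ω.1 x ∂(S.G u ω) + u * ∫ x, S.W ω.1 x ^ 2 ∂(S.G u ω) := by
    rw [← integral_neg, ← integral_const_mul, ← integral_add ((hV.mul hW).neg.integrable _)
      (((hW.pow 2).const_mul u).integrable _)]
    refine integral_congr_ae (.of_forall fun x => ?_)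
    simp only [A]
    ring
  have e3 := S.integral_A_sq_eq u ω
  have e4 := S.meanA_eq u ω
  unfold varA
  rw [e3]
  change -((∫ x, S.V ω x ∂(S.G u ω)) * S.meanA u ω - ∫ x, S.V ω x * S.A u ω x ∂(S.G u ω)) +
    (1 * (∫ x, S.W ω.1 x ∂(S.G u ω)) + u * ((∫ x, S.W ω.1 x ∂(S.G u ω)) * S.meanA u ω -
      ∫ x, S.W ω.1 x * S.A u ω x ∂(S.G u ω))) = _
  rw [e1, e2]
  have e5 : S.meanA u ω ^ 2 = S.meanA u ω *
    (-∫ x, S.V ω x ∂(S.G u ω) + u * ∫ x, S.W ω.1 x ∂(S.G u ω)) := by rw [← e4, sq]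
  rw [e5]
  ring

lemma continuous_varA (ω) : Continuous fun u => S.varA u ω := by
  have hV := S.bddMeas_V ω
  have hW := S.bddMeas_W ω.1
  have h1 := S.continuous_integral_G ω hV
  have h2 := S.continuous_integral_G ω hW
  have h3 := S.continuous_integral_G ω (hV.pow 2)
  have h4 := S.continuous_integral_G ω (hW.pow 2)
  have h5 := S.continuous_integral_G ω (hV.mul hW)
  unfold varA
  simp only [integral_A_sq_eq, meanA_eq]
  fun_prop

lemma W_nonneg (s x : Fin n → ℝ) : 0 ≤ S.W s x := Finset.sum_nonneg fun _ _ => sq_nonneg _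

lemma d_sq_le (i : Fin n) (s x : Fin n → ℝ) : S.d i s x ^ 2 ≤ 4 * S.M ^ 2 := by
  have := sq_le_sq' (abs_le.1 (S.abs_d_le i s x)).1 (abs_le.1 (S.abs_d_le i s x)).2
  linarith

lemma W_le (s x : Fin n → ℝ) : S.W s x ≤ 4 * S.M ^ 2 * n := by
  unfold W
  refine (Finset.sum_le_sum fun i _ => S.d_sq_le i s x).trans ?_
  simp [mul_comm]

lemma integral_W_le (u : ℝ) (ω : (Fin n → ℝ) × (ι ⊕ Fin n → ℝ)) :
    ∫ x, S.W ω.1 x ∂(S.G u ω) ≤ 4 * S.M ^ 2 * n := by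
  refine (le_abs_self _).trans (abs_integral_gibbs_le (S.bddMeas_H u ω) fun x => ?_)
  rw [abs_of_nonneg (S.W_nonneg _ _)]
  exact S.W_le _ _

/-- Up to an explicit linear term, the derivative of the log-partition function increases. -/
lemma monotone_slope (ω : (Fin n → ℝ) × (ι ⊕ Fin n → ℝ)) :
    Monotone fun u => -S.meanA u ω + 4 * S.M ^ 2 * n * u := by
  have hd : ∀ u, HasDerivAt (fun u => -S.meanA u ω + 4 * S.M ^ 2 * n * u)
      (-(∫ x, S.W ω.1 x ∂(S.G u ω) - S.varA u ω) + 4 * S.M ^ 2 * n * 1) u := fun u =>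
    (S.hasDerivAt_meanA u ω).fun_neg.fun_add ((hasDerivAt_id u).const_mul _)
  refine monotone_of_deriv_nonneg (fun u => (hd u).differentiableAt) fun u => ?_
  rw [(hd u).deriv]
  linarith [S.integral_W_le u ω, S.varA_nonneg u ω]

/-- Upper bound on the derivative of the Hamiltonian, in terms of the noise. -/
def boundA (u : ℝ) (ω : (Fin n → ℝ) × (ι ⊕ Fin n → ℝ)) : ℝ :=
  |u| * (4 * S.M ^ 2 * n) + 2 * S.M * ∑ i, |ω.2 (.inr i)|

lemma abs_A_le (u : ℝ) (ω x) : |S.A u ω x| ≤ S.boundA u ω := by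
  unfold A boundA
  have h1 : |2 * u * (S.W ω.1 x / 2)| ≤ |u| * (4 * S.M ^ 2 * n) := by
    rw [show 2 * u * (S.W ω.1 x / 2) = u * S.W ω.1 x by ring, abs_mul,
      abs_of_nonneg (S.W_nonneg _ _)]
    exact mul_le_mul_of_nonneg_left (S.W_le _ _) (abs_nonneg _)
  have h2 : |S.V ω x| ≤ 2 * S.M * ∑ i, |ω.2 (.inr i)| := by
    unfold V
    rw [Finset.mul_sum]
    refine (Finset.abs_sum_le_sum_abs _ _).trans (Finset.sum_le_sum fun i _ => ?_)
    rw [abs_mul]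
    exact mul_le_mul_of_nonneg_right (S.abs_d_le _ _ _) (abs_nonneg _)
  refine (abs_add_le _ _).trans ?_
  rw [abs_neg]
  linarith

lemma memLp_coord (j : ι ⊕ Fin n) :
    MemLp (fun ω : (Fin n → ℝ) × (ι ⊕ Fin n → ℝ) => ω.2 j) 2 S.μ :=
  (memLp_id_gaussianReal (μ := 0) (v := 1) 2).comp_measurePreserving
    ((measurePreserving_eval (fun _ : ι ⊕ Fin n => gaussianReal 0 1) j).comp
      measurePreserving_snd)

lemma memLp_boundA (u : ℝ) : MemLp (S.boundA u) 2 S.μ := by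
  have h1 : MemLp (fun ω : (Fin n → ℝ) × (ι ⊕ Fin n → ℝ) => ∑ i : Fin n, |ω.2 (.inr i)|) 2 S.μ :=
    memLp_finsetSum _ fun i _ => (S.memLp_coord (.inr i)).norm
  have h2 : MemLp (fun _ : (Fin n → ℝ) × (ι ⊕ Fin n → ℝ) => |u| * (4 * S.M ^ 2 * n)) 2 S.μ :=
    memLp_const _
  exact h2.add (h1.const_mul (2 * S.M))

lemma measurable_meanA_right (u : ℝ) : Measurable (S.meanA u) :=
  S.measurable_meanA.comp (f := fun ω => (u, ω)) (by fun_prop)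

lemma measurable_F_right (u : ℝ) : Measurable (S.F u) :=
  S.measurable_F.comp (f := fun ω => (u, ω)) (by fun_prop)

lemma abs_meanA_le (u : ℝ) (ω) : |S.meanA u ω| ≤ S.boundA u ω :=
  abs_integral_gibbs_le (S.bddMeas_H u ω) (S.abs_A_le u ω)

lemma memLp_meanA (u : ℝ) : MemLp (S.meanA u) 2 S.μ :=
  (S.memLp_boundA u).mono (S.measurable_meanA_right u).aestronglyMeasurable
    (.of_forall fun ω => (S.abs_meanA_le u ω).trans (le_abs_self _))

lemma integrable_integral_A_sq (u : ℝ) :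
    Integrable (fun ω => ∫ x, S.A u ω x ^ 2 ∂(S.G u ω)) S.μ := by
  refine (S.memLp_boundA u).integrable_sq.mono'
    (S.measurable_integral_A_sq.comp (f := fun ω => (u, ω)) (by fun_prop)).aestronglyMeasurable
    (.of_forall fun ω => abs_integral_gibbs_le (S.bddMeas_H u ω) fun x => ?_)
  rw [abs_of_nonneg (sq_nonneg _)]
  exact sq_le_sq' (abs_le.1 (S.abs_A_le u ω x)).1 (abs_le.1 (S.abs_A_le u ω x)).2

lemma integrable_varA (u : ℝ) : Integrable (S.varA u) S.μ :=
  (S.integrable_integral_A_sq u).sub (S.memLp_meanA u).integrable_sq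

/-- Law of total variance: thermal and disorder fluctuations. -/
lemma variance_A_eq (u : ℝ) :
    Var[fun p => S.A u p.1 p.2; S.law u] = ∫ ω, S.varA u ω ∂S.μ + Var[S.meanA u; S.μ] := by
  rw [variance_eq_integral_sq_sub (S.memLp_A u), variance_eq_integral_sq_sub (S.memLp_meanA u),
    S.integral_law (S.memLp_A u).integrable_sq,
    S.integral_law ((S.memLp_A u).integrable (by norm_num))]
  have : ∫ ω, S.varA u ω ∂S.μ = ∫ ω, ∫ x, S.A u ω x ^ 2 ∂(S.G u ω) ∂S.μ -
      ∫ ω, S.meanA u ω ^ 2 ∂S.μ :=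
    integral_sub (S.integrable_integral_A_sq u) (S.memLp_meanA u).integrable_sq
  rw [this]
  simp only [meanA]
  ring

lemma variance_A_le {u : ℝ} (hu : 0 < u) :
    Var[fun p => S.A u p.1 p.2; S.law u] ≤ n ^ 2 * κ / u ^ 2 := by
  refine (variance_le_expectation_sq (S.memLp_A u).1).trans ?_
  exact S.integral_A_sq_le hu

lemma integral_abs_meanA_le (hn : 1 ≤ n) {u : ℝ} (hu : 0 < u) :
    ∫ ω, |S.meanA u ω| ∂S.μ ≤ n * κ / u := by
  have hn0 : (0 : ℝ) < n := by positivity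
  have h1 : ∫ ω, S.meanA u ω ^ 2 ∂S.μ ≤ n ^ 2 * κ / u ^ 2 := by
    refine le_trans ?_ (S.integral_A_sq_le hu)
    rw [S.integral_law (S.memLp_A u).integrable_sq]
    refine integral_mono (S.memLp_meanA u).integrable_sq (S.integrable_integral_A_sq u) fun ω => ?_
    have := S.varA_nonneg u ω
    unfold varA at this
    simp only
    linarith
  have h2 : ∫ ω, |S.meanA u ω| ∂S.μ ≤
      ∫ ω, (u / (2 * n) * S.meanA u ω ^ 2 + n / (2 * u)) ∂S.μ := by
    refine integral_mono ((S.memLp_meanA u).integrable (by norm_num)).abs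
      (((S.memLp_meanA u).integrable_sq.const_mul _).fun_add (integrable_const _)) fun ω => ?_
    simp only
    have := sq_nonneg (|S.meanA u ω| * u - n)
    rw [← sq_abs]
    have e : u / (2 * n) * |S.meanA u ω| ^ 2 + n / (2 * u) =
        ((|S.meanA u ω| * u) ^ 2 + n ^ 2) / (2 * n * u) := by field_simp
    rw [e, le_div_iff₀ (by positivity)]
    linarith
  refine h2.trans ?_
  rw [integral_add ((S.memLp_meanA u).integrable_sq.const_mul _) (integrable_const _),
    integral_const_mul]
  simp only [integral_const, probReal_univ, one_smul]
  have h3 : u / (2 * n) * ∫ ω, S.meanA u ω ^ 2 ∂S.μ ≤ u / (2 * n) * (n ^ 2 * κ / u ^ 2) := by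
    gcongr
  refine (add_le_add_left h3 _).trans ?_
  have h4 : (1 : ℝ) ≤ κ := by have := gaussFourth_nonneg; unfold κ; linarith
  have e : u / (2 * n) * (n ^ 2 * κ / u ^ 2) + n / (2 * u) = n * (κ + 1) / 2 / u := by
    field_simp
  rw [e]
  gcongr
  nlinarith

/-! ### Fluctuations of the free energy -/

/-- Lipschitz constants of the Hamiltonian in the noise variables. -/
def lip (u : ℝ) : ι ⊕ Fin n → ℝ := Sum.elim S.β fun _ => 2 * S.M * |u|

lemma β_nonneg (a : ι) : 0 ≤ S.β a := (abs_nonneg _).trans (S.abs_Φ_le 0 a)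

lemma lip_nonneg (u : ℝ) : ∀ j, 0 ≤ S.lip u j
  | .inl a => S.β_nonneg a
  | .inr _ => by have := S.M_pos; simp only [lip, Sum.elim_inr]; positivity

lemma H_sub_noise (u : ℝ) (s : Fin n → ℝ) (w w' : ι ⊕ Fin n → ℝ) (x : Fin n → ℝ) :
    S.H u (s, w) x - S.H u (s, w') x =
      -∑ j, (Sum.elim (S.Φ x) fun i => u * S.d i s x) j * (w j - w' j) := by
  unfold H base V
  simp only [Fintype.sum_sum_type, Sum.elim_inl, Sum.elim_inr, mul_add, mul_sub,
    Finset.sum_add_distrib, Finset.sum_sub_distrib, mul_assoc, ← Finset.mul_sum]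
  ring

lemma abs_H_sub_noise_le (u : ℝ) (s : Fin n → ℝ) (w w' : ι ⊕ Fin n → ℝ) (x : Fin n → ℝ) :
    |S.H u (s, w) x - S.H u (s, w') x| ≤ ∑ j, S.lip u j * |w j - w' j| := by
  rw [H_sub_noise, abs_neg]
  refine (Finset.abs_sum_le_sum_abs _ _).trans (Finset.sum_le_sum fun j _ => ?_)
  rw [abs_mul]
  refine mul_le_mul_of_nonneg_right ?_ (abs_nonneg _)
  rcases j with a | i
  · exact S.abs_Φ_le x a
  · simp only [lip, Sum.elim_inr]
    rw [abs_mul, mul_comm]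
    exact mul_le_mul_of_nonneg_right (S.abs_d_le _ _ _) (abs_nonneg _)

lemma abs_H_zero_noise_le (u : ℝ) (s x : Fin n → ℝ) :
    |S.H u (s, 0) x| ≤ 3 / 2 * ∑ a, S.β a ^ 2 + u ^ 2 * (2 * S.M ^ 2 * n) := by
  have e : S.H u (s, 0) x = (∑ a, S.Φ x a ^ 2) / 2 + -(∑ a, S.Φ x a * S.Φ s a) +
      u ^ 2 * (S.W s x / 2) := by
    unfold H base V
    simp
    ring
  have h1 : |(∑ a, S.Φ x a ^ 2) / 2| ≤ 1 / 2 * ∑ a, S.β a ^ 2 := by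
    rw [abs_of_nonneg (by positivity), one_div, inv_mul_eq_div]
    refine div_le_div_of_nonneg_right (Finset.sum_le_sum fun a _ => ?_) two_pos.le
    exact sq_le_sq' (abs_le.1 (S.abs_Φ_le x a)).1 (abs_le.1 (S.abs_Φ_le x a)).2
  have h2 : |-(∑ a, S.Φ x a * S.Φ s a)| ≤ ∑ a, S.β a ^ 2 := by
    rw [abs_neg]
    refine (Finset.abs_sum_le_sum_abs _ _).trans (Finset.sum_le_sum fun a _ => ?_)
    rw [abs_mul, sq]
    exact mul_le_mul (S.abs_Φ_le _ _) (S.abs_Φ_le _ _) (abs_nonneg _) (S.β_nonneg a)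
  have h3 : |u ^ 2 * (S.W s x / 2)| ≤ u ^ 2 * (2 * S.M ^ 2 * n) := by
    have := S.W_nonneg s x
    rw [abs_of_nonneg (by positivity)]
    gcongr
    linarith [S.W_le s x]
  rw [e]
  refine (abs_add_le _ _).trans ?_
  have := abs_add_le ((∑ a, S.Φ x a ^ 2) / 2) (-(∑ a, S.Φ x a * S.Φ s a))
  linarith

lemma exists_abs_F_le (u : ℝ) : ∃ C L, 0 ≤ L ∧ ∀ s w, |S.F u (s, w)| ≤ C + ∑ j, L * |w j| := by
  refine ⟨3 / 2 * ∑ a, S.β a ^ 2 + u ^ 2 * (2 * S.M ^ 2 * n), ∑ j, S.lip u j,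
    Finset.sum_nonneg fun j _ => S.lip_nonneg u j, fun s w => ?_⟩
  refine abs_logZ_le (S.bddMeas_H u (s, w)) fun x => ?_
  have h1 := S.abs_H_sub_noise_le u s w 0 x
  have h2 := S.abs_H_zero_noise_le u s x
  have h3 : ∑ j, S.lip u j * |w j - (0 : ι ⊕ Fin n → ℝ) j| ≤ ∑ j, (∑ j, S.lip u j) * |w j| := by
    refine Finset.sum_le_sum fun j _ => ?_
    simp only [Pi.zero_apply, sub_zero]
    refine mul_le_mul_of_nonneg_right ?_ (abs_nonneg _)
    exact Finset.single_le_sum (fun j _ => S.lip_nonneg u j) (Finset.mem_univ j)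
  have := abs_add_le (S.H u (s, w) x - S.H u (s, 0) x) (S.H u (s, 0) x)
  rw [sub_add_cancel] at this
  linarith

lemma memLp_F (u : ℝ) : MemLp (S.F u) 2 S.μ := by
  obtain ⟨C, L, -, hF⟩ := S.exists_abs_F_le u
  refine MemLp.mono (g := fun ω => C + ∑ j, L * |ω.2 j|) ?_
    (S.measurable_F_right u).aestronglyMeasurable
    (.of_forall fun ω => (hF ω.1 ω.2).trans (le_abs_self _))
  exact (memLp_const C).add (memLp_finsetSum _ fun j _ => (S.memLp_coord j).norm.const_mul L)

lemma variance_F_noise_le (u : ℝ) (s : Fin n → ℝ) :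
    Var[fun w => S.F u (s, w); stdNoise (ι ⊕ Fin n)] ≤ n * (S.D + 4 * S.M ^ 2 * u ^ 2) := by
  classical
  obtain ⟨C, L, -, hF⟩ := S.exists_abs_F_le u
  have hm : Measurable fun w => S.F u (s, w) :=
    (S.measurable_F_right u).comp measurable_prodMk_left
  have hL2 : ∀ K : ℝ, MemLp (fun t : ℝ => K * |t|) 2 (gaussianReal 0 1) := fun K =>
    (memLp_id_gaussianReal (μ := 0) (v := 1) 2).norm.const_mul K
  refine (variance_pi_le (hL2 L) hm (hF s) (c := fun j => S.lip u j ^ 2) fun j w => ?_).trans ?_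
  · have := variance_le_integral_sub_sq (μ := gaussianReal 0 1)
      (f := fun t => S.F u (s, Function.update w j t)) (hm.comp (measurable_update w))
      (hL2 (S.lip u j)) (S.F u (s, Function.update w j 0)) fun t => by
        refine abs_logZ_sub_le (S.bddMeas_H u _) (S.bddMeas_H u _) fun x => ?_
        refine (S.abs_H_sub_noise_le u s _ _ x).trans_eq ?_
        rw [Finset.sum_eq_single j]
        · simp
        · intro k _ hk
          simp [Function.update_of_ne hk]
        · simp
    refine this.trans_eq ?_
    simp only [mul_pow, sq_abs, integral_const_mul, integral_sq_gaussianReal, mul_one]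
  · rw [Fintype.sum_sum_type]
    simp only [lip, Sum.elim_inl, Sum.elim_inr, Finset.sum_const, Finset.card_univ,
      Fintype.card_fin, nsmul_eq_mul, mul_pow, sq_abs]
    linarith [S.sum_β_le]

/-- Effect on the Hamiltonian of a change in one coordinate of the signal. -/
lemma abs_H_update_signal_le (u : ℝ) (s : Fin n → ℝ) (w : ι ⊕ Fin n → ℝ) (i : Fin n) (t : ℝ)
    (x : Fin n → ℝ) :
    |S.H u (Function.update s i t, w) x - S.H u (s, w) x| ≤
      S.D + 2 * S.M ^ 2 * u ^ 2 + 2 * S.M * |u| * |w (.inr i)| := by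
  have hd : ∀ k, k ≠ i → S.d k (Function.update s i t) x = S.d k s x := fun k hk => by
    unfold d
    rw [Function.update_of_ne hk]
  have hV : S.V (Function.update s i t, w) x - S.V (s, w) x =
      (S.c (s i) - S.c t) * w (.inr i) := by
    unfold V
    rw [← Finset.sum_sub_distrib, Finset.sum_eq_single i]
    · simp only [d, Function.update_self]
      ring
    · intro k _ hk
      simp only [hd k hk, sub_self]
    · simp
  have hW : S.W (Function.update s i t) x - S.W s x =
      S.d i (Function.update s i t) x ^ 2 - S.d i s x ^ 2 := by
    unfold W
    rw [← Finset.sum_sub_distrib, Finset.sum_eq_single i]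
    · intro k _ hk
      simp only [hd k hk, sub_self]
    · simp
  have e : S.H u (Function.update s i t, w) x - S.H u (s, w) x =
      -∑ a, S.Φ x a * (S.Φ (Function.update s i t) a - S.Φ s a) +
      u ^ 2 * ((S.W (Function.update s i t) x - S.W s x) / 2) +
      -(u * (S.V (Function.update s i t, w) x - S.V (s, w) x)) := by
    unfold H base
    simp only [mul_add, mul_sub, Finset.sum_add_distrib, Finset.sum_sub_distrib]
    ring
  have h1 := S.abs_sum_Φ_update_le x s i t
  have h2 : |u ^ 2 * ((S.W (Function.update s i t) x - S.W s x) / 2)| ≤ 2 * S.M ^ 2 * u ^ 2 := by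
    rw [hW, abs_mul, abs_of_nonneg (sq_nonneg u), mul_comm]
    refine mul_le_mul_of_nonneg_right ?_ (sq_nonneg u)
    have a1 := S.d_sq_le i s x
    have a2 := S.d_sq_le i (Function.update s i t) x
    have a3 := sq_nonneg (S.d i s x)
    have a4 := sq_nonneg (S.d i (Function.update s i t) x)
    rw [abs_le]
    constructor <;> linarith
  have h3 : |-(u * (S.V (Function.update s i t, w) x - S.V (s, w) x))| ≤
      2 * S.M * |u| * |w (.inr i)| := by
    rw [hV, abs_neg, abs_mul, abs_mul]
    have : |S.c (s i) - S.c t| ≤ 2 * S.M :=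
      (abs_sub _ _).trans (by linarith [S.abs_c_le (s i), S.abs_c_le t])
    calc |u| * (|S.c (s i) - S.c t| * |w (.inr i)|) ≤ |u| * (2 * S.M * |w (.inr i)|) := by gcongr
      _ = _ := by ring
  rw [e]
  refine (abs_add_le _ _).trans (add_le_add ((abs_add_le _ _).trans (add_le_add ?_ h2)) h3)
  rwa [abs_neg]

lemma variance_F_signal_le (u : ℝ) (w : ι ⊕ Fin n → ℝ) :
    Var[fun s => S.F u (s, w); S.P] ≤
      ∑ i : Fin n, 3 * (S.D ^ 2 + 4 * S.M ^ 4 * u ^ 4 + 4 * S.M ^ 2 * u ^ 2 * w (.inr i) ^ 2) := by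
  obtain ⟨C, L, -, hF⟩ := S.exists_abs_F_le u
  have hm : Measurable fun s => S.F u (s, w) :=
    (S.measurable_F_right u).comp measurable_prodMk_right
  refine variance_pi_le (h := fun _ => 0) (memLp_const 0) hm (C := C + ∑ j, L * |w j|)
    (fun s => by simpa using hF s w) fun i s => ?_
  refine (variance_le_integral_sub_sq (f := fun t => S.F u (Function.update s i t, w))
    (hm.comp (measurable_update s)) (memLp_const
    (S.D + 2 * S.M ^ 2 * u ^ 2 + 2 * S.M * |u| * |w (.inr i)|)) (S.F u (s, w)) fun t =>
      abs_logZ_sub_le (S.bddMeas_H u _) (S.bddMeas_H u _) fun x =>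
        S.abs_H_update_signal_le u s w i t x).trans ?_
  simp only [integral_const, probReal_univ, one_smul]
  have e : 3 * (S.D ^ 2 + 4 * S.M ^ 4 * u ^ 4 + 4 * S.M ^ 2 * u ^ 2 * w (.inr i) ^ 2) =
      3 * (S.D ^ 2 + (2 * S.M ^ 2 * u ^ 2) ^ 2 + (2 * S.M * |u| * |w (.inr i)|) ^ 2) := by
    simp only [mul_pow, sq_abs]
    ring
  rw [e]
  set a := S.D
  set b := 2 * S.M ^ 2 * u ^ 2
  set c := 2 * S.M * |u| * |w (.inr i)|
  nlinarith [sq_nonneg (a - b), sq_nonneg (a - c), sq_nonneg (b - c)]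

/-- The constant in the bound on the fluctuations of the free energy. -/
def varConst : ℝ := 3 * S.D ^ 2 + S.D + 28 * S.M ^ 4

lemma D_nonneg (hn : 1 ≤ n) : 0 ≤ S.D :=
  (abs_nonneg _).trans (S.abs_sum_Φ_update_le 0 0 ⟨0, hn⟩ 0)

/-- Concentration of the free energy, from the Efron–Stein inequality. -/
lemma variance_F_le (hn : 1 ≤ n) (u : ℝ) :
    Var[S.F u; S.μ] ≤ n * S.varConst * (1 + u ^ 4) := by
  refine (variance_prod_le (S.memLp_F u)).trans ?_
  have hz : ∀ i : Fin n, Integrable (fun w : ι ⊕ Fin n → ℝ => w (.inr i) ^ 2)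
      (stdNoise (ι ⊕ Fin n)) := fun i =>
    ((memLp_id_gaussianReal (μ := 0) (v := 1) 2).comp_measurePreserving
      (measurePreserving_eval (fun _ : ι ⊕ Fin n => gaussianReal 0 1) (.inr i))).integrable_sq
  have hz1 : ∀ i : Fin n, ∫ w : ι ⊕ Fin n → ℝ, w (.inr i) ^ 2 ∂(stdNoise (ι ⊕ Fin n)) = 1 := by
    intro i
    have h := measurePreserving_eval (fun _ : ι ⊕ Fin n => gaussianReal 0 1) (.inr i)
    rw [← integral_sq_gaussianReal, ← h.map_eq,
      integral_map h.measurable.aemeasurable (by fun_prop)]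
  have hi : ∀ i : Fin n, Integrable (fun w : ι ⊕ Fin n → ℝ =>
      3 * (S.D ^ 2 + 4 * S.M ^ 4 * u ^ 4 + 4 * S.M ^ 2 * u ^ 2 * w (.inr i) ^ 2))
      (stdNoise (ι ⊕ Fin n)) := fun i =>
    ((integrable_const _).fun_add ((hz i).const_mul _)).const_mul 3
  have h1 : ∫ w, Var[fun s => S.F u (s, w); S.P] ∂(stdNoise (ι ⊕ Fin n)) ≤
      n * (3 * (S.D ^ 2 + 4 * S.M ^ 4 * u ^ 4 + 4 * S.M ^ 2 * u ^ 2)) := by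
    refine (integral_mono_of_nonneg (.of_forall fun _ => variance_nonneg _ _)
      (integrable_finsetSum _ fun i _ => hi i)
      (.of_forall fun w => S.variance_F_signal_le u w)).trans_eq ?_
    rw [integral_finsetSum _ fun i _ => hi i]
    have : ∀ i : Fin n, ∫ w : ι ⊕ Fin n → ℝ,
        3 * (S.D ^ 2 + 4 * S.M ^ 4 * u ^ 4 + 4 * S.M ^ 2 * u ^ 2 * w (.inr i) ^ 2)
        ∂(stdNoise (ι ⊕ Fin n)) = 3 * (S.D ^ 2 + 4 * S.M ^ 4 * u ^ 4 + 4 * S.M ^ 2 * u ^ 2) := by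
      intro i
      rw [integral_const_mul, integral_add (integrable_const _) ((hz i).const_mul _),
        integral_const_mul, hz1]
      simp
    simp [this]
  have h2 : ∫ s, Var[fun w => S.F u (s, w); stdNoise (ι ⊕ Fin n)] ∂S.P ≤
      n * (S.D + 4 * S.M ^ 2 * u ^ 2) := by
    refine (integral_mono_of_nonneg (.of_forall fun _ => variance_nonneg _ _)
      (integrable_const _) (.of_forall fun s => S.variance_F_noise_le u s)).trans_eq ?_
    simp
  refine (add_le_add h1 h2).trans ?_
  rw [← mul_add, mul_assoc (n : ℝ)]
  refine mul_le_mul_of_nonneg_left ?_ (Nat.cast_nonneg n)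
  have hD := S.D_nonneg hn
  have hM : S.M ^ 2 ≤ S.M ^ 4 := pow_le_pow_right₀ S.one_le_M (by norm_num)
  have hu2 : u ^ 2 ≤ 1 + u ^ 4 := by nlinarith [sq_nonneg (u ^ 2 - 1), sq_nonneg u]
  have hu4 : 0 ≤ u ^ 4 := by positivity
  have hM0 : 0 ≤ S.M ^ 4 := by positivity
  have hMu : S.M ^ 2 * u ^ 2 ≤ S.M ^ 4 * (1 + u ^ 4) := by gcongr
  unfold varConst
  nlinarith [mul_nonneg hD hu4, mul_nonneg (sq_nonneg S.D) hu4, mul_nonneg hM0 hu4]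

end Model

/-! ### Thermal and disorder fluctuations -/

lemma slope_bounds_of_monotone_deriv {f f' : ℝ → ℝ} (hf : ∀ u, HasDerivAt f (f' u) u)
    (hmono : Monotone f') {a b : ℝ} (hab : a < b) :
    f' a * (b - a) ≤ f b - f a ∧ f b - f a ≤ f' b * (b - a) := by
  obtain ⟨c, hc, h⟩ := exists_hasDerivAt_eq_slope f f' hab
    (continuous_iff_continuousAt.2 fun u => (hf u).continuousAt).continuousOn fun u _ => hf u
  have hba : 0 < b - a := sub_pos.2 hab
  rw [eq_div_iff hba.ne'] at h
  rw [← h]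
  exact ⟨mul_le_mul_of_nonneg_right (hmono hc.1.le) hba.le,
    mul_le_mul_of_nonneg_right (hmono hc.2.le) hba.le⟩

/-- The increments of a monotone function over intervals of length `2 δ` integrate to `O(δ)`. -/
lemma lintegral_shift_sub_le {h : ℝ → ℝ} (hmono : Monotone h) {δ : ℝ} (hδ : 0 ≤ δ) {a b : ℝ}
    (hab : a ≤ b) :
    ∫⁻ u in Ioc a b, ENNReal.ofReal (h (u + δ) - h (u - δ)) ≤
      ENNReal.ofReal (2 * δ * (h (b + δ) - h (a - δ))) := by
  have hi : ∀ c d, IntervalIntegrable h volume c d := fun c d => hmono.intervalIntegrable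
  have i1 : IntervalIntegrable (fun u => h (u + δ)) volume a b :=
    Monotone.intervalIntegrable fun x y hxy => hmono (by linarith)
  have i2 : IntervalIntegrable (fun u => h (u - δ)) volume a b :=
    Monotone.intervalIntegrable fun x y hxy => hmono (by linarith)
  have h0 : ∀ u, 0 ≤ h (u + δ) - h (u - δ) := fun u => sub_nonneg.2 (hmono (by linarith))
  rw [← ofReal_integral_eq_lintegral_ofReal
    (((intervalIntegrable_iff_integrableOn_Ioc_of_le hab).1 (i1.sub i2)))
    (.of_forall h0), ← intervalIntegral.integral_of_le hab]
  refine ENNReal.ofReal_le_ofReal ?_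
  rw [intervalIntegral.integral_sub i1 i2, intervalIntegral.integral_comp_add_right,
    intervalIntegral.integral_comp_sub_right]
  have e : (∫ x in (a + δ)..(b + δ), h x) - ∫ x in (a - δ)..(b - δ), h x =
      (∫ x in (b - δ)..(b + δ), h x) - ∫ x in (a - δ)..(a + δ), h x := by
    have e1 := intervalIntegral.integral_add_adjacent_intervals (hi (a - δ) (a + δ))
      (hi (a + δ) (b + δ))
    have e2 := intervalIntegral.integral_add_adjacent_intervals (hi (a - δ) (b - δ))
      (hi (b - δ) (b + δ))
    linarith
  rw [e]
  have u1 : ∫ x in (b - δ)..(b + δ), h x ≤ ∫ x in (b - δ)..(b + δ), h (b + δ) :=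
    intervalIntegral.integral_mono_on (by linarith) (hi _ _) (by simp) fun x hx => hmono hx.2
  have u2 : ∫ x in (a - δ)..(a + δ), h (a - δ) ≤ ∫ x in (a - δ)..(a + δ), h x :=
    intervalIntegral.integral_mono_on (by linarith) (by simp) (hi _ _) fun x hx => hmono hx.1
  simp only [intervalIntegral.integral_const, smul_eq_mul] at u1 u2
  linarith

namespace Model

variable {n : ℕ} {ι : Type} [Fintype ι] (S : Model n ι)

lemma intervalIntegral_varA_le (ω : (Fin n → ℝ) × (ι ⊕ Fin n → ℝ)) {a b : ℝ} (hab : a ≤ b) :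
    ∫ u in a..b, S.varA u ω ≤
      4 * S.M ^ 2 * n * (b - a) + |S.meanA b ω| + |S.meanA a ω| := by
  have hc1 : Continuous fun u => ∫ x, S.W ω.1 x ∂(S.G u ω) :=
    S.continuous_integral_G ω (S.bddMeas_W ω.1)
  have hc2 := S.continuous_varA ω
  have h := intervalIntegral.integral_eq_sub_of_hasDerivAt (a := a) (b := b)
    (fun u _ => S.hasDerivAt_meanA u ω) ((hc1.sub hc2).intervalIntegrable _ _)
  rw [intervalIntegral.integral_sub (hc1.intervalIntegrable _ _)
    (hc2.intervalIntegrable _ _)] at h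
  have h2 : ∫ u in a..b, ∫ x, S.W ω.1 x ∂(S.G u ω) ≤ ∫ u in a..b, 4 * S.M ^ 2 * n :=
    intervalIntegral.integral_mono_on hab (hc1.intervalIntegrable _ _) (by simp)
      fun u _ => S.integral_W_le u ω
  simp only [intervalIntegral.integral_const, smul_eq_mul] at h2
  have h3 := neg_abs_le (S.meanA b ω)
  have h4 := le_abs_self (S.meanA a ω)
  linarith

/-- The integral over `u` of the thermal fluctuations telescopes, as these are a derivative up to a
bounded term. -/
lemma lintegral_varA_le (hn : 1 ≤ n) {a b : ℝ} (ha : 0 < a) (hab : a ≤ b) :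
    ∫⁻ u in Ioc a b, ENNReal.ofReal (∫ ω, S.varA u ω ∂S.μ) ≤
      ENNReal.ofReal (n * (4 * S.M ^ 2 * (b - a) + 2 * κ / a)) := by
  have e : ∀ u, ENNReal.ofReal (∫ ω, S.varA u ω ∂S.μ) =
      ∫⁻ ω, ENNReal.ofReal (S.varA u ω) ∂S.μ := fun u =>
    ofReal_integral_eq_lintegral_ofReal (S.integrable_varA u) (.of_forall (S.varA_nonneg u))
  simp only [e]
  rw [lintegral_lintegral_swap S.measurable_varA.ennreal_ofReal.aemeasurable]
  have e2 : ∀ ω, ∫⁻ u in Ioc a b, ENNReal.ofReal (S.varA u ω) =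
      ENNReal.ofReal (∫ u in a..b, S.varA u ω) := fun ω => by
    rw [intervalIntegral.integral_of_le hab, ofReal_integral_eq_lintegral_ofReal
      ((intervalIntegrable_iff_integrableOn_Ioc_of_le hab).1
        ((S.continuous_varA ω).intervalIntegrable _ _)) (.of_forall fun u => S.varA_nonneg u ω)]
  simp only [e2]
  have i1 := ((S.memLp_meanA b).integrable (by norm_num)).abs
  have i2 := ((S.memLp_meanA a).integrable (by norm_num)).abs
  have hba : 0 ≤ b - a := sub_nonneg.2 hab
  refine (lintegral_mono fun ω =>
    ENNReal.ofReal_le_ofReal (S.intervalIntegral_varA_le ω hab)).trans ?_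
  rw [← ofReal_integral_eq_lintegral_ofReal (((integrable_const _).fun_add i1).fun_add i2)
    (.of_forall fun ω => by positivity)]
  refine ENNReal.ofReal_le_ofReal ?_
  rw [integral_add ((integrable_const _).fun_add i1) i2, integral_add (integrable_const _) i1]
  simp only [integral_const, probReal_univ, one_smul]
  have h1 := S.integral_abs_meanA_le hn ha
  have h2 := S.integral_abs_meanA_le hn (ha.trans_le hab)
  have h3 : n * κ / b ≤ n * κ / a := by have := κ_pos; gcongr
  have e3 : n * (4 * S.M ^ 2 * (b - a) + 2 * κ / a) =
      4 * S.M ^ 2 * n * (b - a) + n * κ / a + n * κ / a := by ring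
  rw [e3]
  linarith

/-- Expected derivative of the convexified log-partition function. -/
def slope (u : ℝ) : ℝ := ∫ ω, (-S.meanA u ω + 4 * S.M ^ 2 * n * u) ∂S.μ

lemma integrable_slope (u : ℝ) :
    Integrable (fun ω => -S.meanA u ω + 4 * S.M ^ 2 * n * u) S.μ :=
  ((S.memLp_meanA u).integrable (by norm_num)).fun_neg.fun_add (integrable_const _)

lemma slope_mono : Monotone S.slope := fun u v huv =>
  integral_mono (S.integrable_slope u) (S.integrable_slope v) fun ω => S.monotone_slope ω huv

lemma slope_eq (u : ℝ) : S.slope u = -∫ ω, S.meanA u ω ∂S.μ + 4 * S.M ^ 2 * n * u := by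
  unfold slope
  rw [integral_add ((S.memLp_meanA u).integrable (by norm_num)).fun_neg (integrable_const _),
    integral_neg]
  simp

lemma abs_slope_sub_le (hn : 1 ≤ n) {u : ℝ} (hu : 0 < u) :
    |S.slope u - 4 * S.M ^ 2 * n * u| ≤ n * κ / u := by
  rw [slope_eq, add_sub_cancel_right, abs_neg]
  exact (abs_integral_le_integral_abs).trans (S.integral_abs_meanA_le hn hu)

/-- Disorder fluctuations of the derivative are controlled by those of the free energy at nearby
parameters, by convexity. -/
lemma variance_meanA_le (u : ℝ) {δ : ℝ} (hδ : 0 < δ) :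
    Var[S.meanA u; S.μ] ≤
      8 * (Var[S.F (u + δ); S.μ] + 2 * Var[S.F u; S.μ] + Var[S.F (u - δ); S.μ]) / δ ^ 2 +
        2 * (S.slope (u + δ) - S.slope (u - δ)) ^ 2 := by
  set E : ℝ → ℝ := fun v => ∫ ω, S.F v ω ∂S.μ with hE
  set X : ℝ → (Fin n → ℝ) × (ι ⊕ Fin n → ℝ) → ℝ := fun v ω => S.F v ω - E v with hX
  set k := 4 * S.M ^ 2 * n with hk
  set D := S.slope (u + δ) - S.slope (u - δ) with hD
  have hFi : ∀ v, Integrable (S.F v) S.μ := fun v => (S.memLp_F v).integrable (by norm_num)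
  have hX2 : ∀ v, MemLp (X v) 2 S.μ := fun v => (S.memLp_F v).sub (memLp_const _)
  have hXv : ∀ v, Var[S.F v; S.μ] = ∫ ω, X v ω ^ 2 ∂S.μ := fun v =>
    variance_eq_integral (S.memLp_F v).1.aemeasurable
  have hder : ∀ ω v, HasDerivAt (fun v => S.F v ω + k / 2 * v ^ 2)
      (-S.meanA v ω + k * v) v := fun ω v => by
    refine ((S.hasDerivAt_F v ω).fun_add
      (((hasDerivAt_id v).fun_pow 2).const_mul (k / 2))).congr_deriv ?_
    simp
    ring
  have hsl : ∀ ω {v w : ℝ}, v < w → (-S.meanA v ω + k * v) * (w - v) ≤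
        S.F w ω - S.F v ω + k / 2 * (w ^ 2 - v ^ 2) ∧
      S.F w ω - S.F v ω + k / 2 * (w ^ 2 - v ^ 2) ≤ (-S.meanA w ω + k * w) * (w - v) := by
    intro ω v w hvw
    have := slope_bounds_of_monotone_deriv (hder ω) (S.monotone_slope ω) hvw
    constructor <;> linarith [this.1, this.2]
  have hsub : ∀ w v, Integrable (fun ω => S.F w ω - S.F v ω) S.μ := fun w v =>
    (hFi w).sub (hFi v)
  have hslE : ∀ {v w : ℝ}, v < w → S.slope v * (w - v) ≤
        E w - E v + k / 2 * (w ^ 2 - v ^ 2) ∧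
      E w - E v + k / 2 * (w ^ 2 - v ^ 2) ≤ S.slope w * (w - v) := by
    intro v w hvw
    have e : E w - E v + k / 2 * (w ^ 2 - v ^ 2) =
        ∫ ω, (S.F w ω - S.F v ω + k / 2 * (w ^ 2 - v ^ 2)) ∂S.μ := by
      rw [integral_add (hsub w v) (integrable_const _), integral_sub (hFi w) (hFi v)]
      simp [hE]
    have hi : Integrable (fun ω => S.F w ω - S.F v ω + k / 2 * (w ^ 2 - v ^ 2)) S.μ :=
      (hsub w v).fun_add (integrable_const _)
    unfold slope
    rw [e, ← integral_mul_const, ← integral_mul_const]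
    exact ⟨integral_mono ((S.integrable_slope v).mul_const _) hi fun ω => (hsl ω hvw).1,
      integral_mono hi ((S.integrable_slope w).mul_const _) fun ω => (hsl ω hvw).2⟩
  have hup : u < u + δ := by linarith
  have hlo : u - δ < u := by linarith
  have hm1 : S.slope u ≤ S.slope (u + δ) := S.slope_mono hup.le
  have hm2 : S.slope (u - δ) ≤ S.slope u := S.slope_mono hlo.le
  have hpt : ∀ ω, |(-S.meanA u ω + k * u) - S.slope u| * δ ≤
      |X (u + δ) ω| + 2 * |X u ω| + |X (u - δ) ω| + D * δ := by
    intro ω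
    have a1 := (hsl ω hup).1
    have a2 := (hslE hup).2
    have a3 := (hsl ω hlo).2
    have a4 := (hslE hlo).1
    rw [add_sub_cancel_left] at a1 a2
    rw [sub_sub_cancel] at a3 a4
    have x1 := abs_le.1 (le_refl |X (u + δ) ω|)
    have x2 := abs_le.1 (le_refl |X u ω|)
    have x3 := abs_le.1 (le_refl |X (u - δ) ω|)
    have xp : X (u + δ) ω - X u ω = S.F (u + δ) ω - S.F u ω - (E (u + δ) - E u) := by
      simp only [hX]; ring
    have xm : X u ω - X (u - δ) ω = S.F u ω - S.F (u - δ) ω - (E u - E (u - δ)) := by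
      simp only [hX]; ring
    have y1 : 0 ≤ |X (u + δ) ω| := abs_nonneg _
    have y2 : 0 ≤ |X u ω| := abs_nonneg _
    have y3 : 0 ≤ |X (u - δ) ω| := abs_nonneg _
    have z1 := mul_le_mul_of_nonneg_right hm1 hδ.le
    have z2 := mul_le_mul_of_nonneg_right hm2 hδ.le
    have hDe : D * δ = S.slope (u + δ) * δ - S.slope (u - δ) * δ := by rw [hD]; ring
    rw [hDe, ← abs_of_pos hδ, ← abs_mul, abs_of_pos hδ, abs_le]
    have hexp : (-S.meanA u ω + k * u - S.slope u) * δ =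
      (-S.meanA u ω + k * u) * δ - S.slope u * δ := by ring
    rw [hexp]
    constructor <;> linarith
  have hsq : ∀ ω, (S.meanA u ω - ∫ ω, S.meanA u ω ∂S.μ) ^ 2 ≤
      8 / δ ^ 2 * (X (u + δ) ω ^ 2 + 2 * X u ω ^ 2 + X (u - δ) ω ^ 2) + 2 * D ^ 2 := by
    intro ω
    have e : |(-S.meanA u ω + k * u) - S.slope u| = |S.meanA u ω - ∫ ω, S.meanA u ω ∂S.μ| := by
      rw [slope_eq, ← abs_neg]
      congr 1
      ring
    have h := hpt ω
    rw [e] at h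
    rw [← sq_abs (X (u + δ) ω), ← sq_abs (X u ω), ← sq_abs (X (u - δ) ω),
      ← sq_abs (S.meanA u ω - _)]
    set p := |S.meanA u ω - ∫ ω, S.meanA u ω ∂S.μ|
    set x := |X (u + δ) ω|
    set y := |X u ω|
    set z := |X (u - δ) ω|
    have hp : 0 ≤ p := abs_nonneg _
    have h1 : (p * δ) ^ 2 ≤ (x + 2 * y + z + D * δ) ^ 2 := by gcongr
    have h2 : (x + 2 * y + z + D * δ) ^ 2 ≤
        8 * (x ^ 2 + 2 * y ^ 2 + z ^ 2) + 2 * D ^ 2 * δ ^ 2 := by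
      nlinarith [sq_nonneg (x + 2 * y + z - D * δ), sq_nonneg (x - y), sq_nonneg (x - z),
        sq_nonneg (y - z)]
    have e2 : 8 / δ ^ 2 * (x ^ 2 + 2 * y ^ 2 + z ^ 2) + 2 * D ^ 2 =
        (8 * (x ^ 2 + 2 * y ^ 2 + z ^ 2) + 2 * D ^ 2 * δ ^ 2) / δ ^ 2 := by
      field_simp
    rw [e2, le_div_iff₀ (by positivity), ← mul_pow]
    exact h1.trans h2
  have s1 := (hX2 (u + δ)).integrable_sq
  have s2 := (hX2 u).integrable_sq.const_mul 2
  have s3 := (hX2 (u - δ)).integrable_sq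
  rw [variance_eq_integral (S.memLp_meanA u).1.aemeasurable]
  refine (integral_mono_of_nonneg (.of_forall fun ω => sq_nonneg _)
    ((((s1.fun_add s2).fun_add s3).const_mul _).fun_add (integrable_const _))
    (.of_forall hsq)).trans_eq ?_
  rw [integral_add (((s1.fun_add s2).fun_add s3).const_mul _) (integrable_const _),
    integral_const_mul, integral_add (s1.fun_add s2) s3, integral_add s1 s2, integral_const_mul,
    ← hXv, ← hXv, ← hXv]
  simp only [integral_const, probReal_univ, one_smul]
  ring

/-- Fluctuations of the overlap at mean-field signal-to-noise ratio `u ^ 2`, under the joint law of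
signal, noise and posterior sample. -/
def overlapVar (u : ℝ) : ℝ := Var[fun p => S.q p.1.1 p.2; S.law u]

lemma overlapVar_le_bound (u : ℝ) : S.overlapVar u ≤ S.M ^ 4 := by
  have := variance_le_sq_of_bounded (μ := S.law u)
    (.of_forall fun p => abs_le.1 (S.abs_q_le p.1.1 p.2)) S.bddMeas_q_law.1.aemeasurable
  refine this.trans_eq ?_
  ring

/-- For large signal-to-noise ratio, sample and signal nearly agree. -/
lemma overlapVar_le_tail (hn : 1 ≤ n) {u : ℝ} (hu : 0 < u) :
    S.overlapVar u ≤ 2 * κ / u ^ 4 + 2 * S.M ^ 4 / n := by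
  have hn0 : (0 : ℝ) < n := by positivity
  refine (S.variance_overlap_le hn hu).trans (add_le_add ?_ le_rfl)
  refine (div_le_div_of_nonneg_right (mul_le_mul_of_nonneg_left (S.variance_A_le hu)
    two_pos.le) (by positivity)).trans_eq ?_
  field_simp

lemma slope_diff_le (hn : 1 ≤ n) {u δ : ℝ} (hδ : 0 < δ) (hu : 2 * δ ≤ u) :
    S.slope (u + δ) - S.slope (u - δ) ≤ n * (8 * S.M ^ 2 * δ + 3 * κ / u) := by
  have hκ := κ_pos
  have hn0 : (0 : ℝ) < n := by positivity
  have hu0 : 0 < u := by linarith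
  have h1 := (abs_le.1 (S.abs_slope_sub_le hn (u := u + δ) (by linarith))).2
  have h2 := (abs_le.1 (S.abs_slope_sub_le hn (u := u - δ) (by linarith))).1
  have h3 : n * κ / (u + δ) ≤ n * κ / u := by gcongr; linarith
  have h4 : n * κ / (u - δ) ≤ n * κ / (u / 2) := by gcongr; linarith
  have e : n * (8 * S.M ^ 2 * δ + 3 * κ / u) =
      8 * S.M ^ 2 * n * δ + n * κ / u + n * κ / (u / 2) := by field_simp; ring
  rw [e]
  linarith

lemma lintegral_slope_diff_le (hn : 1 ≤ n) {a b δ : ℝ} (hδ : 0 < δ) (ha : 2 * δ ≤ a)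
    (hab : a ≤ b) :
    ∫⁻ u in Ioc a b, ENNReal.ofReal (S.slope (u + δ) - S.slope (u - δ)) ≤
      ENNReal.ofReal (2 * δ * (n * (4 * S.M ^ 2 * (b - a + 2 * δ) + 3 * κ / a))) := by
  refine (lintegral_shift_sub_le S.slope_mono hδ.le hab).trans (ENNReal.ofReal_le_ofReal ?_)
  have hκ := κ_pos
  have hn0 : (0 : ℝ) < n := by positivity
  have ha0 : 0 < a := by linarith
  have h1 := (abs_le.1 (S.abs_slope_sub_le hn (u := b + δ) (by linarith))).2
  have h2 := (abs_le.1 (S.abs_slope_sub_le hn (u := a - δ) (by linarith))).1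
  have h3 : n * κ / (b + δ) ≤ n * κ / a := by gcongr; linarith
  have h4 : n * κ / (a - δ) ≤ n * κ / (a / 2) := by gcongr; linarith
  have e : n * (4 * S.M ^ 2 * (b - a + 2 * δ) + 3 * κ / a) =
      4 * S.M ^ 2 * n * (b - a + 2 * δ) + n * κ / a + n * κ / (a / 2) := by field_simp; ring
  gcongr
  rw [e]
  linarith

/-- Pointwise bound on the overlap fluctuations, by the quantities that are controlled after
integration over `u`. -/
lemma overlapVar_le (hn : 1 ≤ n) {u δ : ℝ} (hδ : 0 < δ) (hδ1 : δ ≤ 1) (hu : 2 * δ ≤ u) :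
    S.overlapVar u ≤ 64 * S.varConst * (1 + 6 * u ^ 4) / (u ^ 2 * n * δ ^ 2) + 2 * S.M ^ 4 / n +
      (2 / n ^ 2 * ∫ ω, S.varA u ω ∂S.μ + 4 / n * (8 * S.M ^ 2 + 3 * κ / u) *
        (S.slope (u + δ) - S.slope (u - δ))) / u ^ 2 := by
  have hκ := κ_pos
  have hn0 : (0 : ℝ) < n := by positivity
  have hu0 : 0 < u := by linarith
  have hCV : 0 ≤ S.varConst := by
    have := S.D_nonneg hn
    have := S.M_pos
    unfold varConst
    positivity
  have h0 := S.variance_overlap_le hn hu0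
  rw [S.variance_A_eq] at h0
  have h1 := S.variance_meanA_le u hδ
  have v : ∀ w, |w| ≤ 3 / 2 * u → Var[S.F w; S.μ] ≤ n * S.varConst * (1 + 6 * u ^ 4) := by
    intro w hw
    refine (S.variance_F_le hn w).trans ?_
    gcongr
    have : w ^ 4 ≤ (3 / 2 * u) ^ 4 := by
      rw [← Even.pow_abs (show Even 4 by decide) w]
      gcongr
    have : 0 ≤ u ^ 4 := by positivity
    nlinarith
  have v1 := v (u + δ) (by rw [abs_of_pos (by linarith)]; linarith)
  have v2 := v u (by rw [abs_of_pos hu0]; linarith)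
  have v3 := v (u - δ) (by rw [abs_of_pos (by linarith)]; linarith)
  set D := S.slope (u + δ) - S.slope (u - δ) with hD
  have hD0 : 0 ≤ D := sub_nonneg.2 (S.slope_mono (by linarith))
  have hD1 : D ≤ n * (8 * S.M ^ 2 + 3 * κ / u) := by
    refine (S.slope_diff_le hn hδ hu).trans ?_
    have : 8 * S.M ^ 2 * δ ≤ 8 * S.M ^ 2 := mul_le_of_le_one_right (by positivity) hδ1
    gcongr
  have hD2 : D ^ 2 ≤ n * (8 * S.M ^ 2 + 3 * κ / u) * D := by
    rw [sq]; exact mul_le_mul_of_nonneg_right hD1 hD0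
  have h2 : Var[S.meanA u; S.μ] ≤ 32 * (n * S.varConst * (1 + 6 * u ^ 4)) / δ ^ 2 +
      2 * (n * (8 * S.M ^ 2 + 3 * κ / u) * D) := by
    refine h1.trans (add_le_add (div_le_div_of_nonneg_right ?_ (by positivity)) (by linarith))
    linarith
  refine h0.trans ?_
  have h3 : 2 * (∫ ω, S.varA u ω ∂S.μ + Var[S.meanA u; S.μ]) / (u ^ 2 * n ^ 2) ≤
      2 * (∫ ω, S.varA u ω ∂S.μ + (32 * (n * S.varConst * (1 + 6 * u ^ 4)) / δ ^ 2 +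
      2 * (n * (8 * S.M ^ 2 + 3 * κ / u) * D))) / (u ^ 2 * n ^ 2) := by gcongr
  refine (add_le_add_left h3 _).trans_eq ?_
  field_simp
  ring

end Model

/-! ### Integrating over the perturbation -/

/-- Change of variables `u = √(R ε)`. Only a lower bound on the derivative of `R` is needed, as it
makes `R` injective and bounds the Jacobian. -/
lemma lintegral_comp_sqrt_le {R R' : ℝ → ℝ} {a b Λ : ℝ} (ha : 0 < a)
    (hR : ∀ ε ∈ Ioc a b, HasDerivAt R (R' ε) ε) (hR1 : ∀ ε ∈ Ioc a b, 1 ≤ R' ε)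
    (hRa : ∀ ε ∈ Ioc a b, ε ≤ R ε) {ψ : ℝ → ℝ} (hψ : ∀ u, 0 ≤ ψ u) :
    MeasurableSet (Ioc a b ∩ {ε | R ε ≤ Λ}) ∧
    ∫⁻ ε in Ioc a b ∩ {ε | R ε ≤ Λ}, ENNReal.ofReal (ψ √(R ε) / R ε) ≤
      ENNReal.ofReal (2 / √a) * ∫⁻ u in Ioc √a √Λ, ENNReal.ofReal (ψ u) := by
  have hmono : StrictMonoOn R (Ioc a b) := by
    refine strictMonoOn_of_deriv_pos (convex_Ioc a b)
      (fun ε hε => (hR ε hε).continuousAt.continuousWithinAt) fun ε hε => ?_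
    have hε' := interior_subset hε
    rw [(hR ε hε').deriv]
    exact one_pos.trans_le (hR1 ε hε')
  set s := Ioc a b ∩ {ε | R ε ≤ Λ} with hs
  have hsm : MeasurableSet s := by
    refine Set.OrdConnected.measurableSet ⟨fun x hx y hy z hz => ?_⟩
    have hz' : z ∈ Ioc a b := ⟨hx.1.1.trans_le hz.1, hz.2.trans hy.1.2⟩
    exact ⟨hz', (hmono.monotoneOn hz' hy.1 hz.2).trans hy.2⟩
  refine ⟨hsm, ?_⟩
  have hpos : ∀ ε ∈ s, a < R ε := fun ε hε => hε.1.1.trans_le (hRa ε hε.1)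
  have hder : ∀ ε ∈ s, HasDerivWithinAt (fun ε => √(R ε)) (R' ε / (2 * √(R ε))) s ε :=
    fun ε hε => ((hR ε hε.1).sqrt (ha.trans (hpos ε hε)).ne').hasDerivWithinAt
  have hinj : InjOn (fun ε => √(R ε)) s := by
    intro x hx y hy hxy
    exact hmono.injOn hx.1 hy.1
      ((Real.sqrt_inj (ha.trans (hpos x hx)).le (ha.trans (hpos y hy)).le).1 hxy)
  have himg : (fun ε => √(R ε)) '' s ⊆ Ioc √a √Λ := by
    rintro _ ⟨ε, hε, rfl⟩
    exact ⟨Real.sqrt_lt_sqrt ha.le (hpos ε hε), Real.sqrt_le_sqrt hε.2⟩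
  have hra : 0 < √a := Real.sqrt_pos.2 ha
  calc ∫⁻ ε in s, ENNReal.ofReal (ψ √(R ε) / R ε)
      ≤ ∫⁻ ε in s, ENNReal.ofReal |R' ε / (2 * √(R ε))| *
          (ENNReal.ofReal (2 / √a) * ENNReal.ofReal (ψ √(R ε))) := by
        refine setLIntegral_mono' hsm fun ε hε => ?_
        rw [← ENNReal.ofReal_mul (by positivity), ← ENNReal.ofReal_mul (abs_nonneg _)]
        refine ENNReal.ofReal_le_ofReal ?_
        have hR0 : 0 < R ε := ha.trans (hpos ε hε)
        have hr0 : 0 < √(R ε) := Real.sqrt_pos.2 hR0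
        have h1 := hR1 ε hε.1
        have h2 : √a ≤ √(R ε) := Real.sqrt_le_sqrt (hpos ε hε).le
        rw [abs_of_nonneg (by positivity)]
        have e : R' ε / (2 * √(R ε)) * (2 / √a * ψ √(R ε)) = R' ε * ψ √(R ε) / (√(R ε) * √a) := by
          field_simp
        rw [e]
        have h0 := hψ √(R ε)
        have h3 : ψ √(R ε) ≤ R' ε * ψ √(R ε) := le_mul_of_one_le_left h0 h1
        have h4 : √(R ε) * √a ≤ R ε := by
          conv_rhs => rw [← Real.mul_self_sqrt hR0.le]
          gcongr
        gcongr
    _ = ∫⁻ u in (fun ε => √(R ε)) '' s, ENNReal.ofReal (2 / √a) * ENNReal.ofReal (ψ u) :=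
        (lintegral_image_eq_lintegral_abs_deriv_mul hsm hder hinj
          fun u => ENNReal.ofReal (2 / √a) * ENNReal.ofReal (ψ u)).symm
    _ ≤ ∫⁻ u in Ioc √a √Λ, ENNReal.ofReal (2 / √a) * ENNReal.ofReal (ψ u) :=
        lintegral_mono_set himg
    _ = _ := lintegral_const_mul' _ _ ENNReal.ofReal_ne_top

/-- The constant in the bound on the integrated fluctuations of the overlap. -/
def overlapConst (M D : ℝ) : ℝ :=
  448 * (3 * D ^ 2 + D + 28 * M ^ 4) + 2 * Model.κ + 18 * M ^ 4 +
    2 * (8 * M ^ 2 + 4 * Model.κ + 8 * (8 * M ^ 2 + 3 * Model.κ) * (12 * M ^ 2 + 3 * Model.κ))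

namespace Model

variable {n : ℕ} {ι : Type} [Fintype ι] (S : Model n ι)

lemma measurable_slope_diff (δ : ℝ) : Measurable fun u => S.slope (u + δ) - S.slope (u - δ) :=
  (S.slope_mono.measurable.comp (measurable_add_const δ)).sub
    (S.slope_mono.measurable.comp (measurable_sub_const δ))

/-- The part of the bound on the overlap fluctuations that is only controlled after integration over
`u`. Here `r` is a lower bound on `u`, and `δ` the step in the convexity argument. -/
def fluct (r δ u : ℝ) : ℝ :=
  2 / n ^ 2 * ∫ ω, S.varA u ω ∂S.μ +
    4 * (8 * S.M ^ 2 + 3 * κ) / (r * n) * (S.slope (u + δ) - S.slope (u - δ))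

lemma fluct_nonneg {r δ : ℝ} (hr : 0 < r) (hδ : 0 < δ) (u : ℝ) : 0 ≤ S.fluct r δ u := by
  have hκ := κ_pos
  have h1 : 0 ≤ ∫ ω, S.varA u ω ∂S.μ := integral_nonneg (S.varA_nonneg u)
  have h2 : 0 ≤ S.slope (u + δ) - S.slope (u - δ) := sub_nonneg.2 (S.slope_mono (by linarith))
  unfold fluct
  positivity

lemma lintegral_fluct_le (hn : 1 ≤ n) {r L δ : ℝ} (hr : 0 < r) (hrL : r ≤ L) (hδ : 0 < δ)
    (hδr : 2 * δ ≤ r) :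
    ∫⁻ u in Ioc r L, ENNReal.ofReal (S.fluct r δ u) ≤ ENNReal.ofReal
      (2 / n ^ 2 * (n * (4 * S.M ^ 2 * (L - r) + 2 * κ / r)) +
        4 * (8 * S.M ^ 2 + 3 * κ) / (r * n) *
          (2 * δ * (n * (4 * S.M ^ 2 * (L - r + 2 * δ) + 3 * κ / r)))) := by
  have hκ := κ_pos
  have hn0 : (0 : ℝ) < n := by positivity
  have hLr : 0 ≤ L - r := sub_nonneg.2 hrL
  have hv : ∀ u, 0 ≤ ∫ ω, S.varA u ω ∂S.μ := fun u => integral_nonneg (S.varA_nonneg u)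
  have hs : ∀ u, 0 ≤ S.slope (u + δ) - S.slope (u - δ) := fun u =>
    sub_nonneg.2 (S.slope_mono (by linarith))
  have c1 : (0 : ℝ) ≤ 2 / n ^ 2 := by positivity
  have c2 : 0 ≤ 4 * (8 * S.M ^ 2 + 3 * κ) / (r * n) := by positivity
  have e : ∀ u, ENNReal.ofReal (S.fluct r δ u) =
      ENNReal.ofReal (2 / n ^ 2) * ENNReal.ofReal (∫ ω, S.varA u ω ∂S.μ) +
        ENNReal.ofReal (4 * (8 * S.M ^ 2 + 3 * κ) / (r * n)) *
          ENNReal.ofReal (S.slope (u + δ) - S.slope (u - δ)) := by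
    intro u
    unfold fluct
    rw [ENNReal.ofReal_add (mul_nonneg c1 (hv u)) (mul_nonneg c2 (hs u)), ENNReal.ofReal_mul c1,
      ENNReal.ofReal_mul c2]
  simp only [e]
  rw [lintegral_add_right _ ((S.measurable_slope_diff δ).ennreal_ofReal.const_mul _),
    lintegral_const_mul' _ _ ENNReal.ofReal_ne_top, lintegral_const_mul' _ _ ENNReal.ofReal_ne_top,
    ENNReal.ofReal_add (mul_nonneg c1 (by positivity)) (mul_nonneg c2 (by positivity)),
    ENNReal.ofReal_mul c1, ENNReal.ofReal_mul c2]
  gcongr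
  · exact S.lintegral_varA_le hn hr hrL
  · exact S.lintegral_slope_diff_le hn hδ hδr hrL

/-- The overlap fluctuations at `u ≤ L`, where `n = L ^ 16`, with the step `L⁻⁵` in the convexity
argument. The disorder term `(1 + u ^ 4) / (u ^ 2 n δ ^ 2)` is then of order
`L ^ 2 / (L ^ 16 L⁻¹⁰) = L⁻⁴`, as is the integral of `fluct`. -/
lemma overlapVar_le_fluct {r L u : ℝ} (hL : 1 ≤ L) (hnL : (n : ℝ) = L ^ 16) (hr : 0 < r)
    (hr1 : r ≤ 1) (hδr : 2 * (L ^ 5)⁻¹ ≤ r) (hru : r ≤ u) (huL : u ≤ L) :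
    S.overlapVar u ≤ (448 * S.varConst + 2 * S.M ^ 4) / (r ^ 4 * L ^ 4) +
      S.fluct r (L ^ 5)⁻¹ u / u ^ 2 := by
  have hκ := κ_pos
  have hL0 : 0 < L := by linarith
  have hn : 1 ≤ n := by
    have : (1 : ℝ) ≤ n := hnL ▸ one_le_pow₀ hL
    exact_mod_cast this
  have hu0 : 0 < u := hr.trans_le hru
  have hCV : 0 ≤ S.varConst := by
    have := S.D_nonneg hn
    have := S.M_pos
    unfold varConst
    positivity
  set δ := (L ^ 5)⁻¹ with hδ
  have hδ0 : 0 < δ := by positivity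
  have hδ1 : δ ≤ 1 := inv_le_one_of_one_le₀ (one_le_pow₀ hL)
  have h0 := S.overlapVar_le hn hδ0 hδ1 (hδr.trans hru)
  have hs : 0 ≤ S.slope (u + δ) - S.slope (u - δ) := sub_nonneg.2 (S.slope_mono (by linarith))
  have h1 : 4 / n * (8 * S.M ^ 2 + 3 * κ / u) ≤ 4 * (8 * S.M ^ 2 + 3 * κ) / (r * n) := by
    have h2 : 8 * S.M ^ 2 + 3 * κ / u ≤ (8 * S.M ^ 2 + 3 * κ) / r := by
      rw [add_div]
      have : 8 * S.M ^ 2 ≤ 8 * S.M ^ 2 / r := by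
        rw [le_div_iff₀ hr]
        exact mul_le_of_le_one_right (by positivity) hr1
      gcongr
    have e : 4 * (8 * S.M ^ 2 + 3 * κ) / (r * n) = 4 / n * ((8 * S.M ^ 2 + 3 * κ) / r) := by
      have : (n : ℝ) ≠ 0 := by positivity
      field_simp
    rw [e]
    gcongr
  have h3 : (2 / n ^ 2 * ∫ ω, S.varA u ω ∂S.μ + 4 / n * (8 * S.M ^ 2 + 3 * κ / u) *
        (S.slope (u + δ) - S.slope (u - δ))) / u ^ 2 ≤ S.fluct r δ u / u ^ 2 := by
    unfold fluct
    gcongr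
  have hr4 : r ^ 4 ≤ 1 := pow_le_one₀ hr.le hr1
  have h4 : 64 * S.varConst * (1 + 6 * u ^ 4) / (u ^ 2 * n * δ ^ 2) ≤
      448 * S.varConst / (r ^ 4 * L ^ 4) := by
    have e : 64 * S.varConst * (1 + 6 * u ^ 4) / (u ^ 2 * n * δ ^ 2) =
        64 * S.varConst / L ^ 6 * (1 / u ^ 2 + 6 * u ^ 2) := by
      rw [hnL, hδ]
      field_simp
    have e2 : 448 * S.varConst / (r ^ 4 * L ^ 4) =
        64 * S.varConst / L ^ 6 * (7 * L ^ 2 / r ^ 4) := by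
      field_simp
      ring
    rw [e, e2]
    have b1 : 1 / u ^ 2 ≤ L ^ 2 / r ^ 4 := by
      have : r ^ 4 ≤ r ^ 2 := pow_le_pow_of_le_one hr.le hr1 (by norm_num)
      have : r ^ 2 ≤ u ^ 2 := by gcongr
      have : 1 ≤ L ^ 2 := one_le_pow₀ hL
      gcongr
      linarith
    have b2 : 6 * u ^ 2 ≤ 6 * L ^ 2 / r ^ 4 := by
      rw [le_div_iff₀ (by positivity)]
      exact (mul_le_of_le_one_right (by positivity) hr4).trans (by gcongr)
    have e3 : 7 * L ^ 2 / r ^ 4 = L ^ 2 / r ^ 4 + 6 * L ^ 2 / r ^ 4 := by ring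
    rw [e3]
    gcongr
  have h5 : 2 * S.M ^ 4 / n ≤ 2 * S.M ^ 4 / (r ^ 4 * L ^ 4) := by
    rw [hnL]
    gcongr
    exact (mul_le_of_le_one_left (by positivity) hr4).trans (pow_le_pow_right₀ hL (by norm_num))
  rw [add_div]
  linarith

/-- The overlap concentrates after averaging over the perturbation, whenever the mean-field
signal-to-noise ratio `R` grows with slope at least one. -/
lemma lintegral_overlapVar_le {L : ℝ} (hL : 1 ≤ L) (hnL : (n : ℝ) = L ^ 16) {a b : ℝ} (ha : 0 < a)
    (hab : a ≤ b) (hb : b ≤ 1) {R R' : ℝ → ℝ}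
    (hR : ∀ ε ∈ Ioc a b, HasDerivAt R (R' ε) ε) (hR1 : ∀ ε ∈ Ioc a b, 1 ≤ R' ε)
    (hRa : ∀ ε ∈ Ioc a b, ε ≤ R ε) :
    ∫⁻ ε in Ioc a b, ENNReal.ofReal (S.overlapVar √(R ε)) ≤
      ENNReal.ofReal (overlapConst S.M S.D / (a ^ 2 * L ^ 4)) := by
  have hκ := κ_pos
  have hM := S.M_pos
  have hL0 : 0 < L := by linarith
  have hn : 1 ≤ n := by
    have : (1 : ℝ) ≤ n := hnL ▸ one_le_pow₀ hL
    exact_mod_cast this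
  have hD := S.D_nonneg hn
  have hCV : 0 ≤ S.varConst := by
    unfold varConst
    positivity
  have ha1 : a ≤ 1 := hab.trans hb
  set r := √a with hr
  have hr0 : 0 < r := Real.sqrt_pos.2 ha
  have hr1 : r ≤ 1 := Real.sqrt_le_one.2 ha1
  have hr4 : a ^ 2 = r ^ 4 := by
    rw [show r ^ 4 = (r ^ 2) ^ 2 by ring, Real.sq_sqrt ha.le]
  have hra4 : r ^ 4 ≤ 1 := pow_le_one₀ hr0.le hr1
  have hvol : ∀ B : ℝ, ∫⁻ _ in Ioc a b, ENNReal.ofReal B ≤ ENNReal.ofReal B := by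
    intro B
    rw [setLIntegral_const, Real.volume_Ioc]
    refine mul_le_of_le_one_right' ?_
    rw [← ENNReal.ofReal_one]
    exact ENNReal.ofReal_le_ofReal (by linarith)
  rw [hr4]
  have hC : overlapConst S.M S.D = 448 * S.varConst + 2 * κ + 18 * S.M ^ 4 +
    2 * (8 * S.M ^ 2 + 4 * κ + 8 * (8 * S.M ^ 2 + 3 * κ) * (12 * S.M ^ 2 + 3 * κ)) := rfl
  rcases lt_or_ge r (2 * (L ^ 5)⁻¹) with h | hδr
  · -- for such small `a` the right-hand side exceeds the trivial bound
    have h1 : S.M ^ 4 ≤ overlapConst S.M S.D / (r ^ 4 * L ^ 4) := by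
      have h2 : r ^ 4 * L ^ 4 ≤ 16 := by
        have h3 : r ^ 4 ≤ (2 * (L ^ 5)⁻¹) ^ 4 := by gcongr
        have h4 : (2 * (L ^ 5)⁻¹) ^ 4 * L ^ 4 = 16 * (L ^ 16)⁻¹ := by
          field_simp
          norm_num
        have h5 : (L ^ 16)⁻¹ ≤ 1 := inv_le_one_of_one_le₀ (one_le_pow₀ hL)
        have h6 : r ^ 4 * L ^ 4 ≤ (2 * (L ^ 5)⁻¹) ^ 4 * L ^ 4 := by gcongr
        linarith
      rw [le_div_iff₀ (by positivity)]
      have h7 : S.M ^ 4 * (r ^ 4 * L ^ 4) ≤ S.M ^ 4 * 16 := by gcongr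
      have h8 : S.M ^ 4 * 16 ≤ overlapConst S.M S.D := by
        rw [hC]
        have : 0 ≤ 448 * S.varConst + 2 * κ + 2 * S.M ^ 4 +
          2 * (8 * S.M ^ 2 + 4 * κ + 8 * (8 * S.M ^ 2 + 3 * κ) * (12 * S.M ^ 2 + 3 * κ)) := by
          positivity
        linarith
      exact h7.trans h8
    exact (lintegral_mono fun ε => ENNReal.ofReal_le_ofReal
      ((S.overlapVar_le_bound _).trans h1)).trans (hvol _)
  set δ := (L ^ 5)⁻¹ with hδ
  have hδ0 : 0 < δ := by positivity
  have hδ1 : δ ≤ 1 := inv_le_one_of_one_le₀ (one_le_pow₀ hL)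
  set B := (448 * S.varConst + 2 * κ + 2 * S.M ^ 4) / (r ^ 4 * L ^ 4) with hB
  -- the cut-off is at signal-to-noise ratio `L ^ 2`; beyond it, only the tail bound is used
  obtain ⟨hsm, hcv⟩ := lintegral_comp_sqrt_le (Λ := L ^ 2) ha hR hR1 hRa
    (S.fluct_nonneg (δ := δ) hr0 hδ0)
  rw [Real.sqrt_sq hL0.le, ← hr] at hcv
  have hsub : Ioc a b ∩ {ε | R ε ≤ L ^ 2} ⊆ Ioc a b := inter_subset_left
  have hpt : ∀ ε ∈ Ioc a b, ENNReal.ofReal (S.overlapVar √(R ε)) ≤ ENNReal.ofReal B +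
      (Ioc a b ∩ {ε | R ε ≤ L ^ 2}).indicator
        (fun ε => ENNReal.ofReal (S.fluct r δ √(R ε) / R ε)) ε := by
    intro ε hε
    have hRε : a ≤ R ε := hε.1.le.trans (hRa ε hε)
    have hR0 : 0 < R ε := ha.trans_le hRε
    by_cases hle : R ε ≤ L ^ 2
    · have hmem : ε ∈ Ioc a b ∩ {ε | R ε ≤ L ^ 2} := ⟨hε, hle⟩
      rw [indicator_of_mem hmem, ← ENNReal.ofReal_add (by positivity)
        (div_nonneg (S.fluct_nonneg hr0 hδ0 _) hR0.le)]
      refine ENNReal.ofReal_le_ofReal ?_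
      have h := S.overlapVar_le_fluct hL hnL hr0 hr1 hδr (Real.sqrt_le_sqrt hRε)
        (Real.sqrt_le_iff.2 ⟨hL0.le, hle⟩)
      rw [Real.sq_sqrt hR0.le] at h
      refine h.trans (add_le_add ?_ le_rfl)
      rw [hB]
      gcongr
      linarith
    · rw [indicator_of_notMem (fun h => hle h.2), add_zero]
      refine ENNReal.ofReal_le_ofReal ?_
      refine (S.overlapVar_le_tail hn (Real.sqrt_pos.2 hR0)).trans ?_
      have e : √(R ε) ^ 4 = R ε ^ 2 := by
        rw [show √(R ε) ^ 4 = (√(R ε) ^ 2) ^ 2 by ring, Real.sq_sqrt hR0.le]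
      have h1 : r ^ 4 * L ^ 4 ≤ R ε ^ 2 := by
        have : L ^ 4 ≤ R ε ^ 2 := by
          rw [show L ^ 4 = (L ^ 2) ^ 2 by ring]
          have := (not_le.1 hle).le
          gcongr
        exact (mul_le_of_le_one_left (by positivity) hra4).trans this
      have h2 : r ^ 4 * L ^ 4 ≤ n := by
        rw [hnL]
        exact (mul_le_of_le_one_left (by positivity) hra4).trans
          (pow_le_pow_right₀ hL (by norm_num))
      have h3 : 2 * κ / √(R ε) ^ 4 ≤ 2 * κ / (r ^ 4 * L ^ 4) := by
        rw [e]; gcongr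
      have h4 : 2 * S.M ^ 4 / n ≤ 2 * S.M ^ 4 / (r ^ 4 * L ^ 4) := by gcongr
      have h5 : 0 ≤ 448 * S.varConst / (r ^ 4 * L ^ 4) := by positivity
      rw [hB, add_div, add_div]
      linarith
  have hfl := S.lintegral_fluct_le hn hr0 (hr1.trans hL) hδ0 hδr
  have hreal : 2 / r * (2 / n ^ 2 * (n * (4 * S.M ^ 2 * (L - r) + 2 * κ / r)) +
        4 * (8 * S.M ^ 2 + 3 * κ) / (r * n) *
          (2 * δ * (n * (4 * S.M ^ 2 * (L - r + 2 * δ) + 3 * κ / r)))) ≤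
      2 * (8 * S.M ^ 2 + 4 * κ + 8 * (8 * S.M ^ 2 + 3 * κ) * (12 * S.M ^ 2 + 3 * κ)) /
        (r ^ 4 * L ^ 4) := by
    have g1 : 4 * S.M ^ 2 * (L - r) + 2 * κ / r ≤ (4 * S.M ^ 2 + 2 * κ) * L ^ 12 / r ^ 3 := by
      have x1 : L - r ≤ L ^ 12 / r ^ 3 := by
        rw [le_div_iff₀ (by positivity)]
        have y1 : (L - r) * r ^ 3 ≤ L * 1 := by
          have : r ^ 3 ≤ 1 := pow_le_one₀ hr0.le hr1
          have : 0 ≤ L - r := by linarith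
          gcongr
          linarith
        have y2 : L ≤ L ^ 12 := le_self_pow₀ hL (by norm_num)
        linarith
      have x2 : 1 / r ≤ L ^ 12 / r ^ 3 := by
        have y1 : r ^ 3 ≤ r := pow_le_of_le_one hr0.le hr1 (by norm_num)
        have y2 : 1 ≤ L ^ 12 := one_le_pow₀ hL
        gcongr
      have e : (4 * S.M ^ 2 + 2 * κ) * L ^ 12 / r ^ 3 =
        4 * S.M ^ 2 * (L ^ 12 / r ^ 3) + 2 * κ * (L ^ 12 / r ^ 3) := by ring
      have e2 : 2 * κ / r = 2 * κ * (1 / r) := by ring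
      rw [e, e2]
      gcongr
    have g2 : 4 * S.M ^ 2 * (L - r + 2 * δ) + 3 * κ / r ≤ (12 * S.M ^ 2 + 3 * κ) * L / r ^ 2 := by
      have x1 : L - r + 2 * δ ≤ 3 * (L / r ^ 2) := by
        have y1 : L ≤ L / r ^ 2 := by
          rw [le_div_iff₀ (by positivity)]
          exact mul_le_of_le_one_right hL0.le (pow_le_one₀ hr0.le hr1)
        linarith
      have x2 : 1 / r ≤ L / r ^ 2 := by
        have y1 : r ^ 2 ≤ r := pow_le_of_le_one hr0.le hr1 (by norm_num)
        gcongr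
      have e : (12 * S.M ^ 2 + 3 * κ) * L / r ^ 2 =
        4 * S.M ^ 2 * (3 * (L / r ^ 2)) + 3 * κ * (L / r ^ 2) := by ring
      have e2 : 3 * κ / r = 3 * κ * (1 / r) := by ring
      rw [e, e2]
      gcongr
    have g3 : 2 / r * (2 / n ^ 2 * (n * (4 * S.M ^ 2 * (L - r) + 2 * κ / r)) +
        4 * (8 * S.M ^ 2 + 3 * κ) / (r * n) *
          (2 * δ * (n * (4 * S.M ^ 2 * (L - r + 2 * δ) + 3 * κ / r)))) ≤
        2 / r * (2 / n ^ 2 * (n * ((4 * S.M ^ 2 + 2 * κ) * L ^ 12 / r ^ 3)) +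
        4 * (8 * S.M ^ 2 + 3 * κ) / (r * n) *
          (2 * δ * (n * ((12 * S.M ^ 2 + 3 * κ) * L / r ^ 2)))) := by gcongr
    refine g3.trans (le_of_eq ?_)
    rw [hnL, hδ]
    field_simp
    ring
  calc ∫⁻ ε in Ioc a b, ENNReal.ofReal (S.overlapVar √(R ε))
      ≤ ∫⁻ ε in Ioc a b, (ENNReal.ofReal B + (Ioc a b ∩ {ε | R ε ≤ L ^ 2}).indicator
        (fun ε => ENNReal.ofReal (S.fluct r δ √(R ε) / R ε)) ε) :=
        setLIntegral_mono' measurableSet_Ioc hpt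
    _ = (∫⁻ ε in Ioc a b, ENNReal.ofReal B) + ∫⁻ ε in Ioc a b ∩ {ε | R ε ≤ L ^ 2},
          ENNReal.ofReal (S.fluct r δ √(R ε) / R ε) := by
        rw [lintegral_add_left measurable_const, setLIntegral_indicator hsm,
          inter_eq_left.2 hsub]
    _ ≤ ENNReal.ofReal B + ENNReal.ofReal (2 * (8 * S.M ^ 2 + 4 * κ +
          8 * (8 * S.M ^ 2 + 3 * κ) * (12 * S.M ^ 2 + 3 * κ)) / (r ^ 4 * L ^ 4)) := by
        refine add_le_add (hvol B) (hcv.trans ((mul_le_mul_right hfl _).trans ?_))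
        rw [← ENNReal.ofReal_mul (by positivity)]
        exact ENNReal.ofReal_le_ofReal hreal
    _ ≤ ENNReal.ofReal (overlapConst S.M S.D / (r ^ 4 * L ^ 4)) := by
        rw [← ENNReal.ofReal_add (by positivity) (by positivity), hB, ← add_div, hC]
        refine ENNReal.ofReal_le_ofReal ?_
        gcongr
        norm_num

end Model

/-! ### Linear combinations of Gaussian noises -/

open scoped NNReal

lemma measurePreserving_gaussian_add {J : Type*} [Fintype J] (v₁ v₂ : ℝ≥0) (c : ℝ) :
    MeasurePreserving (fun z : (J → ℝ) × (J → ℝ) => fun j => c * z.1 j + z.2 j)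
      ((Measure.pi fun _ => gaussianReal 0 v₁).prod (Measure.pi fun _ => gaussianReal 0 v₂))
      (Measure.pi fun _ => gaussianReal 0 (‖c‖₊ ^ 2 * v₁ + v₂)) := by
  have h1 : MeasurePreserving (fun z : ℝ × ℝ => c * z.1 + z.2)
      ((gaussianReal 0 v₁).prod (gaussianReal 0 v₂)) (gaussianReal 0 (‖c‖₊ ^ 2 * v₁ + v₂)) := by
    have e : MeasurePreserving (c * ·) (gaussianReal 0 v₁) (gaussianReal 0 (‖c‖₊ ^ 2 * v₁)) := by
      refine ⟨by fun_prop, ?_⟩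
      rw [gaussianReal_map_const_mul, mul_zero]
      congr 2
      ext
      simp
    have h : MeasurePreserving (fun z : ℝ × ℝ => z.1 + z.2)
        ((gaussianReal 0 (‖c‖₊ ^ 2 * v₁)).prod (gaussianReal 0 v₂))
        (gaussianReal 0 (‖c‖₊ ^ 2 * v₁ + v₂)) := by
      refine ⟨by fun_prop, ?_⟩
      have := gaussianReal_conv_gaussianReal (m₁ := 0) (m₂ := 0) (v₁ := ‖c‖₊ ^ 2 * v₁) (v₂ := v₂)
      rwa [add_zero] at this
    exact h.comp (e.prod (MeasurePreserving.id _))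
  have h2 := (measurePreserving_arrowProdEquivProdArrow ℝ ℝ J (fun _ => gaussianReal 0 v₁)
    (fun _ => gaussianReal 0 v₂)).symm
  exact (measurePreserving_pi _ _ fun _ => h1).comp h2

lemma measurePreserving_gaussian_sum {J : Type*} [Fintype J] : ∀ {K : ℕ} (w : Fin K → ℝ),
    MeasurePreserving (fun z : Fin K → J → ℝ => fun j => ∑ l, w l * z l j)
      (Measure.pi fun _ => stdNoise J) (Measure.pi fun _ => gaussianReal 0 (∑ l, ‖w l‖₊ ^ 2))
  | 0, w => by
    refine ⟨by fun_prop, ?_⟩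
    simp only [Finset.univ_eq_empty, Finset.sum_empty, Measure.map_const, measure_univ, one_smul,
      gaussianReal_zero_var]
    refine (Measure.pi_eq (μ := fun _ : J => Measure.dirac (0 : ℝ)) fun s hs => ?_).symm
    rw [Measure.dirac_apply' _ (.univ_pi hs)]
    classical
    simp only [Measure.dirac_apply' _ (hs _), Set.indicator, mem_univ_pi, Pi.one_apply]
    rw [Finset.prod_ite_zero]
    simp
  | K + 1, w => by
    have h1 := measurePreserving_piFinSuccAbove (fun _ : Fin (K + 1) => stdNoise J) 0
    have h2 := measurePreserving_gaussian_sum (J := J) fun l : Fin K => w l.succ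
    have h3 := (MeasurePreserving.id (stdNoise J)).prod h2
    have h4 := ((measurePreserving_gaussian_add 1 (∑ l : Fin K, ‖w l.succ‖₊ ^ 2) (w 0)).comp
      h3).comp h1
    rw [mul_one, ← Fin.sum_univ_succ fun l => ‖w l‖₊ ^ 2] at h4
    convert! h4 using 1
    ext z j
    simp only [Fin.sum_univ_succ]
    rfl

/-- Square roots of nonnegative numbers are proportional to a unit vector, also when all of them
vanish. -/
lemma exists_unit_weights {ι : Type*} [Fintype ι] [Nonempty ι] {g : ι → ℝ} (hg : ∀ l, 0 ≤ g l) :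
    ∃ w : ι → ℝ, ∑ l, w l ^ 2 = 1 ∧ ∀ l, √(g l) = √(∑ l, g l) * w l := by
  classical
  have h0 : 0 ≤ ∑ l, g l := Finset.sum_nonneg fun l _ => hg l
  rcases h0.eq_or_lt with h | h
  · refine ⟨Pi.single (Classical.arbitrary ι) 1, ?_, fun l => ?_⟩
    · simp [Pi.single_apply]
    · rw [(Finset.sum_eq_zero_iff_of_nonneg fun l _ => hg l).1 h.symm l (Finset.mem_univ l), ← h]
      simp
  · refine ⟨fun l => √(g l) / √(∑ l, g l), ?_, fun l => ?_⟩
    · simp only [div_pow, Real.sq_sqrt (hg _), Real.sq_sqrt h0]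
      rw [← Finset.sum_div, div_self h.ne']
    · rw [mul_div_cancel₀ _ (Real.sqrt_pos.2 h).ne']

/-- Noises weighted by `√(g l)` act as a single standard noise weighted by `√(∑ l, g l)`. -/
lemma exists_combined_noise {J : Type*} [Fintype J] {K : ℕ} [NeZero K] {g : Fin K → ℝ}
    (hg : ∀ l, 0 ≤ g l) :
    ∃ T : (Fin K → J → ℝ) → J → ℝ,
      MeasurePreserving T (Measure.pi fun _ => stdNoise J) (stdNoise J) ∧
      ∀ z j, ∑ l, √(g l) * z l j = √(∑ l, g l) * T z j := by
  obtain ⟨w, hw, hgw⟩ := exists_unit_weights hg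
  refine ⟨fun z j => ∑ l, w l * z l j, ?_, fun z j => ?_⟩
  · have e : ∑ l, ‖w l‖₊ ^ 2 = 1 := by
      ext
      simp [hw]
    have h := measurePreserving_gaussian_sum (J := J) w
    rwa [e] at h
  · simp only [hgw, Finset.mul_sum, mul_assoc]

lemma exists_combined_noise_two {J : Type*} [Fintype J] {g₁ g₂ : ℝ} (h₁ : 0 ≤ g₁) (h₂ : 0 ≤ g₂) :
    ∃ T : (J → ℝ) × (J → ℝ) → J → ℝ,
      MeasurePreserving T ((stdNoise J).prod (stdNoise J)) (stdNoise J) ∧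
      ∀ z j, √g₁ * z.1 j + √g₂ * z.2 j = √(g₁ + g₂) * T z j := by
  obtain ⟨T, hT, h⟩ := exists_combined_noise (J := J) (K := 2) (g := ![g₁, g₂])
    (by simp [Fin.forall_fin_two, h₁, h₂])
  have hp := (measurePreserving_piFinTwo fun _ : Fin 2 => stdNoise J).symm
  refine ⟨_, hT.comp hp, fun z j => ?_⟩
  have := h ((MeasurableEquiv.piFinTwo fun _ => J → ℝ).symm z) j
  simpa [Fin.sum_univ_two] using this

/-! ### The spiked matrix model -/

/-- Truncation of a real number to `[-M, M]`. -/
def clip (M t : ℝ) : ℝ := max (-M) (min M t)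

@[fun_prop]
lemma measurable_clip (M : ℝ) : Measurable (clip M) := by
  unfold clip
  fun_prop

lemma abs_clip_le {M : ℝ} (hM : 0 ≤ M) (t : ℝ) : |clip M t| ≤ M :=
  abs_le.2 ⟨le_max_left _ _, max_le (by linarith) (min_le_left _ _)⟩

lemma clip_eq {M t : ℝ} (ht : |t| ≤ M) : clip M t = t := by
  have := abs_le.1 ht
  unfold clip
  rw [min_eq_right this.2, max_eq_right this.1]

lemma card_upperPairs_le (n : ℕ) : Fintype.card (UpperPairs n) ≤ n ^ 2 := by
  refine (Fintype.card_subtype_le _).trans_eq ?_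
  simp [sq]

lemma card_upperPairs_touching_le {n : ℕ} (i : Fin n) :
    (Finset.univ.filter fun p : UpperPairs n => p.1.1 = i ∨ p.1.2 = i).card ≤ n := by
  have h := Finset.card_le_card_of_injOn (s := Finset.univ.filter
    fun p : UpperPairs n => p.1.1 = i ∨ p.1.2 = i) (t := (Finset.univ : Finset (Fin n)))
    (fun p => if p.1.1 = i then p.1.2 else p.1.1) (fun _ _ => Finset.mem_univ _) ?_
  · simpa using h
  · rintro ⟨⟨a, b⟩, hab⟩ hp ⟨⟨c, d⟩, hcd⟩ hq h
    simp only [Finset.coe_filter, Finset.mem_univ, true_and, mem_ofPred_eq] at hp hq h hab hcd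
    rw [Subtype.mk.injEq, Prod.mk.injEq]
    grind

/-- The features of the matrix channel with signal-to-noise ratio `γ`, for clipped coordinates. -/
def matFeature {n : ℕ} (M γ : ℝ) (x : Fin n → ℝ) (p : UpperPairs n) : ℝ :=
  √γ * (clip M (x p.1.1) * clip M (x p.1.2)) / √(n : ℝ)

lemma abs_matFeature_le {n : ℕ} {M : ℝ} (hM : 0 ≤ M) (γ : ℝ) (x : Fin n → ℝ) (p : UpperPairs n) :
    |matFeature M γ x p| ≤ √γ * M ^ 2 / √(n : ℝ) := by
  unfold matFeature
  rw [abs_div, abs_mul, abs_mul, abs_of_nonneg (Real.sqrt_nonneg _),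
    abs_of_nonneg (Real.sqrt_nonneg _), sq]
  have h1 := abs_clip_le hM (x p.1.1)
  have h2 := abs_clip_le hM (x p.1.2)
  gcongr

/-- The inference model with one matrix channel of signal-to-noise ratio `γ ≤ 1 / Δ`. The
coordinates are clipped to `[-M, M]`, which changes nothing under a prior supported there. The
constants do not depend on `γ`. -/
@[reducible]
def spikedModel {n : ℕ} (hn : 1 ≤ n) (P₀ : Measure ℝ) [IsProbabilityMeasure P₀] {M γ Δ : ℝ}
    (hM : 1 ≤ M) (hγ0 : 0 ≤ γ) (hγ : γ ≤ 1 / Δ) : Model n (UpperPairs n) where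
  P₀ := P₀
  prob := inferInstance
  c := clip M
  M := M
  one_le_M := hM
  measurable_c := measurable_clip M
  abs_c_le := abs_clip_le (by linarith)
  Φ := matFeature M γ
  measurable_Φ := by
    unfold matFeature
    fun_prop
  β := fun _ => √γ * M ^ 2 / √(n : ℝ)
  abs_Φ_le := abs_matFeature_le (by linarith) γ
  D := 2 * M ^ 4 * (1 / Δ)
  sum_β_le := by
    have hn0 : (0 : ℝ) < n := by positivity
    have hcard : (Fintype.card (UpperPairs n) : ℝ) ≤ n ^ 2 := by
      exact_mod_cast card_upperPairs_le n
    rw [Finset.sum_const, Finset.card_univ, nsmul_eq_mul, div_pow, mul_pow, Real.sq_sqrt hγ0,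
      Real.sq_sqrt hn0.le]
    calc (Fintype.card (UpperPairs n) : ℝ) * (γ * (M ^ 2) ^ 2 / n)
        ≤ n ^ 2 * (γ * (M ^ 2) ^ 2 / n) := by gcongr
      _ = n * (M ^ 4 * γ) := by field_simp
      _ ≤ n * (2 * M ^ 4 * (1 / Δ)) := by
        have : 0 ≤ M ^ 4 := by positivity
        have : M ^ 4 * γ ≤ M ^ 4 * (1 / Δ) := by gcongr
        have : 0 ≤ M ^ 4 * (1 / Δ) := mul_nonneg ‹_› (hγ0.trans hγ)
        gcongr
        linarith
  abs_sum_Φ_update_le := by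
    intro x s i t
    have hn0 : (0 : ℝ) < n := by positivity
    set B := √γ * M ^ 2 / √(n : ℝ) with hB
    have hB0 : 0 ≤ B := by positivity
    have hb := abs_matFeature_le (n := n) (M := M) (by linarith) γ
    have hterm : ∀ p : UpperPairs n, |matFeature M γ x p *
        (matFeature M γ (Function.update s i t) p - matFeature M γ s p)| ≤
        if p.1.1 = i ∨ p.1.2 = i then B * (2 * B) else 0 := by
      intro p
      split_ifs with h
      · rw [abs_mul]
        refine mul_le_mul (hb x p) ((abs_sub _ _).trans ?_) (abs_nonneg _) hB0
        linarith [hb (Function.update s i t) p, hb s p]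
      · push Not at h
        simp [matFeature, Function.update_of_ne h.1, Function.update_of_ne h.2]
    refine (Finset.abs_sum_le_sum_abs _ _).trans ((Finset.sum_le_sum fun p _ => hterm p).trans ?_)
    rw [← Finset.sum_filter, Finset.sum_const, nsmul_eq_mul]
    have hcard := card_upperPairs_touching_le i
    have hBB : B * (2 * B) = 2 * M ^ 4 * γ / n := by
      have : B ^ 2 = M ^ 4 * γ / n := by
        rw [hB, div_pow, mul_pow, Real.sq_sqrt hγ0, Real.sq_sqrt hn0.le]
        ring
      linear_combination 2 * this
    calc _ ≤ (n : ℝ) * (B * (2 * B)) := by gcongr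
      _ = 2 * M ^ 4 * γ := by rw [hBB]; field_simp
      _ ≤ _ := by gcongr

/-! ### Reduction of the interpolating Hamiltonian to a single matrix and mean-field channel -/

lemma hMat_zero {n : ℕ} (x s : Fin n → ℝ) (z : UpperPairs n → ℝ) : hMat x s z 0 = 0 := by
  simp [hMat]

lemma hMf_zero {n : ℕ} (x s z : Fin n → ℝ) : hMf x s z 0 = 0 := by
  simp [hMf]

lemma sum_hMat {n K : ℕ} (x s : Fin n → ℝ) (z : Fin K → UpperPairs n → ℝ) (g : Fin K → ℝ)
    {w : UpperPairs n → ℝ} (hw : ∀ p, ∑ l, √(g l) * z l p = √(∑ l, g l) * w p) :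
    ∑ l, hMat x s (z l) (g l) = hMat x s w (∑ l, g l) := by
  unfold hMat
  rw [Finset.sum_comm]
  refine Finset.sum_congr rfl fun p _ => ?_
  rw [Finset.sum_sub_distrib, ← Finset.sum_mul]
  congr 1
  have e : √(∑ l, g l) * (x p.1.1 * x p.1.2 * w p) / √(n : ℝ) =
      x p.1.1 * x p.1.2 / √(n : ℝ) * (√(∑ l, g l) * w p) := by ring
  rw [e, ← hw, Finset.mul_sum]
  exact Finset.sum_congr rfl fun l _ => by ring

lemma sum_hMf {n K : ℕ} (x s : Fin n → ℝ) (z : Fin K → Fin n → ℝ) (g : Fin K → ℝ)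
    {w : Fin n → ℝ} (hw : ∀ i, ∑ l, √(g l) * z l i = √(∑ l, g l) * w i) :
    ∑ l, hMf x s (z l) (g l) = hMf x s w (∑ l, g l) := by
  unfold hMf
  rw [Finset.sum_comm]
  refine Finset.sum_congr rfl fun i _ => ?_
  rw [Finset.sum_sub_distrib, ← Finset.sum_mul]
  congr 1
  have e : √(∑ l, g l) * (x i * w i) = x i * (√(∑ l, g l) * w i) := by ring
  rw [e, ← hw, Finset.mul_sum]
  exact Finset.sum_congr rfl fun l _ => by ring

lemma hMf_add_hMf {n : ℕ} (x s : Fin n → ℝ) (z₁ z₂ : Fin n → ℝ) (g₁ g₂ : ℝ)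
    {w : Fin n → ℝ} (hw : ∀ i, √g₁ * z₁ i + √g₂ * z₂ i = √(g₁ + g₂) * w i) :
    hMf x s z₁ g₁ + hMf x s z₂ g₂ = hMf x s w (g₁ + g₂) := by
  unfold hMf
  rw [← Finset.sum_add_distrib]
  refine Finset.sum_congr rfl fun i _ => ?_
  have e : √(g₁ + g₂) * (x i * w i) = x i * (√(g₁ + g₂) * w i) := by ring
  rw [e, ← hw]
  ring

/-- Signal-to-noise ratios of the `K` matrix channels at step `k` and time `t`; absent channels have
ratio `0`. -/
def matSnr {K : ℕ} (Δ : ℝ) (k : Fin K) (t : ℝ) (l : Fin K) : ℝ :=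
  if l ∈ Finset.Ioi k then 1 / (K * Δ) else if l = k then (1 - t) / (K * Δ) else 0

/-- Signal-to-noise ratios of the first `K` mean-field channels at step `k` and time `t`; absent
channels have ratio `0`. -/
def mfSnr {K : ℕ} (Δ : ℝ) (m : Fin K → ℝ) (k : Fin K) (t : ℝ) (l : Fin K) : ℝ :=
  if l ∈ Finset.Iio k then m l / (K * Δ) else if l = k then t * m k / (K * Δ) else 0

lemma sum_add_eq_sum_ite {ι : Type*} [Fintype ι] [DecidableEq ι] {F : ι → ℝ → ℝ}
    (hF : ∀ l, F l 0 = 0) {s : Finset ι} {k : ι} (hk : k ∉ s) (A : ι → ℝ) (B : ℝ) :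
    ∑ l ∈ s, F l (A l) + F k B = ∑ l, F l (if l ∈ s then A l else if l = k then B else 0) := by
  have e : ∀ l, F l (if l ∈ s then A l else if l = k then B else 0) =
      (if l ∈ s then F l (A l) else 0) + if l = k then F k B else 0 := by
    intro l
    by_cases h : l = k
    · subst h
      simp [hk]
    · by_cases h' : l ∈ s <;> simp [h, h', hF]
  simp only [e, Finset.sum_add_distrib]
  simp

lemma hamiltonian_eq_sum {n K : ℕ} (Δ : ℝ) (m : Fin K → ℝ) (k : Fin K) (t ε : ℝ)
    (θ : Quenched n K) (x : Fin n → ℝ) :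
    hamiltonian Δ m k t ε θ x = ∑ l, hMat x θ.1 (θ.2.1 l) (matSnr Δ k t l) +
      (∑ l, hMf x θ.1 (θ.2.2.1 l) (mfSnr Δ m k t l) + hMf x θ.1 θ.2.2.2 ε) := by
  have h1 := sum_add_eq_sum_ite (F := fun l => hMat x θ.1 (θ.2.1 l)) (fun l => hMat_zero _ _ _)
    (s := Finset.Ioi k) (k := k) (by simp) (fun _ => 1 / (K * Δ)) ((1 - t) / (K * Δ))
  have h2 := sum_add_eq_sum_ite (F := fun l => hMf x θ.1 (θ.2.2.1 l)) (fun l => hMf_zero _ _ _)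
    (s := Finset.Iio k) (k := k) (by simp) (fun l => m l / (K * Δ)) (t * m k / (K * Δ))
  unfold matSnr mfSnr
  rw [← h1, ← h2]
  unfold hamiltonian
  ring

/-- The total signal-to-noise ratio of the mean-field channels, including the perturbation. -/
def totalMfSnr {K : ℕ} (Δ : ℝ) (m : Fin K → ℝ) (k : Fin K) (t ε : ℝ) : ℝ :=
  ∑ l, mfSnr Δ m k t l + ε

lemma matSnr_nonneg {K : ℕ} {Δ t : ℝ} (hΔ : 0 < Δ) (k : Fin K) (ht1 : t ≤ 1) (l : Fin K) :
    0 ≤ matSnr Δ k t l := by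
  have : 0 ≤ 1 - t := by linarith
  unfold matSnr
  split_ifs <;> positivity

lemma mfSnr_nonneg {K : ℕ} {Δ t : ℝ} (hΔ : 0 < Δ) {m : Fin K → ℝ} (hm : ∀ l, 0 ≤ m l) (k : Fin K)
    (ht0 : 0 ≤ t) (l : Fin K) : 0 ≤ mfSnr Δ m k t l := by
  have h1 := hm l
  have h2 := hm k
  unfold mfSnr
  split_ifs <;> positivity

lemma sum_matSnr_le {K : ℕ} {Δ t : ℝ} (hΔ : 0 < Δ) (k : Fin K) (ht0 : 0 ≤ t) :
    ∑ l, matSnr Δ k t l ≤ 1 / Δ := by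
  have hK : (0 : ℝ) < K := by
    have := k.pos
    positivity
  have h : ∀ l ∈ Finset.univ, matSnr Δ k t l ≤ 1 / (K * Δ) := by
    intro l _
    unfold matSnr
    split_ifs
    · exact le_rfl
    · gcongr
      linarith
    · positivity
  refine (Finset.sum_le_sum h).trans_eq ?_
  simp only [Finset.sum_const, Finset.card_univ, Fintype.card_fin, nsmul_eq_mul]
  field_simp

lemma hMat_eq_potential {n : ℕ} {M γ : ℝ} (hγ : 0 ≤ γ) {x s : Fin n → ℝ} (hx : ∀ i, |x i| ≤ M)
    (hs : ∀ i, |s i| ≤ M) (z : UpperPairs n → ℝ) :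
    hMat x s z γ = potential (matFeature M γ) (matFeature M γ s + z) x := by
  unfold hMat potential matFeature
  rw [Finset.sum_div, ← Finset.sum_sub_distrib]
  refine Finset.sum_congr rfl fun p _ => ?_
  simp only [Pi.add_apply, clip_eq (hx _), clip_eq (hs _)]
  have h1 : √(n : ℝ) ^ 2 = n := Real.sq_sqrt (by positivity)
  have h2 : √γ ^ 2 = γ := Real.sq_sqrt hγ
  have e1 : (√γ * (x p.1.1 * x p.1.2) / √(n : ℝ)) ^ 2 =
      γ * (x p.1.1 ^ 2 * x p.1.2 ^ 2) / n := by
    rw [div_pow, mul_pow, h1, h2, mul_pow]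
  have e2 : √γ * (x p.1.1 * x p.1.2) / √(n : ℝ) * (√γ * (s p.1.1 * s p.1.2) / √(n : ℝ)) =
      γ * (x p.1.1 * x p.1.2 * (s p.1.1 * s p.1.2)) / n := by
    rw [div_mul_div_comm, ← sq, h1]
    rw [show √γ * (x p.1.1 * x p.1.2) * (√γ * (s p.1.1 * s p.1.2)) =
      √γ ^ 2 * (x p.1.1 * x p.1.2 * (s p.1.1 * s p.1.2)) by ring, h2]
  rw [e1, mul_add, e2]
  ring

lemma hMf_eq_potential {n : ℕ} {M γ : ℝ} (hγ : 0 ≤ γ) {x s : Fin n → ℝ} (hx : ∀ i, |x i| ≤ M)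
    (hs : ∀ i, |s i| ≤ M) (z : Fin n → ℝ) :
    hMf x s z γ = potential (fun x i => √γ * clip M (x i))
      ((fun i => √γ * clip M (s i)) + z) x := by
  unfold hMf potential
  rw [Finset.sum_div, ← Finset.sum_sub_distrib]
  refine Finset.sum_congr rfl fun i _ => ?_
  simp only [Pi.add_apply, clip_eq (hx _), clip_eq (hs _)]
  have h2 : √γ ^ 2 = γ := Real.sq_sqrt hγ
  rw [mul_pow, h2, mul_add, show √γ * x i * (√γ * s i) = √γ ^ 2 * (x i * s i) by ring, h2]
  ring

lemma potential_sum_elim {X ι κ : Type*} [Fintype ι] [Fintype κ] (f : X → ι → ℝ) (g : X → κ → ℝ)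
    (y : ι → ℝ) (z : κ → ℝ) (x : X) :
    potential (fun x => Sum.elim (f x) (g x)) (Sum.elim y z) x =
      potential f y x + potential g z x := by
  unfold potential
  simp only [Fintype.sum_sum_type, Sum.elim_inl, Sum.elim_inr]
  ring

lemma measurable_quenchedGibbs {T : Type*} [MeasurableSpace T] (P₀ : Measure ℝ)
    [IsProbabilityMeasure P₀] {n K : ℕ} (Δ : ℝ) (k : Fin K) {m : T → Fin K → ℝ} {t ε : T → ℝ}
    (hm : Measurable m) (ht : Measurable t) (hε : Measurable ε)
    {g : T → (Fin n → ℝ) → (Fin n → ℝ) → ℝ}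
    (hg : Measurable fun p : T × (Fin n → ℝ) × (Fin n → ℝ) => g p.1 p.2.1 p.2.2) :
    Measurable fun r => quenchedGibbs P₀ Δ (m r) k (t r) (ε r) (g r) := by
  unfold quenchedGibbs
  have : IsProbabilityMeasure (quenchedLaw P₀ n K) := by unfold quenchedLaw; infer_instance
  refine measurable_integral_param (f := fun r θ => ∫ x, g r x θ.1
    ∂(gibbsPosterior P₀ Δ (m r) k (t r) (ε r) θ)) ?_
  refine measurable_integral_gibbs (T := T × Quenched n K)
    (H := fun q x => hamiltonian Δ (m q.1) k (t q.1) (ε q.1) q.2 x)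
    (g := fun q x => g q.1 x q.2.1) ?_ ?_
  · unfold hamiltonian hMat hMf Function.uncurry
    fun_prop
  · exact hg.comp (f := fun q : (T × Quenched n K) × (Fin n → ℝ) => (q.1.1, q.2, q.1.2.1))
      (by fun_prop)

lemma measurable_overlap {n : ℕ} :
    Measurable fun p : (Fin n → ℝ) × (Fin n → ℝ) => overlap p.1 p.2 := by
  unfold overlap
  fun_prop

lemma measurable_overlapVariance {T : Type*} [MeasurableSpace T] (P₀ : Measure ℝ)
    [IsProbabilityMeasure P₀] (n : ℕ) {K : ℕ} (Δ : ℝ) (k : Fin K) {m : T → Fin K → ℝ} {t ε : T → ℝ}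
    (hm : Measurable m) (ht : Measurable t) (hε : Measurable ε) :
    Measurable fun r => overlapVariance P₀ n Δ (m r) k (t r) (ε r) := by
  unfold overlapVariance
  have h := measurable_quenchedGibbs P₀ (n := n) Δ k hm ht hε (g := fun _ => overlap)
    (measurable_overlap.comp measurable_snd)
  refine measurable_quenchedGibbs P₀ Δ k hm ht hε ?_
  exact ((measurable_overlap.comp measurable_snd).sub (h.comp measurable_fst)).pow_const 2

lemma ae_pi_abs_le {P₀ : Measure ℝ} [IsProbabilityMeasure P₀] {M : ℝ} (hP : ∀ᵐ t ∂P₀, |t| ≤ M)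
    (n : ℕ) : ∀ᵐ x ∂(Measure.pi fun _ : Fin n => P₀), ∀ i, |x i| ≤ M := by
  rw [ae_all_iff]
  exact fun i => (measurePreserving_eval (fun _ : Fin n => P₀) i).quasiMeasurePreserving.ae hP

section Reduction

variable {n K : ℕ} {P₀ : Measure ℝ} [IsProbabilityMeasure P₀] {M Δ t ε : ℝ} {m : Fin K → ℝ}

/-- The channels of equal kind combine into a single channel, as far as the Hamiltonian is
concerned: signal-to-noise ratios add up. -/
lemma exists_combined_channel (hn : 1 ≤ n) (P₀ : Measure ℝ) [IsProbabilityMeasure P₀] (hM : 1 ≤ M)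
    (hΔ : 0 < Δ) (hm : ∀ l, 0 ≤ m l) (k : Fin K) (ht0 : 0 ≤ t) (ht1 : t ≤ 1) (hε : 0 ≤ ε) :
    ∃ T : Quenched n K → (Fin n → ℝ) × (UpperPairs n ⊕ Fin n → ℝ),
      MeasurePreserving T (quenchedLaw P₀ n K)
        ((Measure.pi fun _ => P₀).prod (stdNoise (UpperPairs n ⊕ Fin n))) ∧
      (∀ θ, (T θ).1 = θ.1) ∧
      ∀ θ x, (∀ i, |θ.1 i| ≤ M) → (∀ i, |x i| ≤ M) → hamiltonian Δ m k t ε θ x =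
        let S := spikedModel hn P₀ hM (Finset.sum_nonneg fun l _ => matSnr_nonneg hΔ k ht1 l)
          (sum_matSnr_le hΔ k ht0)
        potential (S.Ψ √(totalMfSnr Δ m k t ε))
          (S.Ψ √(totalMfSnr Δ m k t ε) (T θ).1 + (T θ).2) x := by
  have : NeZero K := ⟨k.pos.ne'⟩
  have hγ := matSnr_nonneg hΔ k ht1
  have hμ := mfSnr_nonneg hΔ hm k ht0
  have hμ0 : 0 ≤ ∑ l, mfSnr Δ m k t l := Finset.sum_nonneg fun l _ => hμ l
  obtain ⟨T₁, hT₁, h₁⟩ := exists_combined_noise (J := UpperPairs n) hγ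
  obtain ⟨T₂, hT₂, h₂⟩ := exists_combined_noise (J := Fin n) hμ
  obtain ⟨T₃, hT₃, h₃⟩ := exists_combined_noise_two (J := Fin n) hμ0 hε
  have hT := ((MeasurePreserving.id (Measure.pi fun _ : Fin n => P₀))).prod
    ((measurePreserving_sumPiEquivProdPi_symm
      (fun _ : UpperPairs n ⊕ Fin n => gaussianReal 0 1)).comp
      (hT₁.prod (hT₃.comp (hT₂.prod (MeasurePreserving.id (stdNoise (Fin n)))))))
  refine ⟨_, hT, fun θ => rfl, fun θ x hs hx => ?_⟩
  set w := T₁ θ.2.1 with hw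
  set v := T₃ (T₂ θ.2.2.1, θ.2.2.2) with hv
  set γ := ∑ l, matSnr Δ k t l
  have hγ0 : 0 ≤ γ := Finset.sum_nonneg fun l _ => hγ l
  have hv' := h₃ (T₂ θ.2.2.1, θ.2.2.2)
  rw [hamiltonian_eq_sum, sum_hMat _ _ _ _ (h₁ θ.2.1), sum_hMf _ _ _ _ (h₂ θ.2.2.1),
    hMf_add_hMf _ _ _ _ _ _ hv', hMat_eq_potential hγ0 hx hs,
    hMf_eq_potential (add_nonneg hμ0 hε) hx hs, ← potential_sum_elim]
  change potential _ _ x = potential _ _ x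
  congr 1
  ext j
  rcases j with p | i <;> rfl

/-- Averages over the interpolating posterior are averages over a model with a single matrix
channel and a single mean-field channel. -/
lemma quenchedGibbs_eq_integral_law (hn : 1 ≤ n) (hM : 1 ≤ M) (hP : ∀ᵐ t ∂P₀, |t| ≤ M)
    (hΔ : 0 < Δ) (hm : ∀ l, 0 ≤ m l) (k : Fin K) (ht0 : 0 ≤ t) (ht1 : t ≤ 1) (hε : 0 ≤ ε)
    {g f : (Fin n → ℝ) → (Fin n → ℝ) → ℝ} (hf : Measurable (Function.uncurry f)) {B : ℝ}
    (hB : ∀ s x, |f s x| ≤ B)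
    (hgf : ∀ s x, (∀ i, |s i| ≤ M) → (∀ i, |x i| ≤ M) → g x s = f s x) :
    quenchedGibbs P₀ Δ m k t ε g =
      ∫ p, f p.1.1 p.2 ∂((spikedModel hn P₀ hM (Finset.sum_nonneg fun l _ =>
        matSnr_nonneg hΔ k ht1 l) (sum_matSnr_le hΔ k ht0)).law √(totalMfSnr Δ m k t ε)) := by
  obtain ⟨T, hT, hT1, hTH⟩ := exists_combined_channel hn P₀ hM hΔ hm k ht0 ht1 hε
  set S := spikedModel hn P₀ hM (Finset.sum_nonneg fun l _ => matSnr_nonneg hΔ k ht1 l)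
    (sum_matSnr_le hΔ k ht0) with hS
  set u := √(totalMfSnr Δ m k t ε) with hu
  have hbox := ae_pi_abs_le hP n
  have hfm : Measurable fun p : ((Fin n → ℝ) × (UpperPairs n ⊕ Fin n → ℝ)) × (Fin n → ℝ) =>
      f p.1.1 p.2 :=
    hf.comp (f := fun p : ((Fin n → ℝ) × (UpperPairs n ⊕ Fin n → ℝ)) × (Fin n → ℝ) =>
      (p.1.1, p.2)) (by fun_prop)
  have hfi : Integrable (fun p : ((Fin n → ℝ) × (UpperPairs n ⊕ Fin n → ℝ)) × (Fin n → ℝ) =>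
      f p.1.1 p.2) (S.law u) :=
    (BddMeas.mk' hfm fun p => hB p.1.1 p.2).integrable _
  have hmeas : Measurable fun ω : (Fin n → ℝ) × (UpperPairs n ⊕ Fin n → ℝ) =>
      ∫ x, f ω.1 x ∂(S.G u ω) :=
    measurable_integral_gibbs (T := (Fin n → ℝ) × (UpperPairs n ⊕ Fin n → ℝ))
      (g := fun ω x => f ω.1 x) (S.measurable_H_right u) hfm
  rw [S.integral_law hfi]
  have hT' : MeasurePreserving T (quenchedLaw P₀ n K) S.μ := hT
  rw [← hT'.map_eq, integral_map hT.measurable.aemeasurable hmeas.aestronglyMeasurable]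
  unfold quenchedGibbs
  have hθ : ∀ᵐ θ ∂(quenchedLaw P₀ n K), ∀ i, |θ.1 i| ≤ M :=
    (Measure.quasiMeasurePreserving_fst
      (μ := Measure.pi fun _ : Fin n => P₀)).ae hbox
  refine integral_congr_ae (hθ.mono fun θ hs => ?_)
  have hG : gibbsPosterior P₀ Δ m k t ε θ = S.G u (T θ) := by
    rw [S.G_eq_potential]
    exact tilted_congr (hbox.mono fun x hx => congrArg Neg.neg (hTH θ x hs hx))
  simp only [hG, hT1]
  refine integral_congr_ae ?_
  have hac : S.G u (T θ) ≪ Measure.pi fun _ : Fin n => P₀ := tilted_absolutelyContinuous _ _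
  have hbox' : ∀ᵐ x ∂(S.G u (T θ)), ∀ i, |x i| ≤ M := hac.ae_le hbox
  exact hbox'.mono fun x hx => hgf _ _ hs hx

/-- The fluctuations of the overlap under the interpolating posterior are those of a model with a
single matrix channel and a single mean-field channel. -/
lemma overlapVariance_eq (hn : 1 ≤ n) (hM : 1 ≤ M) (hP : ∀ᵐ t ∂P₀, |t| ≤ M)
    (hΔ : 0 < Δ) (hm : ∀ l, 0 ≤ m l) (k : Fin K) (ht0 : 0 ≤ t) (ht1 : t ≤ 1) (hε : 0 ≤ ε) :
    overlapVariance P₀ n Δ m k t ε = (spikedModel hn P₀ hM (Finset.sum_nonneg fun l _ =>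
        matSnr_nonneg hΔ k ht1 l) (sum_matSnr_le hΔ k ht0)).overlapVar
          √(totalMfSnr Δ m k t ε) := by
  set S := spikedModel hn P₀ hM (Finset.sum_nonneg fun l _ => matSnr_nonneg hΔ k ht1 l)
    (sum_matSnr_le hΔ k ht0) with hS
  set u := √(totalMfSnr Δ m k t ε) with hu
  have hq : ∀ s x : Fin n → ℝ, (∀ i, |s i| ≤ M) → (∀ i, |x i| ≤ M) → overlap x s = S.q s x := by
    intro s x hs hx
    unfold overlap Model.q
    congr 1
    exact Finset.sum_congr rfl fun i _ => by
      change _ = clip M (x i) * clip M (s i)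
      rw [clip_eq (hx i), clip_eq (hs i)]
  unfold overlapVariance
  rw [quenchedGibbs_eq_integral_law hn hM hP hΔ hm k ht0 ht1 hε (g := overlap) S.measurable_q
    S.abs_q_le hq]
  set e := ∫ p, S.q p.1.1 p.2 ∂(S.law u) with he
  rw [quenchedGibbs_eq_integral_law hn hM hP hΔ hm k ht0 ht1 hε (f := fun s x => (S.q s x - e) ^ 2)
    ((S.measurable_q.sub_const e).pow_const 2) (B := (S.M ^ 2 + |e|) ^ 2)
    (fun s x => by
      rw [abs_pow]
      have := (abs_sub (S.q s x) e).trans (add_le_add (S.abs_q_le s x) le_rfl)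
      gcongr)
    (fun s x hs hx => by rw [hq s x hs hx])]
  exact (variance_eq_integral S.bddMeas_q_law.1.aemeasurable).symm

end Reduction

/-- No integrability is needed, as a Bochner integral that does not exist is zero. -/
lemma ofReal_integral_le_lintegral {α : Type*} [MeasurableSpace α] {μ : Measure α} {f : α → ℝ}
    (hf : ∀ᵐ x ∂μ, 0 ≤ f x) : ENNReal.ofReal (∫ x, f x ∂μ) ≤ ∫⁻ x, ENNReal.ofReal (f x) ∂μ := by
  by_cases h : Integrable f μ
  · rw [ofReal_integral_eq_lintegral_ofReal h hf]
  · simp [integral_undef h]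

lemma overlapVariance_nonneg (P₀ : Measure ℝ) (n : ℕ) {K : ℕ} (Δ : ℝ) (m : Fin K → ℝ) (k : Fin K)
    (t ε : ℝ) : 0 ≤ overlapVariance P₀ n Δ m k t ε :=
  integral_nonneg fun _ => integral_nonneg fun _ => sq_nonneg _

lemma hasDerivAt_mfSnr {K : ℕ} {Δ : ℝ} {m : Fin K → ℝ → ℝ} (k : Fin K)
    (t : ℝ) {ε : ℝ} (hd : ∀ l, DifferentiableAt ℝ (m l) ε) (l : Fin K) :
    HasDerivAt (fun ε => mfSnr Δ (fun l => m l ε) k t l)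
      (mfSnr Δ (fun l => deriv (m l) ε) k t l) ε := by
  unfold mfSnr
  split_ifs
  · exact (hd l).hasDerivAt.div_const _
  · exact ((hd k).hasDerivAt.const_mul t).div_const _
  · exact hasDerivAt_const _ _

/-- The averaged overlap fluctuations at a fixed interpolation step and time. -/
lemma lintegral_overlapVariance_le {n K : ℕ} (hn : 1 ≤ n) {P₀ : Measure ℝ} [IsProbabilityMeasure P₀]
    {M Δ t : ℝ} (hM : 1 ≤ M) (hP : ∀ᵐ t ∂P₀, |t| ≤ M) (hΔ : 0 < Δ) {m : Fin K → ℝ → ℝ}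
    (hm : ∀ l, IsTrialParameter (m l)) (k : Fin K) (ht0 : 0 ≤ t) (ht1 : t ≤ 1) {a b : ℝ}
    (ha : 0 < a) (hab : a ≤ b) (hb : b < 1) :
    ∫⁻ ε in Ioc a b, ENNReal.ofReal (overlapVariance P₀ n Δ (fun l => m l ε) k t ε) ≤
      ENNReal.ofReal (overlapConst M (2 * M ^ 4 * (1 / Δ)) / (a ^ 2 * (n : ℝ) ^ (1 / 4 : ℝ))) := by
  set S := spikedModel hn P₀ hM (Finset.sum_nonneg fun l _ => matSnr_nonneg hΔ k ht1 l)
    (sum_matSnr_le hΔ k ht0) with hS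
  have hsub : ∀ ε ∈ Ioc a b, ε ∈ Ioo (0 : ℝ) 1 := fun ε hε =>
    ⟨ha.trans hε.1, hε.2.trans_lt hb⟩
  have hd : ∀ ε ∈ Ioc a b, ∀ l, DifferentiableAt ℝ (m l) ε := fun ε hε l =>
    (hm l).differentiableOn.differentiableAt (isOpen_Ioo.mem_nhds (hsub ε hε))
  have hd0 : ∀ ε ∈ Ioc a b, ∀ l, 0 ≤ deriv (m l) ε := fun ε hε l => by
    rw [← derivWithin_of_isOpen isOpen_Ioo (hsub ε hε)]
    exact (hm l).monotoneOn.derivWithin_nonneg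
  have hn1 : (1 : ℝ) ≤ n := by exact_mod_cast hn
  have h := S.lintegral_overlapVar_le (L := (n : ℝ) ^ (1 / 16 : ℝ))
    (Real.one_le_rpow hn1 (by norm_num))
    (by rw [← Real.rpow_natCast, ← Real.rpow_mul (by positivity)]; norm_num)
    ha hab hb.le (R := fun ε => totalMfSnr Δ (fun l => m l ε) k t ε)
    (R' := fun ε => ∑ l, mfSnr Δ (fun l => deriv (m l) ε) k t l + 1)
    (fun ε hε => (HasDerivAt.fun_sum fun l _ => hasDerivAt_mfSnr k t (hd ε hε) l).add
      (hasDerivAt_id ε))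
    (fun ε hε => le_add_of_nonneg_left
      (Finset.sum_nonneg fun l _ => mfSnr_nonneg hΔ (hd0 ε hε) k ht0 l))
    (fun ε hε => le_add_of_nonneg_left (Finset.sum_nonneg fun l _ =>
      mfSnr_nonneg hΔ (fun l => (hm l).nonneg ε (hsub ε hε)) k ht0 l))
  rw [← Real.rpow_natCast ((n : ℝ) ^ (1 / 16 : ℝ)), ← Real.rpow_mul (by positivity)] at h
  rw [show (1 / 16 : ℝ) * ((4 : ℕ) : ℝ) = 1 / 4 by norm_num] at h
  refine le_trans (le_of_eq ?_) h
  refine setLIntegral_congr_fun measurableSet_Ioc fun ε hε => ?_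
  rw [overlapVariance_eq hn hM hP hΔ (fun l => (hm l).nonneg ε (hsub ε hε)) k ht0 ht1
    (hsub ε hε).1.le]

end RankOne

open RankOne in
theorem lemma3 (Δ M v α : ℝ) (hΔ : 0 < Δ) (hα₀ : 0 < α) (hα₁ : α < 1 / 4) :
    ∃ C : ℝ, 0 < C ∧
      ∀ (P₀ : Measure ℝ) [IsProbabilityMeasure P₀],
        P₀ (Icc (-M) M)ᶜ = 0 → ∫ x, x ^ 2 ∂P₀ = v →
      ∀ (K : ℕ → ℕ) (a b : ℕ → ℝ) (m : (n : ℕ) → Fin (K n) → ℝ → ℝ),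
        Tendsto K atTop atTop →
        (∀ n, 0 < a n ∧ a n < b n ∧ b n < 1) →
        (∀ n k, RankOne.IsTrialParameter (m n k)) →
        ∀ n : ℕ, 1 ≤ n →
          ∫ ε in (a n)..(b n), (1 / (K n : ℝ)) * ∑ k : Fin (K n), ∫ t in (0 : ℝ)..1,
              RankOne.overlapVariance P₀ n Δ (fun l => m n l ε) k t ε
            ≤ C / (a n ^ 2 * (n : ℝ) ^ α) := by
  set M' := max 1 |M| with hM'
  have hM1 : 1 ≤ M' := le_max_left _ _
  have hκ := Model.κ_pos
  set C := overlapConst M' (2 * M' ^ 4 * (1 / Δ)) with hC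
  have hC0 : 0 < C := by
    rw [hC]
    unfold overlapConst
    positivity
  refine ⟨C, hC0, fun P₀ _ hP _ K a b m _ hab hm n hn => ?_⟩
  obtain ⟨ha, hab, hb⟩ := hab n
  have hn1 : (1 : ℝ) ≤ n := by exact_mod_cast hn
  have hP' : ∀ᵐ t ∂P₀, |t| ≤ M' := by
    have : ∀ᵐ t ∂P₀, t ∈ Icc (-M) M := hP
    filter_upwards [this] with t ht
    exact (abs_le.2 ⟨by linarith [ht.1], ht.2⟩ : |t| ≤ M).trans
      ((le_abs_self M).trans (le_max_right _ _))
  have hrate : C / (a n ^ 2 * (n : ℝ) ^ (1 / 4 : ℝ)) ≤ C / (a n ^ 2 * (n : ℝ) ^ α) := by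
    have := Real.rpow_le_rpow_of_exponent_le hn1 hα₁.le
    gcongr
  refine le_trans ?_ hrate
  set B := C / (a n ^ 2 * (n : ℝ) ^ (1 / 4 : ℝ)) with hB
  have hB0 : 0 ≤ B := by positivity
  -- extension of the trial parameters by zero, which is measurable on the whole line
  set m' : Fin (K n) → ℝ → ℝ := fun l => (Ioo (0 : ℝ) 1).indicator (m n l) with hm'
  have hm'm : Measurable fun p : ℝ × ℝ => fun l => m' l p.2 := by
    classical
    refine measurable_pi_iff.2 fun l => ?_
    suffices Measurable (m' l) from this.comp measurable_snd
    have := (hm n l).differentiableOn.continuousOn.measurable_piecewise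
      (continuousOn_const (c := (0 : ℝ))) measurableSet_Ioo
    have e : (Ioo (0 : ℝ) 1).piecewise (m n l) (fun _ => 0) = m' l :=
      Set.piecewise_eq_indicator
    rwa [e] at this
  set F : Fin (K n) → ℝ → ℝ → ℝ := fun k t ε =>
    overlapVariance P₀ n Δ (fun l => m' l ε) k t ε with hF
  have hFm : ∀ k, Measurable (Function.uncurry (F k)) := fun k =>
    measurable_overlapVariance P₀ n Δ k hm'm measurable_fst measurable_snd
  have hFeq : ∀ k t, ∀ ε ∈ Ioc (a n) (b n),
      overlapVariance P₀ n Δ (fun l => m n l ε) k t ε = F k t ε := by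
    intro k t ε hε
    have hε' : ε ∈ Ioo (0 : ℝ) 1 := ⟨ha.trans hε.1, hε.2.trans_lt hb⟩
    simp only [hF, hm', indicator_of_mem hε']
  have hF0 : ∀ k t ε, 0 ≤ F k t ε := fun k t ε => overlapVariance_nonneg _ _ _ _ _ _ _
  have hK0 : 0 ≤ 1 / (K n : ℝ) := by positivity
  rw [intervalIntegral.integral_of_le hab.le]
  rw [setIntegral_congr_fun (g := fun ε => 1 / (K n : ℝ) * ∑ k, ∫ t in Ioc (0 : ℝ) 1, F k t ε)
    measurableSet_Ioc fun ε hε => by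
      simp only [intervalIntegral.integral_of_le zero_le_one, hFeq _ _ ε hε]]
  rw [← ENNReal.ofReal_le_ofReal_iff hB0]
  have hFs : ∀ k ε, 0 ≤ ∫ t in Ioc (0 : ℝ) 1, F k t ε := fun k ε =>
    integral_nonneg fun t => hF0 k t ε
  have hstep : ∀ k, ∫⁻ ε in Ioc (a n) (b n), ∫⁻ t in Ioc (0 : ℝ) 1, ENNReal.ofReal (F k t ε) ≤
      ENNReal.ofReal B := by
    intro k
    rw [lintegral_lintegral_swap
      ((hFm k).comp measurable_swap).ennreal_ofReal.aemeasurable]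
    calc ∫⁻ t in Ioc (0 : ℝ) 1, ∫⁻ ε in Ioc (a n) (b n), ENNReal.ofReal (F k t ε)
        ≤ ∫⁻ t in Ioc (0 : ℝ) 1, ENNReal.ofReal B := by
          refine setLIntegral_mono' measurableSet_Ioc fun t ht => ?_
          rw [setLIntegral_congr_fun (g := fun ε => ENNReal.ofReal
            (overlapVariance P₀ n Δ (fun l => m n l ε) k t ε)) measurableSet_Ioc
            fun ε hε => by simp only [hFeq k t ε hε]]
          exact lintegral_overlapVariance_le hn hM1 hP' hΔ (hm n) k ht.1.le ht.2 ha hab.le hb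
      _ = ENNReal.ofReal B := by simp
  calc ENNReal.ofReal (∫ ε in Ioc (a n) (b n), 1 / (K n : ℝ) * ∑ k, ∫ t in Ioc (0 : ℝ) 1, F k t ε)
      ≤ ∫⁻ ε in Ioc (a n) (b n),
          ENNReal.ofReal (1 / (K n : ℝ) * ∑ k, ∫ t in Ioc (0 : ℝ) 1, F k t ε) :=
        ofReal_integral_le_lintegral (.of_forall fun ε =>
          mul_nonneg hK0 (Finset.sum_nonneg fun k _ => hFs k ε))
    _ ≤ ∫⁻ ε in Ioc (a n) (b n), ENNReal.ofReal (1 / (K n : ℝ)) *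
          ∑ k, ∫⁻ t in Ioc (0 : ℝ) 1, ENNReal.ofReal (F k t ε) := by
        refine lintegral_mono fun ε => ?_
        rw [ENNReal.ofReal_mul hK0, ENNReal.ofReal_sum_of_nonneg fun k _ => hFs k ε]
        gcongr with k
        exact ofReal_integral_le_lintegral (.of_forall fun t => hF0 k t ε)
    _ = ENNReal.ofReal (1 / (K n : ℝ)) *
          ∑ k, ∫⁻ ε in Ioc (a n) (b n), ∫⁻ t in Ioc (0 : ℝ) 1, ENNReal.ofReal (F k t ε) := by
        rw [lintegral_const_mul' _ _ ENNReal.ofReal_ne_top, lintegral_finsetSum]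
        exact fun k _ => ((hFm k).comp measurable_swap).ennreal_ofReal.lintegral_prod_right'
    _ ≤ ENNReal.ofReal (1 / (K n : ℝ)) * ∑ k : Fin (K n), ENNReal.ofReal B := by
        gcongr with k
        exact hstep k
    _ ≤ ENNReal.ofReal B := by
        rw [Finset.sum_const, Finset.card_univ, Fintype.card_fin, nsmul_eq_mul, ← mul_assoc,
          ← ENNReal.ofReal_natCast, ← ENNReal.ofReal_mul hK0]
        refine mul_le_of_le_one_left' ?_
        rw [← ENNReal.ofReal_one]
        refine ENNReal.ofReal_le_ofReal ?_
        rw [one_div]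
        exact inv_mul_le_one

end
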